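/- **Setting.** Fix an even integer $\mathfrak q\ge 4$, a real number $a>0$, and a translation invariant operator $\mathbf h_0$ on $L^2(\mathbb Z^3)$ with summable kernel whose Fourier transform $\hat{\mathbf h}_0$ is entire, invariant under $\mathbf p_\nu\to-\mathbf p_\nu$ for each $\nu$, nonnegative for real $\mathbf p$, strictly positive on $\mathbb R^3\setminus 2\pi\mathbb Z^3$, vanishes together with its first derivatives at $0$, and has positive definite Hessian at $0$. For an odd integer $L\ge 1$, integers $n\ge1$, $N_t,N_s\ge 1$, put $\varepsilon_j=L^{-j}$, $L_0=L^2$, $L_\nu=L$ ($\nu=1,2,3$), $\varepsilon_{n,\nu}=L_\nu^{-n}$, and for $0\le j\le n$ let $$\mathcal X_j^{(n-j)}=(\varepsilon_j^2\mathbb Z/N_t\mathbb Z)\times(\varepsilon_j\mathbb Z^3/N_s\mathbb Z^3),$$ with $\int du=\varepsilon_j^5\sum_u$; $\mathcal H_j^{(n-j)}$ is the space of complex functions on $\mathcal X_j^{(n-j)}$ with the real (bilinear) inner product $\int\alpha_1\alpha_2$, and $*$ denotes the adjoint with respect to these inner products. Write $\mathcal H_n=\mathcal H_n^{(0)}$ (fine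 lattice, spacing $\varepsilon_n^2,\varepsilon_n$); $\mathcal H^{(n)}_0$ lives on the unit lattice. For an operator $A$ on $\mathcal H^{(n)}_0$ with kernel $A(u,u')$, $$\|A\|_m=\max\Big\{\sup_u\int du'\,e^{m|u-u'|}|A(u,u')|,\ \sup_{u'}\int du\,e^{m|u-u'|}|A(u,u')|\Big\},$$ where $|u-u'|$ is the Euclidean distance on the torus. * *Averaging.* Let $q=L^{-5\mathfrak q}\,1_\square*\cdots*1_\square$ ($\mathfrak q$ factors), where $1_\square$ is the characteristic function in $\mathbb Z\times\mathbb Z^3$ of $[-\frac{L^2-1}2,\frac{L^2-1}2]\times[-\frac{L-1}2,\frac{L-1}2]^3$. For $1\le j\le n$ let $Q^{(j)}:\mathcal H_j^{(n-j)}\to\mathcal H_{j-1}^{(n-j+1)}$ be $(Q^{(j)}\psi)(y)=\sum_{x}q(x)\,\psi(y+[(\varepsilon_j^2x_0,\varepsilon_j\mathbf x)])$, let $Q_j=Q^{(1)}\cdots Q^{(j)}$, and let $\mathfrak Q_n=a\big(1+\sum_{j=1}^{n-1}L^{-2j}Q_jQ_j^*\big)^{-1}$ on $\mathcal H_0^{(n)}$.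 * *Averaging of derivatives.* With $r_{\nu}(p)=\frac{\sin\frac12p_\nu}{\varepsilon_{n,\nu}^{-1}\sin\frac12\varepsilon_{n,\nu}p_\nu}$ let $u_n=\prod_{\nu'=0}^3 r_{\nu'}$, $u^{(+)}_{n,\nu}=\prod_{\nu'\ne\nu}r_{\nu'}$, $u^{(-)}_{n,\nu}=r_\nu u_n$, and $\zeta^{(\pm)}_{n,\nu}(k,\ell)=e^{\pm i\varepsilon_{n,\nu}(k+\ell)_\nu/2}e^{\mp ik_\nu/2}\cos\frac12\ell_\nu$. For $0\le\nu\le3$, $Q^{(+)}_{n,\nu}:\mathcal H_0^{(n)}\to\mathcal H_n$ and $Q^{(-)}_{n,\nu}:\mathcal H_n\to\mathcal H_0^{(n)}$ are the operators with Fourier transforms $$\widehat{(Q^{(+)}_{n,\nu}\psi)}(k+\ell)=\zeta^{(+)}_{n,\nu}(k,\ell)u^{(+)}_{n,\nu}(k+\ell)u_n(k+\ell)^{\mathfrak q-1}\hat\psi(k),$$ $$\widehat{(Q^{(-)}_{n,\nu}\phi)}(k)=\sum_{\ell}\zeta^{(-)}_{n,\nu}(k,\ell)u^{(-)}_{n,\nu}(k+\ell)u_n(k+\ell)^{\mathfrak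 q-1}\hat\phi(k+\ell),$$ where $k$ runs over the dual of $\mathcal X_0^{(n)}$ and $\ell$ over $(2\pi\mathbb Z/2\pi\varepsilon_n^{-2}\mathbb Z)\times(2\pi\mathbb Z^3/2\pi\varepsilon_n^{-1}\mathbb Z^3)$ (minimal representatives). * *Differential operator.* Let $h_0$ be the periodization of $\mathbf h_0$ to $\mathbb Z^3/L^nN_s\mathbb Z^3$ and $\partial_0$ the forward time difference on the unit-spacing lattice $(\mathbb Z/L^{2n}N_t\mathbb Z)\times(\mathbb Z^3/L^nN_s\mathbb Z^3)$. Then $D_n$ on $\mathcal H_n$ is $L^{2n}\big(1-e^{-h_0}-e^{-h_0}\partial_0\big)$, transported by the scaling $(x_0,\mathbf x)\mapsto(\varepsilon_n^2x_0,\varepsilon_n\mathbf x)$. * *Green's functions.* For $\mu\in\mathbb C$ set $S_n(\mu)=[D_n+Q_n^*\mathfrak Q_nQ_n-\mu]^{-1}$, $S^{(+)}_{n,\nu}(\mu)=[D_n^*+Q^{(+)}_{n,\nu}\mathfrak Q_nQ^{(-)}_{n,\nu}-\mu]^{-1}$ and $S^{(-)}_{n,\nu}(\mu)=[D_n+Q^{(+)}_{n,\nu}\mathfrak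 Q_nQ^{(-)}_{n,\nu}-\mu]^{-1}$. **Lemma.** There is a constant $\Gamma_2$ depending only on $\mathfrak q$, and there are constants $\mu_{\rm up}>0$, $m_7>0$ and $\Gamma_{15}$ depending only on $\mathfrak q$, $a$ and $\mathbf h_0$, such that for every odd $L>\Gamma_2$, all $n,N_t,N_s\ge1$ and all $\mu\in\mathbb C$ with $|\mu|\le\mu_{\rm up}$ the following holds. The inverses defining $\mathfrak Q_n$, $S_n(\mu)$ and $S^{(\pm)}_{n,\nu}(\mu)$, $0\le\nu\le 3$, exist, the operators on $\mathcal H_0^{(n)}$ $$\big(S_n(\mu)Q_n^*\mathfrak Q_n\big)^*\big(S_n(\mu)Q_n^*\mathfrak Q_n\big),\qquad \big(S_n(\mu)^*Q_n^*\mathfrak Q_n\big)^*\big(S_n(\mu)^*Q_n^*\mathfrak Q_n\big),$$ $$\big(S^{(\pm)}_{n,\nu}(\mu)Q^{(+)}_{n,\nu}\mathfrak Q_n\big)^*\big(S^{(\pm)}_{n,\nu}(\mu)Q^{(+)}_{n,\nu}\mathfrak Q_n\big)\qquad(0\le\nu\le3)$$ are all invertible, and the $\|\cdot\|_{m_7}$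 norms of all their inverses are at most $\Gamma_{15}$. -/

import Mathlib

namespace BlockSpin

/-! ### Lattices

Fix an odd block size `L` and the side lengths `Nt`, `Ns` of the unit-spacing torus
`X_0^(n) = (ℤ / Nt) × (ℤ / Ns)³`, that is `Nt = L_tp / L^(2n)` and `Ns = L_sp / L^n` when the original
torus is `X_0 = (ℤ / L_tp) × (ℤ / L_sp)³`. For `0 ≤ j ≤ n`, the lattice
`X_j^(n-j) = (L^(-2j) ℤ / Nt ℤ) × (L^(-j) ℤ / Ns ℤ)³` is represented by integer coordinates: the
point `u` has integer coordinates `w ν = L_ν ^ j * u ν`. In these coordinates the parabolic scaling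
maps are the identity. The direction `ν = 0` is time; `ν = 1, 2, 3` are space. -/

/-- `L_ν`: the block length `L²` in the time direction and `L` in the space directions. -/
def blockLen (L : ℕ) (ν : Fin 4) : ℕ := if ν = 0 then L ^ 2 else L

/-- The side lengths of the unit-spacing torus. -/
def side (Nt Ns : ℕ) (ν : Fin 4) : ℕ := if ν = 0 then Nt else Ns

instance instNeZeroBlockLen (L : ℕ) [NeZero L] (ν : Fin 4) : NeZero (blockLen L ν) :=
  ⟨by unfold blockLen; split_ifs <;> simp [NeZero.ne L]⟩

instance instNeZeroSide (Nt Ns : ℕ) [NeZero Nt] [NeZero Ns] (ν : Fin 4) : NeZero (side Nt Ns ν) :=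
  ⟨by unfold side; split_ifs <;> simp [NeZero.ne Nt, NeZero.ne Ns]⟩

/-- The lattice `X_j^(n-j)` in integer coordinates. `Site L Nt Ns n` is the fine lattice `X_n` and
`Site L Nt Ns 0` is the unit lattice `X_0^(n)`. -/
abbrev Site (L Nt Ns j : ℕ) : Type := (ν : Fin 4) → ZMod (blockLen L ν ^ j * side Nt Ns ν)

/-- The volume `ε_j^5 = L^(-5j)` of a cell of `X_j^(n-j)`; the integral over this lattice is
`cellVol L j * ∑ u`. -/
noncomputable def cellVol (L j : ℕ) : ℝ := (((L : ℝ) ^ j)⁻¹) ^ 5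

/-- An operator from functions on `X_j^(n-j)` to functions on `X_k^(n-k)`, given by its matrix:
`(A α) u = ∑ u', A u u' * α u'`. -/
abbrev Op (L Nt Ns j k : ℕ) : Type := Matrix (Site L Nt Ns k) (Site L Nt Ns j) ℂ

section

variable (L Nt Ns : ℕ) [NeZero L] [NeZero Nt] [NeZero Ns]

/-- The real (bilinear) inner product `∫ α β` on functions on `X_j^(n-j)`. -/
noncomputable def realInner (j : ℕ) (α β : Site L Nt Ns j → ℂ) : ℂ :=
  (cellVol L j : ℂ) * ∑ u, α u * β u

/-- The adjoint `A^*` for the real inner products. -/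
noncomputable def adj {j k : ℕ} (A : Op L Nt Ns j k) : Op L Nt Ns k j :=
  ((cellVol L k / cellVol L j : ℝ) : ℂ) • A.transpose

theorem realInner_mulVec {j k : ℕ} (A : Op L Nt Ns j k) (α : Site L Nt Ns j → ℂ)
    (β : Site L Nt Ns k → ℂ) :
    realInner L Nt Ns k (A.mulVec α) β = realInner L Nt Ns j α ((adj L Nt Ns A).mulVec β) := by
  have hL : (L : ℝ) ≠ 0 := Nat.cast_ne_zero.mpr (NeZero.ne L)
  have hj : (cellVol L j : ℂ) ≠ 0 := by
    rw [Complex.ofReal_ne_zero]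
    exact pow_ne_zero _ (inv_ne_zero (pow_ne_zero _ hL))
  have hdot : ∑ u, (A.mulVec α) u * β u = ∑ u, α u * (A.transpose.mulVec β) u := by
    simp only [Matrix.mulVec, dotProduct, Matrix.transpose_apply, Finset.sum_mul, Finset.mul_sum]
    rw [Finset.sum_comm]
    exact Finset.sum_congr rfl fun _ _ => Finset.sum_congr rfl fun _ _ => by ring
  simp only [realInner, adj, Matrix.smul_mulVec, Pi.smul_apply, smul_eq_mul]
  rw [hdot, Finset.mul_sum, Finset.mul_sum]
  refine Finset.sum_congr rfl fun u _ => ?_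
  push_cast
  field_simp

/-- The integral kernel `A(u,u')` of an operator: `(A α) u = cellVol L j * ∑ u', A(u,u') * α u'`. -/
noncomputable def kernel {j k : ℕ} (A : Op L Nt Ns j k) (u : Site L Nt Ns k)
    (u' : Site L Nt Ns j) : ℂ :=
  A u u' / (cellVol L j : ℂ)

/-- The Euclidean distance `|u - u'|` on the torus `X_j^(n-j)`. -/
noncomputable def torusDist (j : ℕ) (u u' : Site L Nt Ns j) : ℝ :=
  Real.sqrt (∑ ν, (((u ν - u' ν).valMinAbs : ℝ) / (blockLen L ν : ℝ) ^ j) ^ 2)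

/-- The weighted `ℓ¹`-`ℓ^∞` norm `‖A‖_m` of the kernel of an operator on functions on
`X_j^(n-j)`. -/
noncomputable def opNorm {j : ℕ} (m : ℝ) (A : Op L Nt Ns j j) : ℝ :=
  max (⨆ u, cellVol L j * ∑ u', Real.exp (m * torusDist L Nt Ns j u u') * ‖kernel L Nt Ns A u u'‖)
    (⨆ u', cellVol L j * ∑ u, Real.exp (m * torusDist L Nt Ns j u u') * ‖kernel L Nt Ns A u u'‖)

/-- `A` is invertible and `‖A⁻¹‖_m ≤ Γ`. -/
def HasInverseBound {j : ℕ} (m Γ : ℝ) (A : Op L Nt Ns j j) : Prop :=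
  IsUnit A ∧ opNorm L Nt Ns m A⁻¹ ≤ Γ

end

/-! ### Block spin averaging -/

/-- Convolution on `ℤ × ℤ³`. -/
noncomputable def conv (f g : (Fin 4 → ℤ) → ℝ) (x : Fin 4 → ℤ) : ℝ := ∑' y, f y * g (x - y)

open Classical in
/-- The characteristic function of the rectangle
`[-(L²-1)/2, (L²-1)/2] × [-(L-1)/2, (L-1)/2]³` in `ℤ × ℤ³`. -/
noncomputable def rectInd (L : ℕ) (x : Fin 4 → ℤ) : ℝ :=
  if ∀ ν, 2 * |x ν| ≤ (blockLen L ν : ℤ) - 1 then 1 else 0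

open Classical in
/-- The averaging profile: the `q`-fold convolution `L^(-5q) 1_□ * ⋯ * 1_□` (the convolution powers
start from the unit `δ_0`). -/
noncomputable def profile (L q : ℕ) (x : Fin 4 → ℤ) : ℝ :=
  ((L : ℝ) ^ (5 * q))⁻¹ * ((conv (rectInd L))^[q] (fun y => if y = 0 then 1 else 0)) x

section

variable (L Nt Ns : ℕ) [NeZero L] [NeZero Nt] [NeZero Ns]

/-- The inclusion of the sublattice `X_j^(n-j)` into `X_{j+1}^(n-j-1)`; in integer coordinates it is
multiplication by `L_ν`. -/
def incl (j : ℕ) (y : Site L Nt Ns j) : Site L Nt Ns (j + 1) :=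
  fun ν => ((blockLen L ν * (y ν).val : ℕ) : ZMod _)

/-- The scaled averaging operator `Q^(j+1) : H_{j+1}^(n-j-1) → H_j^(n-j)`,
`(Q ψ) y = ∑_x q(x) ψ(y + [x])` in integer coordinates. -/
noncomputable def avgStep (q j : ℕ) : Op L Nt Ns (j + 1) j :=
  fun y z => ((∑' x : Fin 4 → ℤ,
    if z = incl L Nt Ns j y + (fun ν => ((x ν : ℤ) : ZMod _)) then profile L q x else 0 : ℝ) : ℂ)

/-- `Q_j = Q^(1) ⋯ Q^(j) : H_j^(n-j) → H_0^(n)`. -/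
noncomputable def Qavg (q : ℕ) : (j : ℕ) → Op L Nt Ns j 0
  | 0 => 1
  | j + 1 => Qavg q j * avgStep L Nt Ns q j

/-- `1 + ∑_{j=1}^{n-1} L^(-2j) Q_j Q_j^*` on functions on `X_0^(n)`. -/
noncomputable def fQinv (q n : ℕ) : Op L Nt Ns 0 0 :=
  1 + ∑ j ∈ Finset.Ico 1 n,
    ((L : ℂ) ^ (2 * j))⁻¹ • (Qavg L Nt Ns q j * adj L Nt Ns (Qavg L Nt Ns q j))

/-- `𝔔_n = a (1 + ∑_{j=1}^{n-1} L^(-2j) Q_j Q_j^*)⁻¹`. -/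
noncomputable def fQ (q : ℕ) (a : ℝ) (n : ℕ) : Op L Nt Ns 0 0 :=
  (a : ℂ) • (fQinv L Nt Ns q n)⁻¹

end

/-! ### The operators `Q_{n,ν}^(±)`, through their Fourier transforms -/

/-- `sin (x/2) / (M sin (x/(2M)))`, with the value `1` at its removable singularities (`M` odd). -/
noncomputable def sinRatio (M : ℕ) (x : ℝ) : ℝ :=
  if Real.sin (x / (2 * M)) = 0 then 1
  else Real.sin (x / 2) / (M * Real.sin (x / (2 * M)))

/-- `u_n(p)`. -/
noncomputable def uFun (L n : ℕ) (p : Fin 4 → ℝ) : ℝ := ∏ ν, sinRatio (blockLen L ν ^ n) (p ν)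

/-- `u_{n,ν}^(+)(p)`: the factor with index `ν` is omitted from `u_n(p)`. -/
noncomputable def uPlus (L n : ℕ) (ν : Fin 4) (p : Fin 4 → ℝ) : ℝ :=
  ∏ ν' ∈ Finset.univ.erase ν, sinRatio (blockLen L ν' ^ n) (p ν')

/-- `u_{n,ν}^(-)(p)`: the factor with index `ν` occurs twice. -/
noncomputable def uMinus (L n : ℕ) (ν : Fin 4) (p : Fin 4 → ℝ) : ℝ :=
  sinRatio (blockLen L ν ^ n) (p ν) * uFun L n p

/-- `ζ_{n,ν}^(+)(k,ℓ) = exp(i ε_{n,ν} (k+ℓ)_ν / 2) exp(-i k_ν / 2) cos(ℓ_ν / 2)`. -/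
noncomputable def zetaPlus (L n : ℕ) (ν : Fin 4) (k l : Fin 4 → ℝ) : ℂ :=
  Complex.exp (Complex.I * (((k ν + l ν) / ((blockLen L ν : ℝ) ^ n) / 2 : ℝ) : ℂ)) *
    Complex.exp (-(Complex.I * ((k ν / 2 : ℝ) : ℂ))) * (Real.cos (l ν / 2) : ℂ)

/-- `ζ_{n,ν}^(-)(k,ℓ) = exp(i k_ν / 2) exp(-i ε_{n,ν} (k+ℓ)_ν / 2) cos(ℓ_ν / 2)`. -/
noncomputable def zetaMinus (L n : ℕ) (ν : Fin 4) (k l : Fin 4 → ℝ) : ℂ :=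
  Complex.exp (Complex.I * ((k ν / 2 : ℝ) : ℂ)) *
    Complex.exp (-(Complex.I * (((k ν + l ν) / ((blockLen L ν : ℝ) ^ n) / 2 : ℝ) : ℂ))) *
      (Real.cos (l ν / 2) : ℂ)

/-- The index set of the dual `B̂_n = ∏_ν (2πℤ / 2π L_ν^n ℤ)` of a single period. -/
abbrev Period (L n : ℕ) : Type := (ν : Fin 4) → ZMod (blockLen L ν ^ n)

/-- The representative of `ℓ ∈ B̂_n` with minimal components. -/
noncomputable def periodMom {L n : ℕ} (l : Period L n) : Fin 4 → ℝ :=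
  fun ν => 2 * Real.pi * ((l ν).valMinAbs : ℝ)

section

variable (L Nt Ns : ℕ) [NeZero L] [NeZero Nt] [NeZero Ns]

/-- The representative with minimal components of an element of
`X̂_0^(n) = (2π/Nt ℤ / 2πℤ) × (2π/Ns ℤ / 2πℤ)³`, which is indexed by `Site L Nt Ns 0`. -/
noncomputable def unitMom (k : Site L Nt Ns 0) : Fin 4 → ℝ :=
  fun ν => 2 * Real.pi * ((k ν).valMinAbs : ℝ) / (side Nt Ns ν : ℝ)

/-- The phase `exp(i p·u)` for a point `u` of `X_j^(n-j)`. -/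
noncomputable def phase (j : ℕ) (p : Fin 4 → ℝ) (u : Site L Nt Ns j) : ℂ :=
  Complex.exp (Complex.I * ((∑ ν, p ν * (((u ν).val : ℝ) / (blockLen L ν : ℝ) ^ j) : ℝ) : ℂ))

/-- The Fourier transform `α̂(p) = ∫ α(u) exp(-i p·u) du` on `X_j^(n-j)`. -/
noncomputable def fourier (j : ℕ) (α : Site L Nt Ns j → ℂ) (p : Fin 4 → ℝ) : ℂ :=
  (cellVol L j : ℂ) * ∑ u, α u * phase L Nt Ns j (-p) u

/-- The volume of the torus, the same for all the lattices `X_j^(n-j)`. -/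
noncomputable def torusVol : ℝ := ∏ ν, (side Nt Ns ν : ℝ)

/-- `Q_{n,ν}^(+) : H_0^(n) → H_n`, the operator with
`(Q_{n,ν}^(+) ψ)^(k+ℓ) = ζ_{n,ν}^(+)(k,ℓ) u_{n,ν}^(+)(k+ℓ) u_n(k+ℓ)^(q-1) ψ̂(k)`.
It is given by Fourier inversion, the points of `X̂_n` being written uniquely as `k + ℓ` with
`k ∈ X̂_0^(n)` and `ℓ ∈ B̂_n`. -/
noncomputable def Qplus (q n : ℕ) (ν : Fin 4) : Op L Nt Ns 0 n :=
  LinearMap.toMatrix'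
    { toFun := fun ψ u => ((torusVol Nt Ns : ℂ))⁻¹ * ∑ k : Site L Nt Ns 0, ∑ l : Period L n,
        (zetaPlus L n ν (unitMom L Nt Ns k) (periodMom l) *
          (uPlus L n ν (unitMom L Nt Ns k + periodMom l) : ℂ) *
          (uFun L n (unitMom L Nt Ns k + periodMom l) : ℂ) ^ (q - 1) *
          fourier L Nt Ns 0 ψ (unitMom L Nt Ns k)) *
        phase L Nt Ns n (unitMom L Nt Ns k + periodMom l) u
      map_add' := by
        intro α β
        funext u
        simp only [fourier, Pi.add_apply, add_mul, mul_add, Finset.sum_add_distrib]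
      map_smul' := by
        intro c α
        funext u
        simp only [fourier, Pi.smul_apply, smul_eq_mul, RingHom.id_apply, Finset.mul_sum,
          Finset.sum_mul]
        refine Finset.sum_congr rfl fun k _ => Finset.sum_congr rfl fun l _ =>
          Finset.sum_congr rfl fun x _ => ?_
        ring }

/-- `Q_{n,ν}^(-) : H_n → H_0^(n)`, the operator with
`(Q_{n,ν}^(-) φ)^(k) = ∑_ℓ ζ_{n,ν}^(-)(k,ℓ) u_{n,ν}^(-)(k+ℓ) u_n(k+ℓ)^(q-1) φ̂(k+ℓ)`,
given by Fourier inversion. -/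
noncomputable def Qminus (q n : ℕ) (ν : Fin 4) : Op L Nt Ns n 0 :=
  LinearMap.toMatrix'
    { toFun := fun φ x => ((torusVol Nt Ns : ℂ))⁻¹ * ∑ k : Site L Nt Ns 0,
        (∑ l : Period L n,
          zetaMinus L n ν (unitMom L Nt Ns k) (periodMom l) *
          (uMinus L n ν (unitMom L Nt Ns k + periodMom l) : ℂ) *
          (uFun L n (unitMom L Nt Ns k + periodMom l) : ℂ) ^ (q - 1) *
          fourier L Nt Ns n φ (unitMom L Nt Ns k + periodMom l)) *
        phase L Nt Ns 0 (unitMom L Nt Ns k) x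
      map_add' := by
        intro α β
        funext u
        simp only [fourier, Pi.add_apply, add_mul, mul_add, Finset.sum_add_distrib]
      map_smul' := by
        intro c α
        funext u
        simp only [fourier, Pi.smul_apply, smul_eq_mul, RingHom.id_apply, Finset.mul_sum,
          Finset.sum_mul]
        refine Finset.sum_congr rfl fun k _ => Finset.sum_congr rfl fun l _ =>
          Finset.sum_congr rfl fun x _ => ?_
        ring }

end

/-! ### The differential operators -/

/-- The standing assumptions on the translation invariant operator `𝐡₀` on `L²(ℤ³)` with kernel
`h (x - x')` and Fourier transform `hhat`. -/
structure IsKineticOperator (h : (Fin 3 → ℤ) → ℂ) (hhat : (Fin 3 → ℂ) → ℂ) : Prop where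
  summable : Summable fun x => ‖h x‖
  fourier_eq : ∀ p : Fin 3 → ℝ, hhat (fun ν => (p ν : ℂ)) =
    ∑' x : Fin 3 → ℤ, h x * Complex.exp (-(Complex.I * ((∑ ν, p ν * (x ν : ℝ) : ℝ) : ℂ)))
  entire : Differentiable ℂ hhat
  even : ∀ (p : Fin 3 → ℂ) (ν : Fin 3), hhat (Function.update p ν (-p ν)) = hhat p
  real : ∀ p : Fin 3 → ℝ, (hhat fun ν => (p ν : ℂ)).im = 0
  nonneg : ∀ p : Fin 3 → ℝ, 0 ≤ (hhat fun ν => (p ν : ℂ)).re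
  pos : ∀ p : Fin 3 → ℝ, (¬ ∃ z : Fin 3 → ℤ, ∀ ν, p ν = 2 * Real.pi * (z ν : ℝ)) →
    0 < (hhat fun ν => (p ν : ℂ)).re
  zero : hhat 0 = 0
  deriv_zero : fderiv ℂ hhat 0 = 0
  hessian_posDef : (Matrix.of fun μ ν : Fin 3 =>
    (iteratedFDeriv ℂ 2 hhat 0 ![Pi.single μ 1, Pi.single ν 1]).re).PosDef

section

variable (L Nt Ns : ℕ) [NeZero L] [NeZero Nt] [NeZero Ns]

/-- The periodization `h₀` of `𝐡₀` on the spatial torus `ℤ³ / L_sp ℤ³`, `L_sp = L^n Ns`, acting on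
the spatial coordinates of functions on `X_0` (in integer coordinates). -/
noncomputable def hop (h : (Fin 3 → ℤ) → ℂ) (n : ℕ) : Op L Nt Ns n n :=
  fun u u' => if u 0 = u' 0 then
    ∑' x : Fin 3 → ℤ,
      if (∀ ν : Fin 3, ((x ν : ℤ) : ZMod _) = u ν.succ - u' ν.succ) then h x else 0
  else 0

/-- The forward time derivative `∂₀` on `X_0` (unit spacing, integer coordinates). -/
noncomputable def timeDeriv (n : ℕ) : Op L Nt Ns n n :=
  fun u u' => (if u' = u + Pi.single 0 1 then 1 else 0) - (if u' = u then 1 else 0)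

/-- `D_n = L^(2n) 𝕃_*^(-n) (1 - e^(-h₀) - e^(-h₀) ∂₀) 𝕃_*^n`, in integer coordinates. -/
noncomputable def Dop (h : (Fin 3 → ℤ) → ℂ) (n : ℕ) : Op L Nt Ns n n :=
  (L : ℂ) ^ (2 * n) • (1 - NormedSpace.exp (-hop L Nt Ns h n) -
    NormedSpace.exp (-hop L Nt Ns h n) * timeDeriv L Nt Ns n)

/-! ### The Green's functions -/

/-- `S_n(μ)⁻¹ = D_n + Q_n^* 𝔔_n Q_n - μ`. -/
noncomputable def Sinv (q : ℕ) (a : ℝ) (h : (Fin 3 → ℤ) → ℂ) (n : ℕ) (μ : ℂ) : Op L Nt Ns n n :=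
  Dop L Nt Ns h n +
    adj L Nt Ns (Qavg L Nt Ns q n) * fQ L Nt Ns q a n * Qavg L Nt Ns q n - μ • 1

/-- `S_{n,ν}^(+)(μ)⁻¹ = D_n^* + Q_{n,ν}^(+) 𝔔_n Q_{n,ν}^(-) - μ`. -/
noncomputable def SplusInv (q : ℕ) (a : ℝ) (h : (Fin 3 → ℤ) → ℂ) (n : ℕ) (ν : Fin 4) (μ : ℂ) :
    Op L Nt Ns n n :=
  adj L Nt Ns (Dop L Nt Ns h n) +
    Qplus L Nt Ns q n ν * fQ L Nt Ns q a n * Qminus L Nt Ns q n ν - μ • 1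

/-- `S_{n,ν}^(-)(μ)⁻¹ = D_n + Q_{n,ν}^(+) 𝔔_n Q_{n,ν}^(-) - μ`. -/
noncomputable def SminusInv (q : ℕ) (a : ℝ) (h : (Fin 3 → ℤ) → ℂ) (n : ℕ) (ν : Fin 4) (μ : ℂ) :
    Op L Nt Ns n n :=
  Dop L Nt Ns h n +
    Qplus L Nt Ns q n ν * fQ L Nt Ns q a n * Qminus L Nt Ns q n ν - μ • 1

/-- `X^* X` for an operator `X : H_0^(n) → H_n`. -/
noncomputable def gram {n : ℕ} (X : Op L Nt Ns 0 n) : Op L Nt Ns 0 0 := adj L Nt Ns X * X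

end

end BlockSpin

open BlockSpin

set_option linter.unusedSectionVars false

/-! All operators involved commute with translations of the unit torus, so plane waves reduce the
problem to fibres: above a unit momentum `k` lie the fine momenta `k + ℓ`. On a fibre, `D_n - μ` is
diagonal, and both `Q_n^* 𝔔_n Q_n` and `Q^(+) 𝔔_n Q^(-)` have rank one. Their diagonal entries
agree: the half-cell shifts of `Q^(±)` cancel and the exponents `q - 1` and `q + 1` add up to `2q`.
Cramer's rule for "diagonal plus rank one" (`rankOne_mulVec_sum`) gives the Green's function applied
to the averaging operator explicitly, so each Gram operator is multiplication by an explicit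
function of `k`. The reciprocal of this function is `gramInv`, equal to `greenDen(D) * greenDen(E) /
(a² * greenNum(D, E))`. Here `D` is the symbol of `D_n` or of its adjoint, and `E z = D (-z)`
because the adjoint is the bilinear one. In `greenDen` and `greenNum` the denominator belonging to
`ℓ = 0` has been cleared, so they stay regular where `D` vanishes.

It remains to bound `gramInv` in a complex strip, uniformly in `L`, `n` and the torus; a contour
shift then gives exponential decay of the kernel (`opNorm_diagOp_le`). The upper bounds on
`greenDen` and `greenNum` rest on three facts: `D` is bounded for `ℓ = 0`, it is bounded away from
zero for `ℓ ≠ 0`, and the averaging symbols are summable over `ℓ`. The first two express that `hhat`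
vanishes exactly quadratically at `0`, which compensates the factor `L^(2n)` in `D_n`.

The lower bounds are proved at real momenta and `μ = 0`. There `E` is the conjugate of `D`, so
`greenNum` is a sum of nonnegative terms, one of which is bounded below (`le_norm_greenNum_ofReal`).
Moreover `Re D ≥ 0`, so `greenDen` is `D` times a number of real part at least `1`; this controls it
unless `D` is small, and then its averaging term dominates (`le_norm_greenDen_ofReal`). The Schwarz
lemma along a complex disc carries both bounds to small `μ` and small imaginary parts
(`half_le_norm_of_real`). The bound on `greenDen` is what makes the Green's functions exist; the
bound on `greenNum` is what bounds `gramInv`. -/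

namespace BlockSpin

/-! ### Plane waves on the tori -/

section Waves

variable {L Nt Ns : ℕ} [NeZero L] [NeZero Nt] [NeZero Ns] {j : ℕ}

/-- The plane wave with momentum `p`, evaluated at `u`. -/
noncomputable def wave (p u : Site L Nt Ns j) : ℂ := ∏ ν, ZMod.stdAddChar (p ν * u ν)

theorem wave_comm (p u : Site L Nt Ns j) : wave p u = wave u p := by
  simp only [wave, mul_comm]

theorem wave_add_right (p u v : Site L Nt Ns j) : wave p (u + v) = wave p u * wave p v := by
  simp only [wave, Pi.add_apply, mul_add, AddChar.map_add_eq_mul, Finset.prod_mul_distrib]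

theorem wave_add_left (p p' u : Site L Nt Ns j) : wave (p + p') u = wave p u * wave p' u := by
  rw [wave_comm, wave_add_right, wave_comm u, wave_comm u]

theorem sum_wave (p : Site L Nt Ns j) :
    ∑ u, wave p u = if p = 0 then (Fintype.card (Site L Nt Ns j) : ℂ) else 0 := by
  classical
  have h : ∑ u, wave p u = ∏ ν, ∑ x : ZMod (blockLen L ν ^ j * side Nt Ns ν),
      (ZMod.stdAddChar (x * p ν) : ℂ) := by
    rw [Finset.prod_univ_sum, Fintype.piFinset_univ]
    simp only [wave, mul_comm]
  rw [h]
  simp only [AddChar.sum_mulShift _ (ZMod.isPrimitive_stdAddChar _)]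
  split_ifs with hp
  · subst hp
    simp [Fintype.card_pi]
  · obtain ⟨ν, hν⟩ := Function.ne_iff.mp hp
    exact Finset.prod_eq_zero (Finset.mem_univ ν) (by rw [if_neg (show ¬ p ν = 0 from hν), Nat.cast_zero])

theorem sum_wave_mul_wave (p p' : Site L Nt Ns j) :
    ∑ u, wave p u * wave p' u =
      if p + p' = 0 then (Fintype.card (Site L Nt Ns j) : ℂ) else 0 := by
  simp only [← wave_add_left, sum_wave]

theorem card_site_ne_zero : (Fintype.card (Site L Nt Ns j) : ℂ) ≠ 0 := by
  exact_mod_cast Fintype.card_ne_zero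

/-- Fourier inversion, obtained by exchanging the two sums and using orthogonality of characters;
uniqueness and the expansion in plane waves both follow from it. -/
theorem sum_mul_sum_wave (f : Site L Nt Ns j → ℂ) (v : Site L Nt Ns j) :
    ∑ p, wave p (-v) * ∑ u, f u * wave p u = Fintype.card (Site L Nt Ns j) * f v := by
  have h : ∑ p, wave p (-v) * ∑ u, f u * wave p u = ∑ u, f u * ∑ p, wave (u - v) p := by
    simp only [Finset.mul_sum]
    rw [Finset.sum_comm]
    refine Finset.sum_congr rfl fun u _ => Finset.sum_congr rfl fun p _ => ?_
    rw [sub_eq_add_neg, wave_add_left, wave_comm u, wave_comm (-v)]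
    ring
  rw [h]
  simp only [sum_wave, sub_eq_zero]
  simp [mul_comm]

/-- A function on a torus is determined by its pairings with the plane waves. -/
theorem eq_of_sum_mul_wave_eq {f g : Site L Nt Ns j → ℂ}
    (h : ∀ p, ∑ u, f u * wave p u = ∑ u, g u * wave p u) : f = g := by
  funext v
  have hf := sum_mul_sum_wave f v
  simp only [h] at hf
  rw [sum_mul_sum_wave] at hf
  exact mul_left_cancel₀ card_site_ne_zero hf.symm

/-- Every function is a combination of plane waves. -/
theorem eq_sum_smul_wave (f : Site L Nt Ns j → ℂ) :
    f = ∑ p, ((Fintype.card (Site L Nt Ns j) : ℂ)⁻¹ * ∑ u, f u * wave (-p) u) • wave p := by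
  funext v
  rw [Finset.sum_apply]
  have h := sum_mul_sum_wave f v
  rw [← Equiv.sum_comp (Equiv.neg (Site L Nt Ns j))] at h
  simp only [Pi.smul_apply, smul_eq_mul, mul_assoc, ← Finset.mul_sum]
  rw [eq_inv_mul_iff_mul_eq₀ card_site_ne_zero, ← h]
  refine Finset.sum_congr rfl fun p _ => ?_
  rw [mul_comm]
  congr 1
  simp [wave]

/-- Each row is determined by its pairings with plane waves, so identities between operators may be
checked on symbols. -/
theorem matrix_eq_of_mulVec_wave {ι : Type*} {A B : Matrix ι (Site L Nt Ns j) ℂ}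
    (h : ∀ p, A.mulVec (wave p) = B.mulVec (wave p)) : A = B := by
  ext u v
  have : A u = B u := eq_of_sum_mul_wave_eq fun p => congrFun (h p) u
  rw [this]

/-- The point with given integer coordinates. -/
def ofInt (P : Fin 4 → ℤ) : Site L Nt Ns j := fun ν => (P ν : ZMod _)

theorem ofInt_neg (P : Fin 4 → ℤ) : (ofInt (-P) : Site L Nt Ns j) = -ofInt P := by
  funext ν; simp [ofInt]

theorem ofInt_val (p : Site L Nt Ns j) : ofInt (fun ν => ((p ν).val : ℤ)) = p := by
  funext ν; simp [ofInt]

theorem ofInt_valMinAbs (p : Site L Nt Ns j) : ofInt (fun ν => (p ν).valMinAbs) = p := by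
  funext ν; simp [ofInt]

theorem ofInt_eq_ofInt_iff (P P' : Fin 4 → ℤ) : (ofInt P : Site L Nt Ns j) = ofInt P' ↔
    ∀ ν, ((blockLen L ν ^ j * side Nt Ns ν : ℕ) : ℤ) ∣ P' ν - P ν := by
  simp only [funext_iff, ofInt, ZMod.intCast_eq_intCast_iff_dvd_sub]

/-- In physical units the momentum is `2πP/side` and the point is `U/blockLen^j`, and their pairing
does not see the scale. This is why one integer vector `P` can label compatible waves on all the
tori. -/
theorem wave_ofInt (P U : Fin 4 → ℤ) : wave (ofInt P : Site L Nt Ns j) (ofInt U) =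
    Complex.exp (Complex.I * ∑ ν, 2 * Real.pi * P ν / side Nt Ns ν *
      (U ν / (blockLen L ν : ℂ) ^ j)) := by
  simp only [wave, ofInt, ← Int.cast_mul, ZMod.stdAddChar_coe]
  rw [← Complex.exp_sum, Finset.mul_sum]
  congr 1
  refine Finset.sum_congr rfl fun ν _ => ?_
  push_cast
  have h1 : (blockLen L ν : ℂ) ≠ 0 := Nat.cast_ne_zero.mpr (NeZero.ne _)
  have h2 : (side Nt Ns ν : ℂ) ≠ 0 := Nat.cast_ne_zero.mpr (NeZero.ne _)
  field_simp

/-- The momentum on a coarser torus that labels the restriction of a plane wave. -/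
def proj {j : ℕ} (i : ℕ) (p : Site L Nt Ns j) : Site L Nt Ns i := ofInt fun ν => ((p ν).val : ℤ)

theorem side_pow_dvd {i j : ℕ} (hij : i ≤ j) (ν : Fin 4) :
    ((blockLen L ν ^ i * side Nt Ns ν : ℕ) : ℤ) ∣ ((blockLen L ν ^ j * side Nt Ns ν : ℕ) : ℤ) :=
  Int.natCast_dvd_natCast.mpr (mul_dvd_mul_right (pow_dvd_pow _ hij) _)

theorem proj_ofInt {i j : ℕ} (hij : i ≤ j) (P : Fin 4 → ℤ) :
    proj i (ofInt P : Site L Nt Ns j) = ofInt P := by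
  rw [proj, ofInt_eq_ofInt_iff]
  intro ν
  refine (side_pow_dvd hij ν).trans ?_
  exact ((ofInt_eq_ofInt_iff _ _).mp (ofInt_val (ofInt P : Site L Nt Ns j))) ν

theorem proj_neg {i j : ℕ} (hij : i ≤ j) (p : Site L Nt Ns j) : proj i (-p) = -proj i p := by
  rw [← ofInt_val p, ← ofInt_neg, proj_ofInt hij, proj_ofInt hij, ofInt_neg]

theorem card_site : (Fintype.card (Site L Nt Ns j) : ℝ) =
    ((L : ℝ) ^ j) ^ 5 * Fintype.card (Site L Nt Ns 0) := by
  rw [Fintype.card_pi, Fintype.card_pi]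
  simp only [ZMod.card]
  simp [Fin.prod_univ_four, blockLen, side]
  ring

/-- The total volume is independent of the scale, so no normalisation factor survives when adjoints
between different lattices are computed on plane waves. -/
theorem cellVol_mul_card : (cellVol L j : ℂ) * Fintype.card (Site L Nt Ns j) =
    Fintype.card (Site L Nt Ns 0) := by
  have h : (Fintype.card (Site L Nt Ns j) : ℂ) =
    ((L : ℂ) ^ j) ^ 5 * Fintype.card (Site L Nt Ns 0) := by exact_mod_cast card_site
  have hL : (L : ℂ) ≠ 0 := Nat.cast_ne_zero.mpr (NeZero.ne L)
  rw [h, cellVol]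
  push_cast
  field_simp

theorem cellVol_ne_zero : (cellVol L j : ℂ) ≠ 0 := by
  have hL : (L : ℝ) ≠ 0 := Nat.cast_ne_zero.mpr (NeZero.ne L)
  rw [Complex.ofReal_ne_zero]
  exact pow_ne_zero _ (inv_ne_zero (pow_ne_zero _ hL))

end Waves

/-! ### Symbols of translation invariant operators -/

section Symbols

variable {L Nt Ns : ℕ} [NeZero L] [NeZero Nt] [NeZero Ns] {j : ℕ}

/-- `T` is diagonal on plane waves. -/
def IsDiag (d : Site L Nt Ns j → ℂ) (T : Op L Nt Ns j j) : Prop :=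
  ∀ p, T.mulVec (wave p) = d p • wave p

/-- The fine momenta that restrict to a given momentum of the unit torus. -/
def fib (j : ℕ) (k : Site L Nt Ns 0) : Finset (Site L Nt Ns j) :=
  {p | proj 0 p = k}

/-- `X` maps a plane wave of the unit torus to a combination of plane waves over it. -/
def IsUp (x : Site L Nt Ns j → ℂ) (X : Op L Nt Ns 0 j) : Prop :=
  ∀ k, X.mulVec (wave k) = ∑ p ∈ fib j k, x p • wave p

/-- `A` maps a plane wave to a multiple of the plane wave below it on the unit torus. -/
def IsDown (x : Site L Nt Ns j → ℂ) (A : Op L Nt Ns j 0) : Prop :=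
  ∀ p, A.mulVec (wave p) = x p • wave (proj 0 p)

@[simp] theorem mem_fib {k : Site L Nt Ns 0} {p : Site L Nt Ns j} :
    p ∈ fib j k ↔ proj 0 p = k := by simp [fib]

theorem sum_fib_neg (f : Site L Nt Ns j → ℂ) (k : Site L Nt Ns 0) :
    ∑ p ∈ fib j (-k), f p = ∑ p ∈ fib j k, f (-p) := by
  refine Finset.sum_bij (fun p _ => -p) ?_ ?_ ?_ ?_
  · intro p hp; simp_all [proj_neg]
  · intro p _ p' _ h; simpa using h
  · intro p hp; exact ⟨-p, by simp_all [proj_neg], by simp⟩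
  · intro p hp; simp

theorem sum_adj_mulVec_mul {i : ℕ} (A : Op L Nt Ns j i) (f : Site L Nt Ns i → ℂ)
    (g : Site L Nt Ns j → ℂ) : (cellVol L j : ℂ) * ∑ u, (adj L Nt Ns A).mulVec f u * g u =
      (cellVol L i : ℂ) * ∑ u, f u * A.mulVec g u := by
  have h := realInner_mulVec L Nt Ns A g f
  simp only [realInner] at h
  simp only [mul_comm (f _)]
  rw [h]
  simp only [mul_comm]

/-- The inner product is bilinear, so it pairs the wave `p` with the wave `-p`: the adjoint reflects
the symbol and does not conjugate it. -/
theorem IsDiag.adj {d : Site L Nt Ns j → ℂ} {T : Op L Nt Ns j j} (h : IsDiag d T) :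
    IsDiag (fun p => d (-p)) (adj L Nt Ns T) := by
  intro p
  refine eq_of_sum_mul_wave_eq fun p' => mul_left_cancel₀ (cellVol_ne_zero (L := L) (j := j)) ?_
  rw [sum_adj_mulVec_mul, h]
  congr 1
  simp only [Pi.smul_apply, smul_eq_mul, mul_left_comm (wave p _), mul_assoc, ← Finset.mul_sum,
    sum_wave_mul_wave]
  split_ifs with hp
  · rw [neg_eq_of_add_eq_zero_right hp]
  · simp

theorem IsUp.adj {x : Site L Nt Ns j → ℂ} {X : Op L Nt Ns 0 j} (h : IsUp x X) :
    IsDown (fun p => x (-p)) (adj L Nt Ns X) := by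
  intro p
  refine eq_of_sum_mul_wave_eq fun k => mul_left_cancel₀ (cellVol_ne_zero (L := L) (j := 0)) ?_
  rw [sum_adj_mulVec_mul, h]
  simp only [Finset.sum_apply, Pi.smul_apply, smul_eq_mul, Finset.mul_sum,
    mul_left_comm (wave p _), mul_assoc]
  rw [Finset.sum_comm]
  simp only [← Finset.mul_sum, sum_wave_mul_wave]
  have hc : ∀ p' : Site L Nt Ns j, (p + p' = 0) ↔ p' = -p := fun p' => by
    rw [add_comm, add_eq_zero_iff_eq_neg]
  simp only [hc, mul_ite, mul_zero, Finset.sum_ite_eq', mem_fib, proj_neg (Nat.zero_le j),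
    ← neg_eq_iff_add_eq_zero]
  rw [mul_left_comm, cellVol_mul_card, mul_left_comm, cellVol_mul_card]

theorem IsDown.adj {x : Site L Nt Ns j → ℂ} {A : Op L Nt Ns j 0} (h : IsDown x A) :
    IsUp (fun p => x (-p)) (adj L Nt Ns A) := by
  intro k
  refine eq_of_sum_mul_wave_eq fun p => mul_left_cancel₀ (cellVol_ne_zero (L := L) (j := j)) ?_
  rw [sum_adj_mulVec_mul, h]
  simp only [Finset.sum_apply, Pi.smul_apply, smul_eq_mul, Finset.sum_mul,
    mul_left_comm (wave k _), mul_assoc]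
  rw [Finset.sum_comm]
  simp only [← Finset.mul_sum, sum_wave_mul_wave]
  have hc : ∀ p' : Site L Nt Ns j, (p' + p = 0) ↔ p' = -p := fun p' => by
    rw [add_eq_zero_iff_eq_neg]
  simp only [hc, mul_ite, mul_zero, Finset.sum_ite_eq', mem_fib, proj_neg (Nat.zero_le j), neg_neg,
    ← eq_neg_iff_add_eq_zero]
  rw [mul_left_comm, cellVol_mul_card, mul_left_comm, cellVol_mul_card]
  simp only [eq_comm (a := k)]

theorem IsDiag.add {d d' : Site L Nt Ns j → ℂ} {T T' : Op L Nt Ns j j} (h : IsDiag d T)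
    (h' : IsDiag d' T') : IsDiag (d + d') (T + T') := by
  intro p; rw [Matrix.add_mulVec, h, h', Pi.add_apply, add_smul]

theorem IsDiag.smul {d : Site L Nt Ns j → ℂ} {T : Op L Nt Ns j j} (h : IsDiag d T) (c : ℂ) :
    IsDiag (fun p => c * d p) (c • T) := by
  intro p; rw [Matrix.smul_mulVec, h, smul_smul]

theorem isDiag_one : IsDiag (fun _ => 1) (1 : Op L Nt Ns j j) := by
  intro p; simp

theorem IsDiag.mul {d d' : Site L Nt Ns j → ℂ} {T T' : Op L Nt Ns j j} (h : IsDiag d T)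
    (h' : IsDiag d' T') : IsDiag (fun p => d p * d' p) (T * T') := by
  intro p
  rw [← Matrix.mulVec_mulVec, h', Matrix.mulVec_smul, h, smul_smul, mul_comm]

theorem isDiag_sum {ι : Type*} (s : Finset ι) {d : ι → Site L Nt Ns j → ℂ} {T : ι → Op L Nt Ns j j}
    (h : ∀ i ∈ s, IsDiag (d i) (T i)) : IsDiag (fun p => ∑ i ∈ s, d i p) (∑ i ∈ s, T i) := by
  intro p
  rw [Matrix.sum_mulVec, Finset.sum_congr rfl fun i hi => h i hi p, ← Finset.sum_smul]

theorem IsDiag.congr {d d' : Site L Nt Ns j → ℂ} {T : Op L Nt Ns j j} (h : IsDiag d T)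
    (hd : ∀ p, d p = d' p) : IsDiag d' T := by
  intro p; rw [h, hd]

theorem IsUp.congr {x x' : Site L Nt Ns j → ℂ} {X : Op L Nt Ns 0 j} (h : IsUp x X)
    (hx : ∀ p, x p = x' p) : IsUp x' X := by
  intro p; rw [h]; simp only [hx]

theorem IsUp.mul_isDiag {x : Site L Nt Ns j → ℂ} {X : Op L Nt Ns 0 j} {c : Site L Nt Ns 0 → ℂ}
    {C : Op L Nt Ns 0 0} (h : IsUp x X) (hC : IsDiag c C) :
    IsUp (fun p => c (proj 0 p) * x p) (X * C) := by
  intro k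
  rw [← Matrix.mulVec_mulVec, hC, Matrix.mulVec_smul, h, Finset.smul_sum]
  refine Finset.sum_congr rfl fun p hp => ?_
  simp only [smul_smul, mem_fib.mp hp]

theorem IsDown.mul_isUp {x y : Site L Nt Ns j → ℂ} {A : Op L Nt Ns j 0} {X : Op L Nt Ns 0 j}
    (hA : IsDown x A) (hX : IsUp y X) : IsDiag (fun k => ∑ p ∈ fib j k, x p * y p) (A * X) := by
  intro k
  rw [← Matrix.mulVec_mulVec, hX, Matrix.mulVec_sum, Finset.sum_smul]
  refine Finset.sum_congr rfl fun p hp => ?_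
  rw [Matrix.mulVec_smul, hA, smul_smul, mem_fib.mp hp, mul_comm]

/-- Again because of bilinearity the symbol is a sum of `x (-p) * x p` and not of squared moduli;
positivity is recovered later, only at real momenta and `μ = 0`. -/
theorem IsUp.gram {x : Site L Nt Ns j → ℂ} {X : Op L Nt Ns 0 j} (h : IsUp x X) :
    IsDiag (fun k => ∑ p ∈ fib j k, x (-p) * x p) (gram L Nt Ns X) :=
  h.adj.mul_isUp h

/-- The operator that is diagonal on plane waves with given eigenvalues. -/
noncomputable def diagOp (d : Site L Nt Ns j → ℂ) : Op L Nt Ns j j :=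
  fun u v => (Fintype.card (Site L Nt Ns j) : ℂ)⁻¹ * ∑ p, d p * wave p (u - v)

theorem isDiag_diagOp (d : Site L Nt Ns j → ℂ) : IsDiag d (diagOp d) := by
  intro p
  funext u
  simp only [Matrix.mulVec, dotProduct, diagOp, Pi.smul_apply, smul_eq_mul, mul_assoc]
  rw [← Finset.mul_sum, inv_mul_eq_iff_eq_mul₀ card_site_ne_zero]
  simp only [Finset.sum_mul]
  rw [Finset.sum_comm]
  have : ∀ p' : Site L Nt Ns j, ∑ v, d p' * wave p' (u - v) * wave p v =
      d p' * wave p' u * ∑ v, wave (p - p') v := fun p' => by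
    rw [Finset.mul_sum]
    refine Finset.sum_congr rfl fun v _ => ?_
    rw [sub_eq_add_neg, wave_add_right, sub_eq_add_neg, wave_add_left]
    have : wave p' (-v) = wave (-p') v := by simp [wave]
    rw [this]; ring
  simp only [this, sum_wave, sub_eq_zero]
  simp [mul_comm]

theorem IsDiag.eq_diagOp {d : Site L Nt Ns j → ℂ} {T : Op L Nt Ns j j} (h : IsDiag d T) :
    T = diagOp d :=
  matrix_eq_of_mulVec_wave fun p => by rw [h, isDiag_diagOp]

/-- The inverse is returned as an explicit Fourier sum, which is the form needed for kernel
estimates. -/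
theorem IsDiag.isUnit_and_inv {d : Site L Nt Ns j → ℂ} {T : Op L Nt Ns j j} (h : IsDiag d T)
    (hd : ∀ p, d p ≠ 0) : IsUnit T ∧ T⁻¹ = diagOp fun p => (d p)⁻¹ := by
  have h1 : T * diagOp (fun p => (d p)⁻¹) = 1 := by
    rw [((h.mul (isDiag_diagOp _)).congr fun p => mul_inv_cancel₀ (hd p)).eq_diagOp,
      ← isDiag_one.eq_diagOp]
  exact ⟨IsUnit.of_mul_eq_one _ h1, Matrix.inv_eq_right_inv h1⟩

theorem IsDiag.inv {d : Site L Nt Ns j → ℂ} {T : Op L Nt Ns j j} (h : IsDiag d T)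
    (hd : ∀ p, d p ≠ 0) : IsDiag (fun p => (d p)⁻¹) T⁻¹ := by
  rw [(h.isUnit_and_inv hd).2]
  exact isDiag_diagOp _

end Symbols

end BlockSpin

namespace BlockSpin

/-! ### Resolvents of rank one perturbations -/

section RankOne

variable {L Nt Ns : ℕ} [NeZero L] [NeZero Nt] [NeZero Ns] {j : ℕ}

/-- The product of the values of `d` at the other momenta over the same unit momentum. -/
noncomputable def cofac (d : Site L Nt Ns j → ℂ) (p : Site L Nt Ns j) : ℂ :=
  ∏ p' ∈ (fib j (proj 0 p)).erase p, d p'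

/-- The determinant of the block over `k` of the matrix with diagonal `d` and a rank one
perturbation with diagonal `c * β`. -/
noncomputable def secDet (d β : Site L Nt Ns j → ℂ) (c : Site L Nt Ns 0 → ℂ)
    (k : Site L Nt Ns 0) : ℂ :=
  ∏ p ∈ fib j k, d p + c k * ∑ p ∈ fib j k, β p * cofac d p

theorem mul_cofac (d : Site L Nt Ns j → ℂ) {k : Site L Nt Ns 0} {p : Site L Nt Ns j}
    (hp : p ∈ fib j k) : d p * cofac d p = ∏ p' ∈ fib j k, d p' := by
  rw [cofac, mem_fib.mp hp, Finset.mul_prod_erase _ _ hp]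

theorem prod_fib_neg (f : Site L Nt Ns j → ℂ) (k : Site L Nt Ns 0) :
    ∏ p ∈ fib j (-k), f p = ∏ p ∈ fib j k, f (-p) := by
  refine Finset.prod_bij (fun p _ => -p) ?_ ?_ ?_ ?_
  · intro p hp; simp_all [proj_neg]
  · intro p _ p' _ h; simpa using h
  · intro p hp; exact ⟨-p, by simp_all [proj_neg], by simp⟩
  · intro p hp; simp

theorem cofac_neg (d : Site L Nt Ns j → ℂ) (p : Site L Nt Ns j) :
    cofac d (-p) = cofac (fun p => d (-p)) p := by
  rw [cofac, cofac]
  refine Finset.prod_bij (fun p _ => -p) ?_ ?_ ?_ ?_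
  · intro p' hp
    simp only [Finset.mem_erase, mem_fib, proj_neg (Nat.zero_le j)] at hp ⊢
    exact ⟨fun h => hp.1 (by rw [← h, neg_neg]), by rw [hp.2, neg_neg]⟩
  · intro p _ p' _ h; simpa using h
  · intro p' hp
    simp only [Finset.mem_erase, mem_fib] at hp
    refine ⟨-p', ?_, by simp⟩
    simp only [Finset.mem_erase, mem_fib, proj_neg (Nat.zero_le j)]
    exact ⟨fun h => hp.1 (by simpa using h), by rw [hp.2]⟩
  · intro p hp; simp

theorem secDet_neg {d β : Site L Nt Ns j → ℂ} {c : Site L Nt Ns 0 → ℂ} (hβ : ∀ p, β (-p) = β p)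
    (hc : ∀ k, c (-k) = c k) (k : Site L Nt Ns 0) :
    secDet d β c (-k) = secDet (fun p => d (-p)) β c k := by
  simp only [secDet, prod_fib_neg, sum_fib_neg, hc, hβ, cofac_neg]

variable {d b b' : Site L Nt Ns j → ℂ} {c : Site L Nt Ns 0 → ℂ} {T₀ : Op L Nt Ns j j}
  {U : Op L Nt Ns 0 j} {C : Op L Nt Ns 0 0} {W : Op L Nt Ns j 0}

theorem rankOne_mulVec_wave (hT : IsDiag d T₀) (hU : IsUp b U) (hC : IsDiag c C)
    (hW : IsDown b' W) (p : Site L Nt Ns j) :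
    (T₀ + U * C * W).mulVec (wave p) = d p • wave p +
      (b' p * c (proj 0 p)) • ∑ p' ∈ fib j (proj 0 p), b p' • wave p' := by
  rw [Matrix.add_mulVec, hT, ← Matrix.mulVec_mulVec, hW, Matrix.mulVec_smul,
    ← Matrix.mulVec_mulVec, hC, Matrix.mulVec_smul, hU, smul_smul]

/-- Cramer's rule for a diagonal matrix plus a rank one matrix. Cofactors replace the quotients `b /
d`, so the identity needs no entry of `d` to be nonzero. -/
theorem rankOne_mulVec_sum (hT : IsDiag d T₀) (hU : IsUp b U) (hC : IsDiag c C)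
    (hW : IsDown b' W) (k : Site L Nt Ns 0) :
    (T₀ + U * C * W).mulVec (∑ p ∈ fib j k, (b p * cofac d p) • wave p) =
      secDet d (fun p => b' p * b p) c k • ∑ p ∈ fib j k, b p • wave p := by
  rw [Matrix.mulVec_sum, secDet, add_smul, Finset.smul_sum]
  have h : ∀ p ∈ fib j k, (T₀ + U * C * W).mulVec ((b p * cofac d p) • wave p) =
      (∏ p' ∈ fib j k, d p') • b p • wave p +
        (c k * (b' p * b p * cofac d p)) • ∑ p' ∈ fib j k, b p' • wave p' := fun p hp => by
    rw [Matrix.mulVec_smul, rankOne_mulVec_wave hT hU hC hW, smul_add, smul_smul, smul_smul,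
      mem_fib.mp hp, smul_smul, ← mul_cofac d hp]
    congr 2 <;> ring
  rw [Finset.sum_congr rfl h, Finset.sum_add_distrib, ← Finset.sum_smul, ← Finset.mul_sum]

/-- Surjectivity is shown on plane waves. The range contains the vector `∑ b p • wave p` of each
fibre, hence every wave with `d p ≠ 0`. At most one wave per fibre is then left, and it is recovered
from the fibre vector because its coefficient `b p` is nonzero. -/
theorem rankOne_isUnit (hT : IsDiag d T₀) (hU : IsUp b U) (hC : IsDiag c C) (hW : IsDown b' W)
    (hΔ : ∀ k, secDet d (fun p => b' p * b p) c k ≠ 0)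
    (hd : ∀ p, d p = 0 → b p ≠ 0 ∧ ∀ p' ∈ fib j (proj 0 p), p' ≠ p → d p' ≠ 0) :
    IsUnit (T₀ + U * C * W) := by
  set T := T₀ + U * C * W with hTdef
  have hY : ∀ k, ∑ p ∈ fib j k, b p • wave p ∈ LinearMap.range T.mulVecLin := fun k => by
    refine ⟨(secDet d (fun p => b' p * b p) c k)⁻¹ •
      ∑ p ∈ fib j k, (b p * cofac d p) • wave p, ?_⟩
    rw [Matrix.mulVecLin_apply, Matrix.mulVec_smul, rankOne_mulVec_sum hT hU hC hW,
      smul_smul, inv_mul_cancel₀ (hΔ k), one_smul]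
  have hne : ∀ p, d p ≠ 0 → wave p ∈ LinearMap.range T.mulVecLin := fun p hp => by
    have h1 : T.mulVec (wave p) ∈ LinearMap.range T.mulVecLin := ⟨wave p, rfl⟩
    rw [hTdef, rankOne_mulVec_wave hT hU hC hW] at h1
    have h2 := (Submodule.add_mem_iff_left _ (Submodule.smul_mem _ _ (hY _))).mp h1
    exact (Submodule.smul_mem_iff _ hp).mp h2
  have hall : ∀ p, wave p ∈ LinearMap.range T.mulVecLin := fun p => by
    by_cases hp : d p = 0
    · obtain ⟨hb, hp'⟩ := hd p hp
      have h1 := hY (proj 0 p)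
      rw [← Finset.add_sum_erase _ _ (mem_fib.mpr (rfl : proj 0 p = proj 0 p))] at h1
      have h2 : ∑ x ∈ (fib j (proj 0 p)).erase p, b x • wave x ∈ LinearMap.range T.mulVecLin :=
        Submodule.sum_mem _ fun x hx => Submodule.smul_mem _ _
          (hne x (hp' x (Finset.mem_of_mem_erase hx) (Finset.ne_of_mem_erase hx)))
      exact (Submodule.smul_mem_iff _ hb).mp ((Submodule.add_mem_iff_left _ h2).mp h1)
    · exact hne p hp
  rw [← Matrix.mulVec_surjective_iff_isUnit]
  intro f
  have : f ∈ LinearMap.range T.mulVecLin := by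
    rw [eq_sum_smul_wave f]
    exact Submodule.sum_mem _ fun p _ => Submodule.smul_mem _ _ (hall p)
  exact this

theorem rankOne_isUp_inv (hT : IsDiag d T₀) (hU : IsUp b U) (hC : IsDiag c C) (hW : IsDown b' W)
    (hΔ : ∀ k, secDet d (fun p => b' p * b p) c k ≠ 0) (hunit : IsUnit (T₀ + U * C * W)) :
    IsUp (fun p => b p * cofac d p / secDet d (fun p => b' p * b p) c (proj 0 p))
      ((T₀ + U * C * W)⁻¹ * U) := by
  intro k
  have h := rankOne_mulVec_sum hT hU hC hW k
  rw [← Matrix.mulVec_mulVec, hU]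
  have h2 : ∑ p ∈ fib j k, b p • wave p = (T₀ + U * C * W).mulVec
      ((secDet d (fun p => b' p * b p) c k)⁻¹ •
        ∑ p ∈ fib j k, (b p * cofac d p) • wave p) := by
    rw [Matrix.mulVec_smul, h, smul_smul, inv_mul_cancel₀ (hΔ k), one_smul]
  rw [h2, Matrix.mulVec_mulVec,
    Matrix.nonsing_inv_mul _ ((Matrix.isUnit_iff_isUnit_det _).mp hunit), Matrix.one_mulVec,
    Finset.smul_sum]
  refine Finset.sum_congr rfl fun p hp => ?_
  simp only [smul_smul, mem_fib.mp hp, inv_mul_eq_div]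

/-- The denominator of the resolvent, relative to a distinguished fine momentum `p₀`. -/
noncomputable def denom (d β : Site L Nt Ns j → ℂ) (c : Site L Nt Ns 0 → ℂ)
    (p₀ : Site L Nt Ns j) : ℂ :=
  d p₀ + c (proj 0 p₀) * (β p₀ + d p₀ * ∑ p ∈ (fib j (proj 0 p₀)).erase p₀, β p / d p)

/-- Multiplied by `d p`, both sides are the product of `d` over the fibre. The value `d p₀` may
vanish, as it does at zero momentum for `μ = 0`. -/
theorem cofac_eq {d : Site L Nt Ns j → ℂ} {p₀ : Site L Nt Ns j}
    (hd : ∀ p ∈ (fib j (proj 0 p₀)).erase p₀, d p ≠ 0) {p : Site L Nt Ns j}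
    (hp : p ∈ (fib j (proj 0 p₀)).erase p₀) : cofac d p = cofac d p₀ * (d p₀ / d p) := by
  have h1 := mul_cofac d (Finset.mem_of_mem_erase hp)
  rw [← mul_cofac d (mem_fib.mpr (rfl : proj 0 p₀ = proj 0 p₀))] at h1
  have := hd p hp
  field_simp
  linear_combination h1

theorem secDet_eq {d : Site L Nt Ns j → ℂ} {p₀ : Site L Nt Ns j}
    (hd : ∀ p ∈ (fib j (proj 0 p₀)).erase p₀, d p ≠ 0) (β : Site L Nt Ns j → ℂ)
    (c : Site L Nt Ns 0 → ℂ) :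
    secDet d β c (proj 0 p₀) = cofac d p₀ * denom d β c p₀ := by
  have h0 : p₀ ∈ fib j (proj 0 p₀) := mem_fib.mpr rfl
  rw [secDet, ← mul_cofac d h0, ← Finset.add_sum_erase _ _ h0, denom]
  have : ∑ x ∈ (fib j (proj 0 p₀)).erase p₀, β x * cofac d x =
      cofac d p₀ * (d p₀ * ∑ p ∈ (fib j (proj 0 p₀)).erase p₀, β p / d p) := by
    rw [Finset.mul_sum, Finset.mul_sum]
    refine Finset.sum_congr rfl fun p hp => ?_
    rw [cofac_eq hd hp]
    ring
  rw [this]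
  ring

theorem cofac_ne_zero {d : Site L Nt Ns j → ℂ} {p₀ : Site L Nt Ns j}
    (hd : ∀ p ∈ (fib j (proj 0 p₀)).erase p₀, d p ≠ 0) : cofac d p₀ ≠ 0 :=
  Finset.prod_ne_zero_iff.mpr hd

/-- The numerator of the symbol of the Gram operator, relative to a distinguished momentum. -/
noncomputable def numer (d d' w : Site L Nt Ns j → ℂ) (p₀ : Site L Nt Ns j) : ℂ :=
  w p₀ + d p₀ * d' p₀ * ∑ p ∈ (fib j (proj 0 p₀)).erase p₀, w p / (d p * d' p)

/-- The factors `cofac d p₀` of numerator and denominators cancel. What remains divides only by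
values of `d` away from `p₀`, so it makes sense when `d p₀ = 0`. -/
theorem gram_symbol_eq {β : Site L Nt Ns j → ℂ} (hβ : ∀ p, β (-p) = β p)
    (hc : ∀ k, c (-k) = c k) {p₀ : Site L Nt Ns j}
    (hd : ∀ p ∈ (fib j (proj 0 p₀)).erase p₀, d p ≠ 0)
    (hd' : ∀ p ∈ (fib j (proj 0 p₀)).erase p₀, d (-p) ≠ 0)
    {x : Site L Nt Ns j → ℂ}
    (hx : ∀ p, x p = c (proj 0 p) * (b p * cofac d p / secDet d β c (proj 0 p))) :
    ∑ p ∈ fib j (proj 0 p₀), x (-p) * x p =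
      c (proj 0 p₀) ^ 2 * numer d (fun p => d (-p)) (fun p => b p * b (-p)) p₀ /
        (denom d β c p₀ * denom (fun p => d (-p)) β c p₀) := by
  have h0 : p₀ ∈ fib j (proj 0 p₀) := mem_fib.mpr rfl
  have hR := cofac_ne_zero hd
  have hR' := cofac_ne_zero (d := fun p => d (-p)) hd'
  set k := proj 0 p₀ with hk
  have h1 : ∀ p ∈ fib j k, x (-p) * x p =
      c k ^ 2 / (secDet d β c k * secDet (fun p => d (-p)) β c k) *
        (b p * b (-p) * (cofac d p * cofac (fun p => d (-p)) p)) := fun p hp => by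
    rw [hx, hx, proj_neg (Nat.zero_le j), mem_fib.mp hp, hc, secDet_neg hβ hc, cofac_neg]
    ring
  rw [Finset.sum_congr rfl h1, ← Finset.mul_sum, ← Finset.add_sum_erase _ _ h0, numer]
  have h2 : ∀ p ∈ (fib j k).erase p₀, b p * b (-p) * (cofac d p * cofac (fun p => d (-p)) p) =
      cofac d p₀ * cofac (fun p => d (-p)) p₀ * (d p₀ * d (-p₀) *
        (b p * b (-p) / (d p * d (-p)))) := fun p hp => by
    rw [cofac_eq hd hp, cofac_eq (d := fun p => d (-p)) hd' hp]
    ring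
  rw [Finset.sum_congr rfl h2, ← Finset.mul_sum, ← Finset.mul_sum, hk, secDet_eq hd,
    secDet_eq (d := fun p => d (-p)) hd', ← hk]
  have e : ∀ r r' A B c g : ℂ, r ≠ 0 → r' ≠ 0 → c ^ 2 / (r * A * (r' * B)) * (r * r' * g) =
      c ^ 2 * g / (A * B) := by
    intro r r' A B c g hr hr'
    rw [show r * A * (r' * B) = r * r' * (A * B) by ring]
    have : r * r' ≠ 0 := mul_ne_zero hr hr'
    field_simp
  rw [← e _ _ _ _ _ _ hR hR']
  ring

end RankOne

end BlockSpin

namespace BlockSpin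

/-! ### The symbol of block averaging in one direction -/

/-- The symbol of averaging over `b` consecutive points of spacing `1 / b`. -/
noncomputable def box (b : ℕ) (w : ℂ) : ℂ :=
  (b : ℂ)⁻¹ * ∑ i ∈ Finset.range b, Complex.exp (Complex.I * ((2 * i - (b - 1)) * w / (2 * b)))

/-- The symbol of averaging over `b ^ n` points of spacing `b ^ (-n)`. -/
noncomputable def avgSymb (b n : ℕ) (z : ℂ) : ℂ := ∏ j ∈ Finset.range n, box b (z / (b : ℂ) ^ j)

theorem differentiable_box (b : ℕ) : Differentiable ℂ (box b) := by
  unfold box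
  fun_prop

theorem differentiable_avgSymb (b n : ℕ) : Differentiable ℂ (avgSymb b n) := by
  unfold avgSymb
  refine Differentiable.fun_finsetProd fun j _ => ?_
  exact (differentiable_box b).comp (by fun_prop)

theorem box_neg (b : ℕ) (w : ℂ) : box b (-w) = box b w := by
  unfold box
  rw [← Finset.sum_range_reflect]
  congr 1
  refine Finset.sum_congr rfl fun i hi => ?_
  have hi' : i + 1 ≤ b := Finset.mem_range.mp hi
  have : ((b - 1 - i : ℕ) : ℂ) = b - 1 - i := by
    rw [Nat.sub_sub, add_comm, Nat.cast_sub hi']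
    push_cast
    ring
  rw [this]
  congr 1
  ring

theorem avgSymb_neg (b n : ℕ) (z : ℂ) : avgSymb b n (-z) = avgSymb b n z := by
  unfold avgSymb
  simp only [neg_div, box_neg]

theorem box_zero {b : ℕ} (hb : b ≠ 0) : box b 0 = 1 := by
  have : (b : ℂ) ≠ 0 := Nat.cast_ne_zero.mpr hb
  simp [box, this]

theorem natCast_ne_zero_of_odd {b : ℕ} (hb : Odd b) : (b : ℂ) ≠ 0 := by
  rw [Nat.cast_ne_zero]
  rintro rfl
  simp at hb

/-- For odd `b` the frequencies `(2i - (b - 1)) / 2` are integers. -/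
theorem box_periodic {b : ℕ} (hb : Odd b) (w : ℂ) (t : ℤ) :
    box b (w + 2 * Real.pi * b * t) = box b w := by
  unfold box
  congr 1
  refine Finset.sum_congr rfl fun i _ => ?_
  have hb0 := natCast_ne_zero_of_odd hb
  obtain ⟨m, hm⟩ := hb
  have : Complex.I * ((2 * i - (b - 1)) * (w + 2 * Real.pi * b * t) / (2 * b)) =
      Complex.I * ((2 * i - (b - 1)) * w / (2 * b)) +
        (((i : ℤ) - m) * t : ℤ) * (2 * Real.pi * Complex.I) := by
    field_simp
    rw [hm]
    push_cast
    ring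
  rw [this, Complex.exp_add, Complex.exp_int_mul_two_pi_mul_I, mul_one]

/-- The factor with index `j < n` has period `2π b^(j+1)`, which divides `2π b^n`. -/
theorem avgSymb_periodic {b : ℕ} (hb : Odd b) (n : ℕ) (z : ℂ) (t : ℤ) :
    avgSymb b n (z + 2 * Real.pi * b ^ n * t) = avgSymb b n z := by
  unfold avgSymb
  refine Finset.prod_congr rfl fun j hj => ?_
  have hb0 := natCast_ne_zero_of_odd hb
  obtain ⟨i, rfl⟩ := Nat.exists_eq_add_of_lt (Finset.mem_range.mp hj)
  rw [← box_periodic hb (z / (b : ℂ) ^ j) ((b : ℤ) ^ i * t)]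
  congr 1
  push_cast
  rw [pow_succ, pow_add]
  field_simp

/-- A geometric sum: multiplied by the sine of the half step it telescopes. The product form avoids
dividing by a sine that may vanish. -/
theorem mul_box (b : ℕ) (hb : b ≠ 0) (w : ℂ) :
    b * Complex.sin (w / (2 * b)) * box b w = Complex.sin (w / 2) := by
  have hb' : (b : ℂ) ≠ 0 := Nat.cast_ne_zero.mpr hb
  set f : ℕ → ℂ := fun i => Complex.exp (Complex.I * ((2 * i - b) * w / (2 * b))) with hf
  have h : ∀ i : ℕ, 2 * Complex.I * Complex.sin (w / (2 * b)) *
      Complex.exp (Complex.I * ((2 * i - (b - 1)) * w / (2 * b))) = f (i + 1) - f i := by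
    intro i
    have e1 : f (i + 1) = Complex.exp (w / (2 * b) * Complex.I) *
        Complex.exp (Complex.I * ((2 * i - (b - 1)) * w / (2 * b))) := by
      simp only [hf]
      rw [← Complex.exp_add]
      congr 1
      push_cast
      ring
    have e2 : f i = Complex.exp (-(w / (2 * b)) * Complex.I) *
        Complex.exp (Complex.I * ((2 * i - (b - 1)) * w / (2 * b))) := by
      simp only [hf]
      rw [← Complex.exp_add]
      congr 1
      ring
    rw [e1, e2, ← sub_mul, Complex.sin]
    congr 1
    linear_combination (Complex.exp (-(w / (2 * b)) * Complex.I) -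
      Complex.exp (w / (2 * b) * Complex.I)) * Complex.I_mul_I
  have h2 := Finset.sum_range_sub f b
  rw [← Finset.sum_congr rfl fun i _ => h i, ← Finset.mul_sum] at h2
  have h3 : f b - f 0 = 2 * Complex.I * Complex.sin (w / 2) := by
    simp only [hf]
    rw [Complex.sin, show Complex.I * ((2 * (b : ℂ) - b) * w / (2 * b)) = w / 2 * Complex.I by
      field_simp; ring, show Complex.I * ((2 * ((0 : ℕ) : ℂ) - b) * w / (2 * b)) =
      -(w / 2) * Complex.I by field_simp; push_cast; ring]
    linear_combination (Complex.exp (w / 2 * Complex.I) -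
      Complex.exp (-(w / 2) * Complex.I)) * Complex.I_mul_I
  rw [h3] at h2
  have hI : 2 * Complex.I ≠ 0 := by simp
  apply mul_left_cancel₀ hI
  rw [← h2, box]
  field_simp

/-- The sines of consecutive scales telescope. -/
theorem mul_avgSymb (b n : ℕ) (hb : b ≠ 0) (z : ℂ) :
    (b : ℂ) ^ n * Complex.sin (z / (2 * (b : ℂ) ^ n)) * avgSymb b n z = Complex.sin (z / 2) := by
  induction n with
  | zero => simp [avgSymb]
  | succ n ih =>
    have h := mul_box b hb (z / (b : ℂ) ^ n)
    rw [← ih, avgSymb, Finset.prod_range_succ, ← avgSymb,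
      show z / (2 * (b : ℂ) ^ n) = z / (b : ℂ) ^ n / 2 by ring, ← h,
      show z / (2 * (b : ℂ) ^ (n + 1)) = z / (b : ℂ) ^ n / (2 * b) by rw [pow_succ]; ring]
    ring

theorem norm_box_le (b : ℕ) (hb : b ≠ 0) (w : ℂ) : ‖box b w‖ ≤ Real.exp (|w.im| / 2) := by
  have hb0 : (0 : ℝ) < b := Nat.cast_pos.mpr (Nat.pos_of_ne_zero hb)
  rw [box, norm_mul, norm_inv, Complex.norm_natCast, inv_mul_le_iff₀ hb0]
  refine (norm_sum_le _ _).trans ?_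
  refine (Finset.sum_le_card_nsmul _ _ (Real.exp (|w.im| / 2)) fun i hi => ?_).trans (by simp)
  rw [Complex.norm_exp]
  apply Real.exp_le_exp.mpr
  have hi' : (i : ℝ) + 1 ≤ b := by exact_mod_cast Finset.mem_range.mp hi
  have e : (Complex.I * ((2 * i - (b - 1)) * w / (2 * b))).re =
      -((2 * i - (b - 1)) / b * (w.im / 2)) := by
    rw [show Complex.I * ((2 * i - (b - 1)) * w / (2 * b)) =
      (((2 * i - (b - 1)) / b / 2 : ℝ) : ℂ) * (Complex.I * w) by push_cast; ring,
      Complex.re_ofReal_mul]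
    simp
    ring
  rw [e]
  refine (neg_le_abs _).trans ?_
  rw [abs_mul, abs_div w.im, abs_two]
  refine mul_le_of_le_one_left (by positivity) ?_
  rw [abs_div, abs_of_pos hb0, div_le_one hb0, abs_le]
  have : (0 : ℝ) ≤ i := Nat.cast_nonneg i
  constructor <;> linarith

theorem norm_avgSymb_le (b n : ℕ) (hb : 2 ≤ b) (z : ℂ) : ‖avgSymb b n z‖ ≤ Real.exp |z.im| := by
  have hb2 : (2 : ℝ) ≤ b := by exact_mod_cast hb
  -- The exponents `|Im z| / (2 b^j)` sum to less than `|Im z|` because `b ≥ 2`; the deficit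
  -- `(1/2)^n` makes the induction close.
  suffices h : ‖avgSymb b n z‖ ≤ Real.exp (|z.im| * (1 - (1 / 2) ^ n)) by
    refine h.trans (Real.exp_le_exp.mpr ?_)
    refine mul_le_of_le_one_right (abs_nonneg _) ?_
    linarith [pow_pos (one_half_pos (α := ℝ)) n]
  induction n with
  | zero => simp [avgSymb]
  | succ n ih =>
    rw [avgSymb, Finset.prod_range_succ, ← avgSymb, norm_mul]
    refine (mul_le_mul ih (norm_box_le b (by lia) _) (norm_nonneg _) (Real.exp_pos _).le).trans ?_
    rw [← Real.exp_add]
    apply Real.exp_le_exp.mpr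
    have e : (z / (b : ℂ) ^ n).im = z.im / (b : ℝ) ^ n := by
      rw [show z / (b : ℂ) ^ n = z / (((b : ℝ) ^ n : ℝ) : ℂ) by push_cast; rfl,
        Complex.div_ofReal_im]
    rw [e, abs_div, abs_of_pos (by positivity : (0 : ℝ) < (b : ℝ) ^ n)]
    have h1 : |z.im| / (b : ℝ) ^ n ≤ |z.im| * (1 / 2) ^ n := by
      rw [div_eq_mul_inv, one_div, inv_pow]
      gcongr
    rw [pow_succ]
    linarith

theorem avgSymb_ofReal {b : ℕ} (hb : Odd b) (n : ℕ) (x : ℝ) :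
    avgSymb b n x = (sinRatio (b ^ n) x : ℂ) := by
  have hb0 : b ≠ 0 := by rintro rfl; simp at hb
  have hM : ((b : ℝ) ^ n) ≠ 0 := pow_ne_zero _ (Nat.cast_ne_zero.mpr hb0)
  have h := mul_avgSymb b n hb0 (x : ℂ)
  have e : (x : ℂ) / (2 * (b : ℂ) ^ n) = ((x / (2 * (b : ℝ) ^ n) : ℝ) : ℂ) := by push_cast; rfl
  rw [sinRatio]
  split_ifs with h0
  · push_cast at h0
    -- At a removable singularity `x` is a multiple of the period, so the value is the one at `0`.
    obtain ⟨t, ht⟩ := Real.sin_eq_zero_iff.mp h0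
    have hx : x = 2 * Real.pi * (b : ℝ) ^ n * t := by
      rw [eq_div_iff (by positivity)] at ht
      linarith
    have := avgSymb_periodic hb n 0 t
    rw [zero_add] at this
    rw [hx]
    push_cast
    rw [this]
    simp [avgSymb, box_zero hb0]
  · push_cast at h0 ⊢
    rw [e] at h
    have h1 : (b : ℂ) ^ n * Complex.sin ((x / (2 * (b : ℝ) ^ n) : ℝ) : ℂ) ≠ 0 := by
      rw [← Complex.ofReal_sin]
      refine mul_ne_zero (pow_ne_zero _ (Nat.cast_ne_zero.mpr hb0)) ?_
      exact_mod_cast h0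
    rw [← e] at h h1
    rw [eq_div_iff h1, mul_comm, h]

/-! ### The averaging operators on plane waves -/

section Profile

open Function

theorem conv_eq_sum {f : (Fin 4 → ℤ) → ℝ} {s : Finset (Fin 4 → ℤ)} (hs : support f ⊆ s)
    (g : (Fin 4 → ℤ) → ℝ) (x : Fin 4 → ℤ) : conv f g x = ∑ y ∈ s, f y * g (x - y) := by
  rw [conv, tsum_eq_sum]
  intro y hy
  rw [notMem_support.mp fun h => hy (hs h), zero_mul]

theorem support_conv_finite {f g : (Fin 4 → ℤ) → ℝ} (hf : (support f).Finite)
    (hg : (support g).Finite) : (support (conv f g)).Finite := by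
  refine (hf.add hg).subset fun x hx => ?_
  rw [mem_support, conv_eq_sum (s := hf.toFinset) (by simp)] at hx
  obtain ⟨y, hy, hxy⟩ := Finset.exists_ne_zero_of_sum_ne_zero hx
  exact ⟨y, left_ne_zero_of_mul hxy, x - y, right_ne_zero_of_mul hxy, by simp⟩

theorem tsum_conv_mul {f g : (Fin 4 → ℤ) → ℝ} (hf : (support f).Finite)
    (hg : (support g).Finite) {χ : (Fin 4 → ℤ) → ℂ} (hχ : ∀ x y, χ (x + y) = χ x * χ y) :
    ∑' x, (conv f g x : ℂ) * χ x = (∑' x, (f x : ℂ) * χ x) * ∑' x, (g x : ℂ) * χ x := by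
  have hsum : Summable fun x => (g x : ℂ) * χ x :=
    summable_of_hasFiniteSupport (hg.subset fun x hx => by
      simpa using left_ne_zero_of_mul hx)
  have h1 : ∀ x, (conv f g x : ℂ) * χ x =
      ∑ y ∈ hf.toFinset, (f y : ℂ) * χ y * ((g (x - y) : ℂ) * χ (x - y)) := fun x => by
    rw [conv_eq_sum (s := hf.toFinset) (by simp)]
    push_cast
    rw [Finset.sum_mul]
    refine Finset.sum_congr rfl fun y _ => ?_
    have := hχ y (x - y)
    rw [add_sub_cancel] at this
    rw [this]
    ring
  simp only [h1]
  rw [Summable.tsum_finsetSum]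
  · have h2 : ∀ y, ∑' x, (f y : ℂ) * χ y * ((g (x - y) : ℂ) * χ (x - y)) =
        (f y : ℂ) * χ y * ∑' x, (g x : ℂ) * χ x := fun y => by
      rw [tsum_mul_left]
      exact congrArg _ ((Equiv.subRight y).tsum_eq fun x => (g x : ℂ) * χ x)
    simp only [h2, ← Finset.sum_mul]
    rw [tsum_eq_sum (s := hf.toFinset) (f := fun x => (f x : ℂ) * χ x)]
    intro x hx
    have : f x = 0 := by simpa using hx
    rw [this, Complex.ofReal_zero, zero_mul]
  · intro y _
    exact ((Equiv.subRight y).summable_iff (f := fun x => (g x : ℂ) * χ x)).mpr hsum |>.mul_left _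

theorem rectInd_eq {L : ℕ} (hL : Odd L) (x : Fin 4 → ℤ) : rectInd L x =
    if x ∈ Fintype.piFinset fun ν => Finset.Icc (-((blockLen L ν : ℤ) / 2)) ((blockLen L ν : ℤ) / 2)
    then 1 else 0 := by
  have hodd : ∀ ν, Odd (blockLen L ν) := fun ν => by
    unfold blockLen; split_ifs
    exacts [hL.pow, hL]
  unfold rectInd
  congr 1
  simp only [Fintype.mem_piFinset, Finset.mem_Icc, eq_iff_iff]
  refine forall_congr' fun ν => ?_
  obtain ⟨m, hm⟩ := hodd ν
  rw [← abs_le]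
  lia

theorem support_rectInd_finite {L : ℕ} (hL : Odd L) : (support (rectInd L)).Finite := by
  refine (Fintype.piFinset fun ν =>
    Finset.Icc (-((blockLen L ν : ℤ) / 2)) ((blockLen L ν : ℤ) / 2)).finite_toSet.subset ?_
  intro x hx
  rw [mem_support, rectInd_eq hL] at hx
  by_contra h
  exact hx (if_neg h)

theorem sum_Icc_eq_sum_range {b : ℕ} (hb : Odd b) (f : ℤ → ℂ) :
    ∑ x ∈ Finset.Icc (-((b : ℤ) / 2)) ((b : ℤ) / 2), f x =
      ∑ i ∈ Finset.range b, f (i - (b : ℤ) / 2) := by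
  obtain ⟨m, hm⟩ := hb
  symm
  refine Finset.sum_bij (fun i _ => (i : ℤ) - (b : ℤ) / 2) ?_ ?_ ?_ ?_
  · intro i hi
    simp only [Finset.mem_range, Finset.mem_Icc] at hi ⊢
    lia
  · intro i _ i' _ h
    lia
  · intro x hx
    simp only [Finset.mem_Icc] at hx
    exact ⟨(x + (b : ℤ) / 2).toNat, by simp only [Finset.mem_range]; lia, by lia⟩
  · intro i _
    rfl

theorem tsum_rectInd_mul {L : ℕ} (hL : Odd L) (w : Fin 4 → ℂ) :
    ∑' x : Fin 4 → ℤ, (rectInd L x : ℂ) *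
      Complex.exp (Complex.I * ∑ ν, w ν / blockLen L ν * x ν) =
      (L : ℂ) ^ 5 * ∏ ν, box (blockLen L ν) (w ν) := by
  have hodd : ∀ ν, Odd (blockLen L ν) := fun ν => by
    unfold blockLen; split_ifs
    exacts [hL.pow, hL]
  have hL0 : L ≠ 0 := by rintro rfl; simp at hL
  rw [tsum_eq_sum (s := Fintype.piFinset fun ν =>
    Finset.Icc (-((blockLen L ν : ℤ) / 2)) ((blockLen L ν : ℤ) / 2))]
  · have h5 : (L : ℂ) ^ 5 = ∏ ν, (blockLen L ν : ℂ) := by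
      simp [Fin.prod_univ_four, blockLen]; ring
    rw [h5, ← Finset.prod_mul_distrib]
    have h1 : ∀ ν, (blockLen L ν : ℂ) * box (blockLen L ν) (w ν) =
        ∑ x ∈ Finset.Icc (-((blockLen L ν : ℤ) / 2)) ((blockLen L ν : ℤ) / 2),
          Complex.exp (Complex.I * (w ν / blockLen L ν * x)) := fun ν => by
      have hb0 := natCast_ne_zero_of_odd (hodd ν)
      rw [sum_Icc_eq_sum_range (hodd ν), box, mul_inv_cancel_left₀ hb0]
      refine Finset.sum_congr rfl fun i _ => ?_
      congr 2
      obtain ⟨m, hm⟩ := hodd ν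
      have hm' : (blockLen L ν : ℤ) / 2 = m := by lia
      have hb : (blockLen L ν : ℂ) = 2 * m + 1 := by rw [hm]; push_cast; ring
      rw [hm']
      field_simp
      push_cast
      rw [hb]
      ring
    simp only [h1]
    rw [Finset.prod_univ_sum]
    refine Finset.sum_congr rfl fun x hx => ?_
    rw [rectInd_eq hL, if_pos hx, Complex.ofReal_one, one_mul, Finset.mul_sum, Complex.exp_sum]
  · intro x hx
    rw [rectInd_eq hL, if_neg hx, Complex.ofReal_zero, zero_mul]

/-- A multiplicative `χ` turns convolution powers into powers; the finite support is carried through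
the induction because it justifies the sums. The unit `δ` is given by its values so that the choice
of decidability instance plays no role. -/
theorem iterate_conv_rectInd {L : ℕ} (hL : Odd L) {χ : (Fin 4 → ℤ) → ℂ} (hχ0 : χ 0 = 1)
    (hχ : ∀ x y, χ (x + y) = χ x * χ y) (q : ℕ) {δ : (Fin 4 → ℤ) → ℝ}
    (hδ : ∀ y, δ y = if y = 0 then 1 else 0) :
    (support ((conv (rectInd L))^[q] δ)).Finite ∧
      ∑' x, (((conv (rectInd L))^[q] δ x : ℝ) : ℂ) * χ x =
        (∑' x, (rectInd L x : ℂ) * χ x) ^ q := by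
  induction q with
  | zero =>
    have hs : support δ ⊆ {0} := fun x hx => by
      by_contra h
      rw [mem_support, hδ, if_neg (by simpa using h)] at hx
      exact hx rfl
    refine ⟨(Set.finite_singleton _).subset hs, ?_⟩
    rw [tsum_eq_single 0]
    · simp [hδ, hχ0]
    · intro x hx
      simp [hδ, hx]
  | succ q ih =>
    rw [iterate_succ_apply']
    refine ⟨support_conv_finite (support_rectInd_finite hL) ih.1, ?_⟩
    rw [tsum_conv_mul (support_rectInd_finite hL) ih.1 hχ, ih.2, pow_succ, mul_comm]

theorem tsum_profile_mul {L : ℕ} (hL : Odd L) (q : ℕ) (w : Fin 4 → ℂ) :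
    (support (profile L q)).Finite ∧ ∑' x : Fin 4 → ℤ, (profile L q x : ℂ) *
      Complex.exp (Complex.I * ∑ ν, w ν / blockLen L ν * x ν) =
      (∏ ν, box (blockLen L ν) (w ν)) ^ q := by
  have h := iterate_conv_rectInd hL
    (χ := fun x => Complex.exp (Complex.I * ∑ ν, w ν / blockLen L ν * x ν)) (by simp)
    (fun x y => by
      rw [← Complex.exp_add, ← mul_add, ← Finset.sum_add_distrib]
      simp only [Pi.add_apply, Int.cast_add, mul_add]) q
    (δ := fun y => open Classical in if y = 0 then 1 else 0) (fun y => by congr)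
  refine ⟨h.1.subset fun x hx => right_ne_zero_of_mul hx, ?_⟩
  have hL0 : (L : ℂ) ≠ 0 := by
    rw [Nat.cast_ne_zero]; rintro rfl; simp at hL
  simp only [profile, Complex.ofReal_mul, mul_assoc]
  rw [tsum_mul_left, h.2, tsum_rectInd_mul hL, mul_pow, ← pow_mul]
  push_cast
  rw [inv_mul_cancel_left₀ (pow_ne_zero _ hL0)]

end Profile

/-! ### Symbols of `Q_j` and `𝔔_n`, and the fibres over a unit momentum -/

section Averaging

variable {L Nt Ns : ℕ} [NeZero L] [NeZero Nt] [NeZero Ns]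

/-- The momentum with given integer coordinates. -/
noncomputable def mom (Nt Ns : ℕ) (P : Fin 4 → ℤ) (ν : Fin 4) : ℝ :=
  2 * Real.pi * P ν / side Nt Ns ν

theorem wave_ofInt_mom {j : ℕ} (P U : Fin 4 → ℤ) : wave (ofInt P : Site L Nt Ns j) (ofInt U) =
    Complex.exp (Complex.I * ∑ ν, (mom Nt Ns P ν : ℂ) * (U ν / (blockLen L ν : ℂ) ^ j)) := by
  rw [wave_ofInt]
  simp [mom]

/-- The inclusion does not move the physical point, so a plane wave restricts to the wave with the
same integer label. -/
theorem wave_incl {j : ℕ} (P : Fin 4 → ℤ) (y : Site L Nt Ns j) :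
    wave (ofInt P) (incl L Nt Ns j y) = wave (ofInt P) y := by
  have h1 : incl L Nt Ns j y = ofInt fun ν => (blockLen L ν : ℤ) * ((y ν).val : ℤ) := by
    funext ν; simp [incl, ofInt]
  conv_rhs => rw [← ofInt_val y]
  rw [h1, wave_ofInt_mom, wave_ofInt_mom]
  congr 2
  refine Finset.sum_congr rfl fun ν _ => ?_
  have hb : (blockLen L ν : ℂ) ≠ 0 := Nat.cast_ne_zero.mpr (NeZero.ne _)
  push_cast
  rw [pow_succ]
  field_simp

theorem avgStep_mulVec_wave (hL : Odd L) (q j : ℕ) (P : Fin 4 → ℤ) :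
    (avgStep L Nt Ns q j).mulVec (wave (ofInt P)) =
      (∏ ν, box (blockLen L ν) (mom Nt Ns P ν / (blockLen L ν : ℂ) ^ j)) ^ q •
        wave (ofInt P) := by
  classical
  obtain ⟨hfin, hsum⟩ := tsum_profile_mul hL q
    (fun ν => (mom Nt Ns P ν : ℂ) / (blockLen L ν : ℂ) ^ j)
  have h0 : ∀ x ∉ hfin.toFinset, profile L q x = 0 := fun x hx => by simpa using hx
  funext y
  simp only [Matrix.mulVec, dotProduct, avgStep, Pi.smul_apply, smul_eq_mul]
  have h1 : ∀ z : Site L Nt Ns (j + 1), (((∑' x : Fin 4 → ℤ,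
      if z = incl L Nt Ns j y + (fun ν => ((x ν : ℤ) : ZMod _)) then profile L q x else 0 : ℝ)) : ℂ)
      = ∑ x ∈ hfin.toFinset, if z = incl L Nt Ns j y + ofInt x then (profile L q x : ℂ) else 0 := by
    intro z
    rw [tsum_eq_sum (s := hfin.toFinset) fun x hx => by rw [h0 x hx, ite_self]]
    simp only [Complex.ofReal_sum, apply_ite Complex.ofReal, Complex.ofReal_zero]
    rfl
  simp only [h1, Finset.sum_mul]
  rw [Finset.sum_comm]
  simp only [ite_mul, zero_mul, Finset.sum_ite_eq', Finset.mem_univ, if_true,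
    wave_add_right, wave_incl]
  rw [← hsum, tsum_eq_sum (s := hfin.toFinset) fun x hx => by rw [h0 x hx]; simp, Finset.sum_mul]
  refine Finset.sum_congr rfl fun x _ => ?_
  rw [wave_ofInt_mom, mul_comm (wave _ y), ← mul_assoc]
  congr 4
  refine Finset.sum_congr rfl fun ν _ => ?_
  rw [pow_succ]
  field_simp

/-- The symbol of the iterated block average. -/
noncomputable def volSymb (L n : ℕ) (e : Fin 4 → ℕ) (z : Fin 4 → ℂ) : ℂ :=
  ∏ ν, avgSymb (blockLen L ν) n (z ν) ^ e ν

/-- A function of momentum, regarded as a function on the dual of a torus. -/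
noncomputable def symb {j : ℕ} (Φ : (Fin 4 → ℂ) → ℂ) (p : Site L Nt Ns j) : ℂ :=
  Φ fun ν => mom Nt Ns (fun ν => ((p ν).val : ℤ)) ν

/-- `Φ` has period `2π L_ν^n` in each direction. -/
def HasPeriods (L n : ℕ) (Φ : (Fin 4 → ℂ) → ℂ) : Prop :=
  ∀ (z : Fin 4 → ℂ) (t : Fin 4 → ℤ),
    Φ (fun ν => z ν + 2 * Real.pi * (blockLen L ν : ℂ) ^ n * t ν) = Φ z

/-- `symb` evaluates at the representative `val`; periodicity makes every other representative
equally good. -/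
theorem symb_ofInt {j : ℕ} {Φ : (Fin 4 → ℂ) → ℂ} (hΦ : HasPeriods L j Φ) (P : Fin 4 → ℤ) :
    symb Φ (ofInt P : Site L Nt Ns j) = Φ fun ν => mom Nt Ns P ν := by
  have h := (ofInt_eq_ofInt_iff _ _).mp (ofInt_val (ofInt P : Site L Nt Ns j))
  choose t ht using h
  rw [symb, ← hΦ _ t]
  congr 1
  funext ν
  have h2 : (P ν : ℂ) = (((ofInt P : Site L Nt Ns j) ν).val : ℤ) +
      ((blockLen L ν : ℂ) ^ j * side Nt Ns ν) * t ν := by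
    have := ht ν
    rw [sub_eq_iff_eq_add'] at this
    rw [this]
    push_cast
    ring
  have hs : (side Nt Ns ν : ℂ) ≠ 0 := Nat.cast_ne_zero.mpr (NeZero.ne _)
  simp only [mom]
  push_cast at h2 ⊢
  rw [h2]
  field_simp

theorem odd_blockLen (hL : Odd L) (ν : Fin 4) : Odd (blockLen L ν) := by
  unfold blockLen; split_ifs
  exacts [hL.pow, hL]

theorem hasPeriods_volSymb (hL : Odd L) (n : ℕ) (e : Fin 4 → ℕ) :
    HasPeriods L n (volSymb L n e) := by
  intro z t
  simp only [volSymb, avgSymb_periodic (odd_blockLen hL _)]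

theorem volSymb_neg (n : ℕ) (e : Fin 4 → ℕ) (z : Fin 4 → ℂ) :
    volSymb L n e (-z) = volSymb L n e z := by
  simp only [volSymb, Pi.neg_apply, avgSymb_neg]

theorem mom_neg (P : Fin 4 → ℤ) : mom Nt Ns (-P) = -mom Nt Ns P := by
  funext ν; simp [mom, neg_div]

theorem symb_neg {j : ℕ} {Φ : (Fin 4 → ℂ) → ℂ} (hΦ : HasPeriods L j Φ) (p : Site L Nt Ns j) :
    symb Φ (-p) = symb (fun z => Φ (-z)) p := by
  conv_lhs => rw [← ofInt_val p]
  rw [← ofInt_neg, symb_ofInt hΦ, mom_neg, symb]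
  congr 1
  funext ν
  simp

theorem Qavg_mulVec_wave (hL : Odd L) (q j : ℕ) (P : Fin 4 → ℤ) :
    (Qavg L Nt Ns q j).mulVec (wave (ofInt P)) =
      volSymb L j (fun _ => q) (fun ν => mom Nt Ns P ν) • wave (ofInt P) := by
  induction j with
  | zero => simp [Qavg, volSymb, avgSymb]
  | succ j ih =>
    rw [Qavg, ← Matrix.mulVec_mulVec, avgStep_mulVec_wave hL, Matrix.mulVec_smul, ih, smul_smul]
    congr 1
    simp only [volSymb, avgSymb, Finset.prod_range_succ, mul_pow, Finset.prod_mul_distrib,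
      Finset.prod_pow]
    rw [mul_comm]

theorem isDown_Qavg (hL : Odd L) (q j : ℕ) :
    IsDown (symb (volSymb L j fun _ => q)) (Qavg L Nt Ns q j) := by
  intro p
  conv_lhs => rw [← ofInt_val p]
  rw [Qavg_mulVec_wave hL]
  rfl

theorem isUp_adj_Qavg (hL : Odd L) (q j : ℕ) :
    IsUp (symb (volSymb L j fun _ => q)) (adj L Nt Ns (Qavg L Nt Ns q j)) := by
  refine (isDown_Qavg hL q j).adj.congr fun p => ?_
  rw [symb_neg (hasPeriods_volSymb hL _ _)]
  simp only [volSymb_neg]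

theorem symb_volSymb_mul {n : ℕ} (e e' : Fin 4 → ℕ) (p : Site L Nt Ns n) :
    symb (volSymb L n e) p * symb (volSymb L n e') p = symb (volSymb L n (e + e')) p := by
  simp only [symb, volSymb, ← Finset.prod_mul_distrib, Pi.add_apply, pow_add]

theorem isDiag_fQinv (hL : Odd L) (q n : ℕ) : IsDiag (fun k => 1 + ∑ j ∈ Finset.Ico 1 n,
      ((L : ℂ) ^ (2 * j))⁻¹ * ∑ p ∈ fib j k, symb (volSymb L j fun _ => 2 * q) p)
    (fQinv L Nt Ns q n) := by
  refine isDiag_one.add (isDiag_sum _ fun j _ => ?_)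
  refine ((isDown_Qavg hL q j).mul_isUp (isUp_adj_Qavg hL q j)).smul _ |>.congr fun k => ?_
  simp only [symb_volSymb_mul]
  congr 2
  funext p
  congr 2
  funext ν
  simp [two_mul]

/-- The point of the period box of a fine torus, as a shift of integer coordinates. -/
def shiftInt {n : ℕ} (Nt Ns : ℕ) (K : Fin 4 → ℤ) (l : Period L n) : Fin 4 → ℤ :=
  fun ν => K ν + side Nt Ns ν * (l ν).valMinAbs

theorem shiftInt_zero {n : ℕ} (K : Fin 4 → ℤ) :
    shiftInt Nt Ns K (0 : Period L n) = K := by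
  funext ν; simp [shiftInt]

theorem mom_shiftInt {n : ℕ} (K : Fin 4 → ℤ) (l : Period L n) (ν : Fin 4) :
    mom Nt Ns (shiftInt Nt Ns K l) ν = mom Nt Ns K ν + periodMom l ν := by
  have hs : (side Nt Ns ν : ℝ) ≠ 0 := Nat.cast_ne_zero.mpr (NeZero.ne _)
  simp only [mom, shiftInt, periodMom]
  push_cast
  field_simp

theorem ofInt_shiftInt_injective {n : ℕ} (K : Fin 4 → ℤ) :
    Function.Injective fun l : Period L n => (ofInt (shiftInt Nt Ns K l) : Site L Nt Ns n) := by
  intro l l' h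
  funext ν
  have h1 := (ofInt_eq_ofInt_iff _ _).mp h ν
  simp only [shiftInt, add_sub_add_left_eq_sub, ← mul_sub] at h1
  rw [Nat.cast_mul, mul_comm] at h1
  have hs : (side Nt Ns ν : ℤ) ≠ 0 := Nat.cast_ne_zero.mpr (NeZero.ne _)
  have h2 := (mul_dvd_mul_iff_left hs).mp h1
  rw [← (l ν).coe_valMinAbs, ← (l' ν).coe_valMinAbs]
  exact (ZMod.intCast_eq_intCast_iff_dvd_sub _ _ _).mpr h2

theorem image_shiftInt {n : ℕ} (K : Fin 4 → ℤ) :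
    (Finset.univ.image fun l : Period L n => (ofInt (shiftInt Nt Ns K l) : Site L Nt Ns n)) =
      fib n (ofInt K) := by
  ext p
  simp only [Finset.mem_image, Finset.mem_univ, true_and, mem_fib]
  constructor
  · rintro ⟨l, rfl⟩
    rw [proj_ofInt (Nat.zero_le n), ofInt_eq_ofInt_iff]
    intro ν
    simp [shiftInt]
  · intro hp
    rw [← ofInt_val p, proj_ofInt (Nat.zero_le n), ofInt_eq_ofInt_iff] at hp
    choose t ht using hp
    -- Congruence on the unit torus means `K - p = side * t`, hence `p = K + side * (-t)`.
    refine ⟨fun ν => ((-t ν : ℤ) : ZMod _), ?_⟩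
    conv_rhs => rw [← ofInt_val p]
    rw [ofInt_eq_ofInt_iff]
    intro ν
    have h1 : ((blockLen L ν ^ n : ℕ) : ℤ) ∣
        -t ν - ((-t ν : ℤ) : ZMod (blockLen L ν ^ n)).valMinAbs := by
      rw [← ZMod.intCast_eq_intCast_iff_dvd_sub, ZMod.coe_valMinAbs]
    have h2 := mul_dvd_mul_left (side Nt Ns ν : ℤ) h1
    rw [Nat.cast_mul, mul_comm ((blockLen L ν ^ n : ℕ) : ℤ)]
    refine h2.trans (dvd_of_eq ?_)
    have := ht ν
    simp only [pow_zero, one_mul] at this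
    simp only [shiftInt]
    linear_combination this

theorem sum_fib {n : ℕ} {A : Type*} [AddCommMonoid A] (K : Fin 4 → ℤ) (f : Site L Nt Ns n → A) :
    ∑ p ∈ fib n (ofInt K), f p = ∑ l : Period L n, f (ofInt (shiftInt Nt Ns K l)) := by
  rw [← image_shiftInt, Finset.sum_image (ofInt_shiftInt_injective K).injOn]

theorem sum_fib_erase {n : ℕ} (K : Fin 4 → ℤ) (f : Site L Nt Ns n → ℂ) :
    ∑ p ∈ (fib n (ofInt K)).erase (ofInt K), f p =
      ∑ l ∈ Finset.univ.erase (0 : Period L n), f (ofInt (shiftInt Nt Ns K l)) := by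
  have h0 : (ofInt K : Site L Nt Ns n) ∈ fib n (ofInt K) :=
    mem_fib.mpr (proj_ofInt (Nat.zero_le n) K)
  have h1 := sum_fib (L := L) K f
  rw [← Finset.add_sum_erase _ _ h0, ← Finset.add_sum_erase _ _ (Finset.mem_univ (0 : Period L n)),
    shiftInt_zero] at h1
  exact add_left_cancel h1

end Averaging

end BlockSpin

namespace BlockSpin

/-! ### The symbol of the differential operator -/

/-- Identity theorem: the zeros `1 / (m + 1)` accumulate at `0`. -/
theorem eq_zero_of_real_eq_zero {f : ℂ → ℂ} (hf : Differentiable ℂ f) (h : ∀ x : ℝ, f x = 0)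
    (z : ℂ) : f z = 0 := by
  have h1 : AnalyticOnNhd ℂ f Set.univ := hf.differentiableOn.analyticOnNhd isOpen_univ
  have h2 : ∃ᶠ w in nhdsWithin (0 : ℂ) {0}ᶜ, f w = 0 := by
    have ht : Filter.Tendsto (fun m : ℕ => ((((m : ℝ) + 1)⁻¹ : ℝ) : ℂ)) Filter.atTop
        (nhdsWithin (0 : ℂ) {0}ᶜ) := by
      rw [tendsto_nhdsWithin_iff]
      constructor
      · have := (tendsto_one_div_add_atTop_nhds_zero_nat (𝕜 := ℝ))
        have h3 := (Complex.continuous_ofReal.tendsto 0).comp this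
        simpa [Function.comp_def] using h3
      · refine Filter.Eventually.of_forall fun m => ?_
        rw [Set.mem_compl_singleton_iff, Complex.ofReal_ne_zero]
        positivity
    exact ht.frequently (Filter.Frequently.of_forall fun m => h _)
  exact h1.eqOn_zero_of_preconnected_of_frequently_eq_zero isPreconnected_univ (Set.mem_univ 0) h2
    (Set.mem_univ z)

theorem eq_zero_of_real_eq_zero_fin_three {g : (Fin 3 → ℂ) → ℂ} (hg : Differentiable ℂ g)
    (h : ∀ p : Fin 3 → ℝ, g (fun ν => (p ν : ℂ)) = 0) (z : Fin 3 → ℂ) : g z = 0 := by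
  have h0 : ∀ (z₀ : ℂ) (x₁ x₂ : ℝ), g ![z₀, x₁, x₂] = 0 := fun z₀ x₁ x₂ => by
    refine eq_zero_of_real_eq_zero (f := fun z => g ![z, x₁, x₂]) (hg.comp ?_) (fun x => ?_) z₀
    · rw [differentiable_pi]; intro i; fin_cases i <;> simp
    · rw [← h ![x, x₁, x₂]]; congr 1; funext i; fin_cases i <;> simp
  have h1 : ∀ (z₀ z₁ : ℂ) (x₂ : ℝ), g ![z₀, z₁, x₂] = 0 := fun z₀ z₁ x₂ => by
    refine eq_zero_of_real_eq_zero (f := fun z => g ![z₀, z, x₂]) (hg.comp ?_)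
      (fun x => h0 z₀ x x₂) z₁
    rw [differentiable_pi]; intro i; fin_cases i <;> simp
  have h2 : g ![z 0, z 1, z 2] = 0 := by
    refine eq_zero_of_real_eq_zero (f := fun w => g ![z 0, z 1, w]) (hg.comp ?_)
      (fun x => h1 _ _ x) (z 2)
    rw [differentiable_pi]; intro i; fin_cases i <;> simp
  rw [← h2]; congr 1; funext i; fin_cases i <;> simp

/-- On real momenta periodicity is visible in the Fourier series; entireness extends it to complex
momenta, one variable at a time. -/
theorem IsKineticOperator.periodic {h : (Fin 3 → ℤ) → ℂ} {hhat : (Fin 3 → ℂ) → ℂ}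
    (hh : IsKineticOperator h hhat) (z : Fin 3 → ℂ) (t : Fin 3 → ℤ) :
    hhat (fun ν => z ν + 2 * Real.pi * t ν) = hhat z := by
  refine sub_eq_zero.mp (eq_zero_of_real_eq_zero_fin_three
    (g := fun z => hhat (fun ν => z ν + 2 * Real.pi * t ν) - hhat z) ?_ ?_ z)
  · refine (hh.entire.comp ?_).sub hh.entire
    rw [differentiable_pi]; intro i; fun_prop
  · intro p
    have e : (fun ν => (p ν : ℂ) + 2 * Real.pi * t ν) =
        fun ν => ((p ν + 2 * Real.pi * t ν : ℝ) : ℂ) := by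
      funext ν; push_cast; rfl
    rw [e, hh.fourier_eq, hh.fourier_eq, sub_eq_zero]
    refine tsum_congr fun x => ?_
    congr 1
    have : -(Complex.I * ((∑ ν, (p ν + 2 * Real.pi * t ν) * (x ν : ℝ) : ℝ) : ℂ)) =
        -(Complex.I * ((∑ ν, p ν * (x ν : ℝ) : ℝ) : ℂ)) +
          ((-∑ ν, t ν * x ν : ℤ) : ℂ) * (2 * Real.pi * Complex.I) := by
      simp only [add_mul, Finset.sum_add_distrib]
      push_cast
      rw [neg_mul, Finset.sum_mul, mul_add, neg_add, Finset.mul_sum Finset.univ _ Complex.I,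
        Finset.mul_sum Finset.univ _ Complex.I]
      congr 2
      refine Finset.sum_congr rfl fun ν _ => ?_
      ring
    rw [this, Complex.exp_add, Complex.exp_int_mul_two_pi_mul_I, mul_one]

theorem IsKineticOperator.neg {h : (Fin 3 → ℤ) → ℂ} {hhat : (Fin 3 → ℂ) → ℂ}
    (hh : IsKineticOperator h hhat) (z : Fin 3 → ℂ) : hhat (-z) = hhat z := by
  rw [← hh.even z 0, ← hh.even _ 1, ← hh.even _ 2]
  congr 1
  funext i
  fin_cases i <;> simp [Function.update]

/-- The symbol of `D_n`. -/
noncomputable def kinSymb (L n : ℕ) (hhat : (Fin 3 → ℂ) → ℂ) (z : Fin 4 → ℂ) : ℂ :=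
  (L : ℂ) ^ (2 * n) * (1 - Complex.exp (-hhat (fun ν => z ν.succ / (L : ℂ) ^ n) +
    Complex.I * (z 0 / (L : ℂ) ^ (2 * n))))

section

variable {L Nt Ns : ℕ} [NeZero L] [NeZero Nt] [NeZero Ns]

theorem hasPeriods_kinSymb {h : (Fin 3 → ℤ) → ℂ} {hhat : (Fin 3 → ℂ) → ℂ}
    (hh : IsKineticOperator h hhat) (n : ℕ) : HasPeriods L n (kinSymb L n hhat) := by
  intro z t
  have hL : (L : ℂ) ≠ 0 := Nat.cast_ne_zero.mpr (NeZero.ne L)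
  have e1 : (fun ν : Fin 3 => (z ν.succ + 2 * Real.pi * (blockLen L ν.succ : ℂ) ^ n * t ν.succ) /
      (L : ℂ) ^ n) = fun ν => z ν.succ / (L : ℂ) ^ n + 2 * Real.pi * (t ν.succ : ℂ) := by
    funext ν
    simp only [blockLen, Fin.succ_ne_zero, if_false]
    field_simp
  have e2 : Complex.I * ((z 0 + 2 * Real.pi * (blockLen L 0 : ℂ) ^ n * t 0) / (L : ℂ) ^ (2 * n)) =
      Complex.I * (z 0 / (L : ℂ) ^ (2 * n)) + t 0 * (2 * Real.pi * Complex.I) := by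
    simp only [blockLen, if_true]
    push_cast
    rw [← pow_mul]
    field_simp
  rw [kinSymb, e1, e2, hh.periodic _ fun ν => t ν.succ, ← add_assoc, Complex.exp_add,
    Complex.exp_int_mul_two_pi_mul_I, mul_one, kinSymb]

/-- The plane waves form an invertible matrix `U` that diagonalises `T`, and the exponential
commutes with conjugation by `U`. -/
theorem isDiag_exp {j : ℕ} {η : Site L Nt Ns j → ℂ} {T : Op L Nt Ns j j} (h : IsDiag η T) :
    IsDiag (fun p => Complex.exp (η p)) (NormedSpace.exp T) := by
  set U : Op L Nt Ns j j := fun u p => wave p u with hU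
  set V : Op L Nt Ns j j := fun p u =>
    (Fintype.card (Site L Nt Ns j) : ℂ)⁻¹ * wave (-p) u with hV
  have hVU : V * U = 1 := by
    ext p p'
    rw [Matrix.mul_apply]
    simp only [hU, hV, mul_assoc, ← Finset.mul_sum, sum_wave_mul_wave, Matrix.one_apply,
      neg_add_eq_zero]
    split_ifs
    · exact inv_mul_cancel₀ card_site_ne_zero
    · exact mul_zero _
  have hUunit : IsUnit U := IsUnit.of_mul_eq_one_right _ hVU
  have hUw : ∀ p, U.mulVec (Pi.single p 1) = wave p := fun p => by
    rw [Matrix.mulVec_single_one]; rfl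
  have key : ∀ (w : Site L Nt Ns j → ℂ), IsDiag w (U * Matrix.diagonal w * U⁻¹) := fun w p => by
    have hinv : U⁻¹.mulVec (wave p) = Pi.single p 1 := by
      rw [← hUw, Matrix.mulVec_mulVec,
        Matrix.nonsing_inv_mul _ ((Matrix.isUnit_iff_isUnit_det _).mp hUunit), Matrix.one_mulVec]
    rw [← Matrix.mulVec_mulVec, hinv, ← Matrix.mulVec_mulVec, Matrix.diagonal_mulVec_single,
      mul_one, ← hUw, ← Matrix.mulVec_smul, ← Pi.single_smul, smul_eq_mul, mul_one]
  have hT : T = U * Matrix.diagonal η * U⁻¹ := by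
    rw [h.eq_diagOp, (key η).eq_diagOp]
  rw [hT, Matrix.exp_conj _ _ hUunit, Matrix.exp_diagonal]
  refine (key _).congr fun p => ?_
  rw [Pi.coe_exp, Complex.exp_eq_exp_ℂ]

theorem isDiag_timeDeriv (n : ℕ) : IsDiag (fun p : Site L Nt Ns n =>
      Complex.exp (Complex.I * (mom Nt Ns (fun ν => ((p ν).val : ℤ)) 0 / (L : ℂ) ^ (2 * n))) - 1)
    (timeDeriv L Nt Ns n) := by
  intro p
  funext u
  have h1 : (Pi.single 0 1 : Site L Nt Ns n) = ofInt (Pi.single 0 1) := by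
    funext ν
    by_cases h : ν = 0
    · subst h; simp [ofInt]
    · simp [ofInt, h]
  simp only [Matrix.mulVec, dotProduct, timeDeriv, sub_mul, ite_mul, one_mul, zero_mul,
    Finset.sum_sub_distrib, Finset.sum_ite_eq', Finset.mem_univ, if_true, Pi.smul_apply,
    smul_eq_mul, wave_add_right]
  rw [h1]
  have h2 : wave p (ofInt (Pi.single 0 1)) = Complex.exp (Complex.I *
      (mom Nt Ns (fun ν => ((p ν).val : ℤ)) 0 / (L : ℂ) ^ (2 * n))) := by
    conv_lhs => rw [← ofInt_val p]
    rw [wave_ofInt_mom, Finset.sum_eq_single 0]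
    · simp [blockLen, ← pow_mul, div_eq_mul_inv]
    · intro ν _ h; simp [h]
    · simp
  rw [h2]
  ring

theorem isDiag_hop {h : (Fin 3 → ℤ) → ℂ} {hhat : (Fin 3 → ℂ) → ℂ} (hh : IsKineticOperator h hhat)
    (n : ℕ) : IsDiag (fun p : Site L Nt Ns n => hhat fun ν =>
      (mom Nt Ns (fun ν => ((p ν).val : ℤ)) ν.succ : ℂ) / (L : ℂ) ^ n) (hop L Nt Ns h n) := by
  intro p
  funext u
  set P : Fin 4 → ℤ := fun ν => ((p ν).val : ℤ) with hP
  have hp : p = ofInt P := (ofInt_val p).symm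
  set X : (Fin 3 → ℤ) → Site L Nt Ns n := fun x => ofInt (Fin.cons 0 x) with hX
  have hcond : ∀ (x : Fin 3 → ℤ) (u' : Site L Nt Ns n),
      (u 0 = u' 0 ∧ ∀ ν : Fin 3, ((x ν : ℤ) : ZMod _) = u ν.succ - u' ν.succ) ↔
        u' = u - X x := by
    intro x u'
    rw [funext_iff, Fin.forall_fin_succ (P := fun ν => u' ν = (u - X x) ν)]
    refine and_congr ?_ (forall_congr' fun ν => ?_)
    · simp [hX, ofInt, eq_comm]
    · simp only [hX, ofInt, Pi.sub_apply, Fin.cons_succ]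
      rw [eq_sub_iff_add_eq, eq_sub_iff_add_eq, add_comm]
  have hs : Summable h := hh.summable.of_norm
  have h1 : ∀ u', hop L Nt Ns h n u u' * wave p u' =
      ∑' x, if u' = u - X x then h x * wave p u' else 0 := fun u' => by
    rw [hop]
    simp only [← hcond]
    by_cases h0 : u 0 = u' 0
    · simp only [h0, if_true, true_and]
      rw [← tsum_mul_right]
      refine tsum_congr fun x => ?_
      rw [ite_mul, zero_mul]
    · simp [h0]
  simp only [Matrix.mulVec, dotProduct, h1, Pi.smul_apply, smul_eq_mul]
  rw [← Summable.tsum_finsetSum]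
  · simp only [Finset.sum_ite_eq', Finset.mem_univ, if_true, sub_eq_add_neg, wave_add_right]
    have e : (fun ν : Fin 3 => (mom Nt Ns P ν.succ : ℂ) / (L : ℂ) ^ n) =
        fun ν => ((mom Nt Ns P ν.succ / (L : ℝ) ^ n : ℝ) : ℂ) := by
      funext ν; push_cast; rfl
    rw [e, hh.fourier_eq, ← tsum_mul_right]
    refine tsum_congr fun x => ?_
    rw [hX, ← ofInt_neg, hp, wave_ofInt_mom, Fin.sum_univ_succ]
    simp only [Pi.neg_apply, Fin.cons_zero, Fin.cons_succ, blockLen, Fin.succ_ne_zero, if_false]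
    push_cast
    rw [neg_zero, zero_div, mul_zero, zero_add, mul_comm (wave _ u), ← mul_assoc]
    congr 3
    rw [← mul_neg, ← Finset.sum_neg_distrib]
    congr 1
    refine Finset.sum_congr rfl fun ν _ => ?_
    ring
  · intro u' _
    refine Summable.of_norm_bounded (g := fun x => ‖h x‖ * ‖wave p u'‖)
      (hh.summable.mul_right _) fun x => ?_
    split_ifs
    · rw [norm_mul]
    · rw [norm_zero]; positivity

/-- With `θ` the time phase, `1 - e^(-η) - e^(-η) (e^(iθ) - 1)` collapses to `1 - e^(-η + iθ)`. -/
theorem isDiag_Dop {h : (Fin 3 → ℤ) → ℂ} {hhat : (Fin 3 → ℂ) → ℂ} (hh : IsKineticOperator h hhat)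
    (n : ℕ) : IsDiag (symb (kinSymb L n hhat)) (Dop L Nt Ns h n) := by
  have h1 := isDiag_exp (((isDiag_hop (L := L) (Nt := Nt) (Ns := Ns) hh n).smul (-1)))
  rw [neg_one_smul] at h1
  have h2 := ((isDiag_one.add (h1.smul (-1))).add
    ((h1.mul (isDiag_timeDeriv n)).smul (-1))).smul ((L : ℂ) ^ (2 * n))
  have e : Dop L Nt Ns h n = (L : ℂ) ^ (2 * n) • (1 + (-1 : ℂ) • NormedSpace.exp (-hop L Nt Ns h n) +
      (-1 : ℂ) • (NormedSpace.exp (-hop L Nt Ns h n) * timeDeriv L Nt Ns n)) := by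
    rw [Dop, neg_one_smul, neg_one_smul, ← sub_eq_add_neg, ← sub_eq_add_neg]
  rw [e]
  refine h2.congr fun p => ?_
  simp only [Pi.add_apply, symb, kinSymb, Complex.exp_add, neg_one_mul]
  ring

end

end BlockSpin

namespace BlockSpin

/-! ### The symbols of the averaging operators for derivatives -/

section

variable {L Nt Ns : ℕ} [NeZero L] [NeZero Nt] [NeZero Ns]

/-- The multiplicities of the averages in the symbol of `Q_{n,ν}^(+)`. -/
def plusExp (q : ℕ) (ν : Fin 4) (ν' : Fin 4) : ℕ := if ν' = ν then q - 1 else q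

/-- The multiplicities of the averages in the symbol of `Q_{n,ν}^(-)`. -/
def minusExp (q : ℕ) (ν : Fin 4) (ν' : Fin 4) : ℕ := if ν' = ν then q + 1 else q

/-- The symbol of a shift by `(1 - M) / 2` steps of length `M⁻¹`, where `M = L_ν^n`. -/
noncomputable def shiftSymb (L n : ℕ) (ν : Fin 4) (z : Fin 4 → ℂ) : ℂ :=
  Complex.exp (Complex.I * ((((blockLen L ν : ℂ) ^ n)⁻¹ - 1) / 2 * z ν))

/-- With `M = L_ν^n`, the phase changes by `2π t (1 - M) / 2`, and `(1 - M) / 2` is an integer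
because `M` is odd. -/
theorem hasPeriods_shiftSymb (hL : Odd L) (n : ℕ) (ν : Fin 4) :
    HasPeriods L n (shiftSymb L n ν) := by
  intro z t
  obtain ⟨m, hm⟩ := (odd_blockLen hL ν).pow (n := n)
  have hb : (blockLen L ν : ℂ) ^ n = 2 * m + 1 := by exact_mod_cast hm
  have h0 : (blockLen L ν : ℂ) ^ n ≠ 0 := pow_ne_zero _ (Nat.cast_ne_zero.mpr (NeZero.ne _))
  have e : Complex.I * ((((blockLen L ν : ℂ) ^ n)⁻¹ - 1) / 2 *
      (z ν + 2 * Real.pi * (blockLen L ν : ℂ) ^ n * t ν)) =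
      Complex.I * ((((blockLen L ν : ℂ) ^ n)⁻¹ - 1) / 2 * z ν) +
        ((-m * t ν : ℤ) : ℂ) * (2 * Real.pi * Complex.I) := by
    rw [mul_add, mul_add, add_right_inj]
    field_simp
    rw [hb]
    push_cast
    ring
  rw [shiftSymb, e, Complex.exp_add, Complex.exp_int_mul_two_pi_mul_I, mul_one, shiftSymb]

theorem shiftSymb_neg_mul (n : ℕ) (ν : Fin 4) (z : Fin 4 → ℂ) :
    shiftSymb L n ν (-z) * shiftSymb L n ν z = 1 := by
  rw [shiftSymb, shiftSymb, ← Complex.exp_add]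
  simp

/-- The symbol of `Q_{n,ν}^(+)`. -/
noncomputable def plusSymb (L q n : ℕ) (ν : Fin 4) (z : Fin 4 → ℂ) : ℂ :=
  shiftSymb L n ν z * volSymb L n (plusExp q ν) z

/-- The symbol of `Q_{n,ν}^(-)`. -/
noncomputable def minusSymb (L q n : ℕ) (ν : Fin 4) (z : Fin 4 → ℂ) : ℂ :=
  shiftSymb L n ν (-z) * volSymb L n (minusExp q ν) z

theorem HasPeriods.mul {n : ℕ} {Φ Φ' : (Fin 4 → ℂ) → ℂ} (h : HasPeriods L n Φ)
    (h' : HasPeriods L n Φ') : HasPeriods L n fun z => Φ z * Φ' z := by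
  intro z t
  simp only [h z t, h' z t]

theorem HasPeriods.neg {n : ℕ} {Φ : (Fin 4 → ℂ) → ℂ} (h : HasPeriods L n Φ) :
    HasPeriods L n fun z => Φ (-z) := by
  intro z t
  show Φ _ = Φ (-z)
  rw [← h (-z) (-t)]
  congr 1
  funext ν
  simp only [Pi.neg_apply]
  push_cast
  ring

theorem hasPeriods_plusSymb (hL : Odd L) (q n : ℕ) (ν : Fin 4) :
    HasPeriods L n (plusSymb L q n ν) :=
  (hasPeriods_shiftSymb hL n ν).mul (hasPeriods_volSymb hL n _)

theorem hasPeriods_minusSymb (hL : Odd L) (q n : ℕ) (ν : Fin 4) :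
    HasPeriods L n (minusSymb L q n ν) :=
  (hasPeriods_shiftSymb hL n ν).neg.mul (hasPeriods_volSymb hL n _)

theorem volSymb_mul (n : ℕ) (e e' : Fin 4 → ℕ) (z : Fin 4 → ℂ) :
    volSymb L n e z * volSymb L n e' z = volSymb L n (e + e') z := by
  simp only [volSymb, ← Finset.prod_mul_distrib, Pi.add_apply, pow_add]

/-- The shifts are inverse to each other and `(q - 1) + (q + 1) = 2q`, so the rank one term has the
same diagonal as for `Q_n^* 𝔔_n Q_n`. The bound `1 ≤ q` is needed for the truncated subtraction. -/
theorem minusSymb_mul_plusSymb {q : ℕ} (hq : 1 ≤ q) (n : ℕ) (ν : Fin 4) (z : Fin 4 → ℂ) :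
    minusSymb L q n ν z * plusSymb L q n ν z = volSymb L n (fun _ => 2 * q) z := by
  rw [minusSymb, plusSymb, mul_mul_mul_comm, shiftSymb_neg_mul, one_mul, volSymb_mul]
  congr 1
  funext ν'
  simp only [minusExp, plusExp, Pi.add_apply]
  split_ifs <;> lia

/-- This product is the weight in the Gram symbol. Its exponent in direction `ν` is only `2(q - 1)`,
which is still even. -/
theorem plusSymb_mul_neg (q n : ℕ) (ν : Fin 4) (z : Fin 4 → ℂ) :
    plusSymb L q n ν z * plusSymb L q n ν (-z) = volSymb L n (2 * plusExp q ν) z := by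
  rw [plusSymb, plusSymb, mul_mul_mul_comm, mul_comm (shiftSymb L n ν z), shiftSymb_neg_mul,
    one_mul, volSymb_neg, volSymb_mul, two_mul]

/-- Half of `ℓ_ν` is an integer multiple of `π`, so the sine vanishes and the cosine equals either
exponential. The cosine in `ζ` can thus be absorbed into a pure shift depending on `k + ℓ` only. -/
theorem cos_periodMom {n : ℕ} (l : Period L n) (ν : Fin 4) :
    (Real.cos (periodMom l ν / 2) : ℂ) = Complex.exp (-(Complex.I * (periodMom l ν / 2 : ℝ))) ∧
    (Real.cos (periodMom l ν / 2) : ℂ) = Complex.exp (Complex.I * (periodMom l ν / 2 : ℝ)) := by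
  set m := (l ν).valMinAbs with hm
  have h1 : periodMom l ν / 2 = m * Real.pi := by rw [periodMom, ← hm]; ring
  have h2 : Complex.sin ((m * Real.pi : ℝ) : ℂ) = 0 := by
    rw [← Complex.ofReal_sin, Real.sin_int_mul_pi, Complex.ofReal_zero]
  rw [h1, Complex.ofReal_cos, mul_comm Complex.I, ← neg_mul, Complex.exp_mul_I, Complex.exp_mul_I,
    Complex.cos_neg, Complex.sin_neg, h2]
  simp

theorem zetaPlus_eq {n : ℕ} (ν : Fin 4) (k : Fin 4 → ℝ) (l : Period L n) :
    zetaPlus L n ν k (periodMom l) = shiftSymb L n ν fun ν => ((k ν + periodMom l ν : ℝ) : ℂ) := by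
  rw [zetaPlus, (cos_periodMom l ν).1, ← Complex.exp_add, ← Complex.exp_add, shiftSymb]
  congr 1
  push_cast
  ring

theorem zetaMinus_eq {n : ℕ} (ν : Fin 4) (k : Fin 4 → ℝ) (l : Period L n) :
    zetaMinus L n ν k (periodMom l) =
      shiftSymb L n ν (-fun ν => ((k ν + periodMom l ν : ℝ) : ℂ)) := by
  rw [zetaMinus, (cos_periodMom l ν).2, ← Complex.exp_add, ← Complex.exp_add, shiftSymb]
  congr 1
  simp only [Pi.neg_apply]
  push_cast
  ring

theorem volSymb_ofReal (hL : Odd L) (n : ℕ) (e : Fin 4 → ℕ) (p : Fin 4 → ℝ) :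
    volSymb L n e (fun ν => (p ν : ℂ)) = ∏ ν, (sinRatio (blockLen L ν ^ n) (p ν) : ℂ) ^ e ν := by
  simp only [volSymb, avgSymb_ofReal (odd_blockLen hL _)]

theorem uPlus_mul {q : ℕ} (hq : 1 ≤ q) (hL : Odd L) (n : ℕ) (ν : Fin 4) (p : Fin 4 → ℝ) :
    (uPlus L n ν p : ℂ) * (uFun L n p : ℂ) ^ (q - 1) =
      volSymb L n (plusExp q ν) fun ν => (p ν : ℂ) := by
  rw [volSymb_ofReal hL, uPlus, uFun, ← Finset.mul_prod_erase _ _ (Finset.mem_univ ν),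
    ← Finset.mul_prod_erase _ _ (Finset.mem_univ ν), plusExp, if_pos rfl]
  push_cast
  rw [mul_pow, mul_left_comm, ← Finset.prod_pow, ← Finset.prod_mul_distrib]
  congr 1
  refine Finset.prod_congr rfl fun ν' hν' => ?_
  rw [plusExp, if_neg (Finset.ne_of_mem_erase hν'), ← pow_succ', Nat.sub_add_cancel hq]

theorem uMinus_mul {q : ℕ} (hq : 1 ≤ q) (hL : Odd L) (n : ℕ) (ν : Fin 4) (p : Fin 4 → ℝ) :
    (uMinus L n ν p : ℂ) * (uFun L n p : ℂ) ^ (q - 1) =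
      volSymb L n (minusExp q ν) fun ν => (p ν : ℂ) := by
  rw [uMinus, Complex.ofReal_mul, mul_assoc, ← pow_succ', Nat.sub_add_cancel hq,
    volSymb_ofReal hL, uFun, ← Finset.mul_prod_erase _ _ (Finset.mem_univ ν),
    ← Finset.mul_prod_erase _ _ (Finset.mem_univ ν), minusExp, if_pos rfl]
  push_cast
  rw [mul_pow, ← mul_assoc, ← pow_succ', ← Finset.prod_pow]
  congr 1
  refine Finset.prod_congr rfl fun ν' hν' => ?_
  rw [minusExp, if_neg (Finset.ne_of_mem_erase hν')]

theorem phase_mom {j : ℕ} (P : Fin 4 → ℤ) (u : Site L Nt Ns j) :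
    phase L Nt Ns j (mom Nt Ns P) u = wave (ofInt P) u := by
  conv_rhs => rw [← ofInt_val u]
  rw [wave_ofInt_mom, phase]
  push_cast
  rfl

theorem fourier_wave {j : ℕ} (p : Site L Nt Ns j) (P : Fin 4 → ℤ) :
    fourier L Nt Ns j (wave p) (mom Nt Ns P) =
      if p = ofInt P then (Fintype.card (Site L Nt Ns 0) : ℂ) else 0 := by
  simp only [fourier, ← mom_neg, phase_mom, sum_wave_mul_wave, ofInt_neg, mul_ite, mul_zero,
    cellVol_mul_card, ← sub_eq_add_neg, sub_eq_zero]

theorem torusVol_eq : (torusVol Nt Ns : ℂ) = Fintype.card (Site L Nt Ns 0) := by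
  rw [Fintype.card_pi]
  simp only [ZMod.card]
  simp [torusVol]

theorem unitMom_add_periodMom {n : ℕ} (k : Site L Nt Ns 0) (l : Period L n) :
    unitMom L Nt Ns k + periodMom l =
      mom Nt Ns (shiftInt Nt Ns (fun ν => (k ν).valMinAbs) l) := by
  funext ν
  rw [mom_shiftInt]
  rfl

theorem isUp_Qplus {q : ℕ} (hq : 1 ≤ q) (hL : Odd L) (n : ℕ) (ν : Fin 4) :
    IsUp (symb (plusSymb L q n ν)) (Qplus L Nt Ns q n ν) := by
  intro k
  funext u
  have hf : ∀ k' : Site L Nt Ns 0, fourier L Nt Ns 0 (wave k) (unitMom L Nt Ns k') =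
      if k = k' then (Fintype.card (Site L Nt Ns 0) : ℂ) else 0 := fun k' => by
    have := fourier_wave k (fun ν => (k' ν).valMinAbs)
    rw [ofInt_valMinAbs] at this
    exact this
  rw [Qplus, LinearMap.toMatrix'_mulVec]
  simp only [LinearMap.coe_mk, AddHom.coe_mk, hf]
  rw [Finset.sum_eq_single k (fun k' _ hk' => by simp [hk'.symm]) (by simp), if_pos rfl,
    torusVol_eq (L := L), Finset.mul_sum, Finset.sum_apply]
  conv_rhs => rw [← ofInt_valMinAbs k]
  rw [sum_fib]
  refine Finset.sum_congr rfl fun l _ => ?_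
  rw [unitMom_add_periodMom, phase_mom, Pi.smul_apply, smul_eq_mul,
    symb_ofInt (hasPeriods_plusSymb hL q n ν), plusSymb, ← uPlus_mul hq hL, zetaPlus_eq]
  have : (fun ν => ((unitMom L Nt Ns k ν + periodMom l ν : ℝ) : ℂ)) =
      fun ν => ((mom Nt Ns (shiftInt Nt Ns (fun ν => (k ν).valMinAbs) l) ν : ℝ) : ℂ) := by
    funext ν
    rw [← unitMom_add_periodMom]
    rfl
  rw [this]
  have hc := card_site_ne_zero (L := L) (Nt := Nt) (Ns := Ns) (j := 0)
  field_simp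

theorem isDown_Qminus {q : ℕ} (hq : 1 ≤ q) (hL : Odd L) (n : ℕ) (ν : Fin 4) :
    IsDown (symb (minusSymb L q n ν)) (Qminus L Nt Ns q n ν) := by
  intro p
  funext y
  rw [Qminus, LinearMap.toMatrix'_mulVec]
  simp only [LinearMap.coe_mk, AddHom.coe_mk]
  have h1 : ∀ k : Site L Nt Ns 0, ∑ l : Period L n,
      zetaMinus L n ν (unitMom L Nt Ns k) (periodMom l) *
        (uMinus L n ν (unitMom L Nt Ns k + periodMom l) : ℂ) *
        (uFun L n (unitMom L Nt Ns k + periodMom l) : ℂ) ^ (q - 1) *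
        fourier L Nt Ns n (wave p) (unitMom L Nt Ns k + periodMom l) =
      if proj 0 p = k then symb (minusSymb L q n ν) p * Fintype.card (Site L Nt Ns 0) else 0 := by
    intro k
    have h2 := sum_fib (fun ν => (k ν).valMinAbs) fun p' : Site L Nt Ns n =>
      if p = p' then symb (minusSymb L q n ν) p' * (Fintype.card (Site L Nt Ns 0) : ℂ) else 0
    rw [Finset.sum_ite_eq, ofInt_valMinAbs] at h2
    simp only [mem_fib] at h2
    rw [h2]
    refine Finset.sum_congr rfl fun l _ => ?_
    rw [unitMom_add_periodMom, fourier_wave, mul_ite, mul_zero, mul_assoc (zetaMinus _ _ _ _ _),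
      uMinus_mul hq hL, zetaMinus_eq, symb_ofInt (hasPeriods_minusSymb hL q n ν), minusSymb]
    have : (fun ν => ((unitMom L Nt Ns k ν + periodMom l ν : ℝ) : ℂ)) =
        fun ν => ((mom Nt Ns (shiftInt Nt Ns (fun ν => (k ν).valMinAbs) l) ν : ℝ) : ℂ) := by
      funext ν
      rw [← unitMom_add_periodMom]
      rfl
    rw [this]
  have h3 : ∀ k : Site L Nt Ns 0, phase L Nt Ns 0 (unitMom L Nt Ns k) y = wave k y := fun k => by
    have := phase_mom (fun ν => (k ν).valMinAbs) y
    rw [ofInt_valMinAbs] at this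
    exact this
  simp only [h1, h3, ite_mul, zero_mul, Finset.sum_ite_eq, Finset.mem_univ, if_true]
  rw [torusVol_eq (L := L), Pi.smul_apply, smul_eq_mul]
  have hc := card_site_ne_zero (L := L) (Nt := Nt) (Ns := Ns) (j := 0)
  field_simp

end

end BlockSpin

namespace BlockSpin

/-! ### Decay of kernels whose symbols are holomorphic in a strip -/

theorem summable_exp_neg_mul_abs {c : ℝ} (hc : 0 < c) :
    Summable fun y : ℤ => Real.exp (-(c * |(y : ℝ)|)) := by
  have h : Summable fun k : ℕ => Real.exp (-(c * (k : ℝ))) := by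
    have := Real.summable_exp_nat_mul_iff.mpr (neg_neg_of_pos hc)
    refine this.congr fun k => ?_
    ring_nf
  refine Summable.of_nat_of_neg ?_ ?_
  · simpa using h
  · simpa using h

/-- The sum of `exp (-c |y|)` over the integers. -/
noncomputable def expSum (c : ℝ) : ℝ := ∑' y : ℤ, Real.exp (-(c * |(y : ℝ)|))

theorem expSum_nonneg (c : ℝ) : 0 ≤ expSum c := tsum_nonneg fun _ => (Real.exp_pos _).le

theorem sum_exp_valMinAbs_le {c : ℝ} (hc : 0 < c) (N : ℕ) [NeZero N] :
    ∑ x : ZMod N, Real.exp (-(c * |(x.valMinAbs : ℝ)|)) ≤ expSum c := by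
  have h := (summable_exp_neg_mul_abs hc).sum_le_tsum
    (Finset.univ.map ⟨ZMod.valMinAbs (n := N), ZMod.injective_valMinAbs⟩)
    fun _ _ => (Real.exp_pos _).le
  rwa [Finset.sum_map] at h

section Strip

variable {f : ℂ → ℂ} {m B : ℝ}

theorem norm_integral_strip_le (hm : 0 ≤ m)
    (hd : ∀ z : ℂ, |z.re| ≤ Real.pi → |z.im| ≤ m → DifferentiableAt ℂ f z)
    (hB : ∀ z : ℂ, |z.re| ≤ Real.pi → |z.im| ≤ m → ‖f z‖ ≤ B)
    (hper : ∀ s : ℝ, |s| ≤ m →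
      f (-Real.pi + s * Complex.I) = f (Real.pi + s * Complex.I)) (y : ℤ) :
    ‖∫ t in (-Real.pi)..Real.pi, Complex.exp (-(Complex.I * y * t)) * f t‖ ≤
      B * Real.exp (-(m * |(y : ℝ)|)) * (2 * Real.pi) := by
  have hπ := Real.pi_pos
  -- The contour moves to the side on which `|exp (-i y z)| = exp (y * Im z)` decays.
  set s : ℝ := if 0 ≤ y then -m else m with hs
  have hsm : |s| = m := by
    rw [hs]; split_ifs
    · rw [abs_neg, abs_of_nonneg hm]
    · rw [abs_of_nonneg hm]
  have hys : y * s = -(m * |(y : ℝ)|) := by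
    rw [hs]; split_ifs with h
    · rw [abs_of_nonneg (by exact_mod_cast h)]; ring
    · rw [abs_of_neg (by exact_mod_cast (not_le.mp h))]; ring
  set g : ℂ → ℂ := fun z => Complex.exp (-(Complex.I * y * z)) * f z with hg
  have hrect := Complex.integral_boundary_rect_eq_zero_of_differentiableOn g
    (-Real.pi : ℂ) (Real.pi + s * Complex.I) (by
      intro z hz
      rw [Complex.mem_reProdIm] at hz
      simp only [Complex.neg_re, Complex.ofReal_re, Complex.add_re, Complex.mul_re, Complex.I_re,
        mul_zero, Complex.ofReal_im, Complex.I_im, sub_zero, add_zero, Complex.neg_im,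
        Complex.add_im, Complex.mul_im, mul_one, zero_add, neg_zero] at hz
      have h1 : |z.re| ≤ Real.pi := by
        rw [Set.uIcc_of_le (by linarith)] at hz
        exact abs_le.mpr hz.1
      have h2 : |z.im| ≤ m := by
        have := Set.abs_sub_left_of_mem_uIcc hz.2
        simpa [hsm] using this
      have := hd z h1 h2
      refine DifferentiableAt.differentiableWithinAt ?_
      simp only [hg]
      fun_prop)
  simp only [Complex.neg_re, Complex.ofReal_re, Complex.add_re, Complex.mul_re, Complex.I_re,
    mul_zero, Complex.ofReal_im, Complex.I_im, zero_mul, sub_zero, add_zero, Complex.neg_im,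
    Complex.add_im, Complex.mul_im, mul_one, zero_add, neg_zero, Complex.ofReal_zero] at hrect
  -- Periodicity of `f` across the two vertical sides, together with integrality of `y`, makes their
  -- contributions cancel.
  have hvert : ∫ t in (0 : ℝ)..s, g (Real.pi + t * Complex.I) =
      ∫ t in (0 : ℝ)..s, g (((-Real.pi : ℝ) : ℂ) + t * Complex.I) := by
    refine intervalIntegral.integral_congr fun t ht => ?_
    have ht' : |t| ≤ m := by
      have := Set.abs_sub_left_of_mem_uIcc ht
      simpa [hsm] using this
    simp only [hg]
    rw [Complex.ofReal_neg, hper t ht']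
    congr 1
    have : -(Complex.I * y * (-Real.pi + t * Complex.I)) =
        -(Complex.I * y * (Real.pi + t * Complex.I)) + (y : ℂ) * (2 * Real.pi * Complex.I) := by
      ring
    rw [this, Complex.exp_add, Complex.exp_int_mul_two_pi_mul_I, mul_one]
  rw [hvert] at hrect
  have hmain : ∫ t in (-Real.pi)..Real.pi, g t =
      ∫ t in (-Real.pi)..Real.pi, g (t + s * Complex.I) := by
    linear_combination hrect
  have h1 : (∫ t in (-Real.pi)..Real.pi, Complex.exp (-(Complex.I * y * t)) * f t) =
      ∫ t in (-Real.pi)..Real.pi, g (t + s * Complex.I) := hmain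
  rw [h1]
  have h2 := intervalIntegral.norm_integral_le_of_norm_le_const (a := -Real.pi) (b := Real.pi)
    (f := fun t : ℝ => g (t + s * Complex.I)) (C := B * Real.exp (-(m * |(y : ℝ)|))) (by
      intro t ht
      rw [Set.uIoc_of_le (by linarith)] at ht
      simp only [hg]
      rw [norm_mul, mul_comm, Complex.norm_exp]
      have e : (-(Complex.I * y * (t + s * Complex.I))).re = -(m * |(y : ℝ)|) := by
        rw [← hys]
        simp
      rw [e]
      refine mul_le_mul_of_nonneg_right (hB _ ?_ ?_) (Real.exp_pos _).le
      · simpa using abs_le.mpr ⟨ht.1.le, ht.2⟩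
      · simp [hsm])
  rwa [sub_neg_eq_add, ← two_mul, abs_of_pos (by positivity : 0 < 2 * Real.pi)] at h2

/-- The shifted contour makes the coefficients summable, and then the Fourier series of the
continuous periodic function converges pointwise. -/
theorem exists_fourier_series (hm : 0 < m)
    (hd : ∀ z : ℂ, |z.re| ≤ Real.pi → |z.im| ≤ m → DifferentiableAt ℂ f z)
    (hB : ∀ z : ℂ, |z.re| ≤ Real.pi → |z.im| ≤ m → ‖f z‖ ≤ B)
    (hper : ∀ s : ℝ, |s| ≤ m →
      f (-Real.pi + s * Complex.I) = f (Real.pi + s * Complex.I)) :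
    ∃ c : ℤ → ℂ, (∀ y, ‖c y‖ ≤ B * Real.exp (-(m * |(y : ℝ)|))) ∧
      ∀ t : ℝ, |t| ≤ Real.pi → HasSum (fun y : ℤ => c y * Complex.exp (Complex.I * y * t)) (f t) := by
  have hπ := Real.pi_pos
  have : Fact (0 < 2 * Real.pi) := ⟨by positivity⟩
  set F₀ : ℝ → ℂ := fun t => f t with hF₀
  have hend : F₀ (-Real.pi) = F₀ (-Real.pi + 2 * Real.pi) := by
    have := hper 0 (by simpa using hm.le)
    simp only [Complex.ofReal_zero, zero_mul, add_zero] at this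
    simp only [hF₀]
    rw [show -Real.pi + 2 * Real.pi = Real.pi by ring]
    push_cast
    exact this
  have hcont : ContinuousOn F₀ (Set.Icc (-Real.pi) (-Real.pi + 2 * Real.pi)) := by
    intro t ht
    have h1 := (hd t (by simpa using abs_le.mpr ⟨ht.1, by linarith [ht.2]⟩)
      (by simpa using hm.le)).continuousAt
    exact (h1.comp Complex.continuous_ofReal.continuousAt).continuousWithinAt
  set F : C(AddCircle (2 * Real.pi), ℂ) :=
    ⟨AddCircle.liftIco (2 * Real.pi) (-Real.pi) F₀, AddCircle.liftIco_continuous hend hcont⟩ with hF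
  have hcoef : ∀ y : ℤ, fourierCoeff F y = (1 / (2 * Real.pi) : ℝ) •
      ∫ t in (-Real.pi)..Real.pi, Complex.exp (-(Complex.I * y * t)) * f t := by
    intro y
    have h1 := fourierCoeff_liftIco_eq (T := 2 * Real.pi) (a := -Real.pi) F₀ y
    have h2 : fourierCoeff F y = fourierCoeff (AddCircle.liftIco (2 * Real.pi) (-Real.pi) F₀) y :=
      rfl
    rw [h2, h1, fourierCoeffOn_eq_integral]
    have e : -Real.pi + 2 * Real.pi = Real.pi := by ring
    have e2 : -Real.pi + 2 * Real.pi - -Real.pi = 2 * Real.pi := by ring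
    congr 1
    · rw [e2]
    · rw [e]
      refine intervalIntegral.integral_congr fun t _ => ?_
      simp only [smul_eq_mul, hF₀]
      rw [fourier_coe_apply]
      congr 2
      push_cast
      field_simp
      ring
  have hbound : ∀ y, ‖fourierCoeff F y‖ ≤ B * Real.exp (-(m * |(y : ℝ)|)) := by
    intro y
    rw [hcoef, norm_smul]
    have h1 := norm_integral_strip_le hm.le hd hB hper y
    rw [Real.norm_of_nonneg (by positivity), one_div, inv_mul_le_iff₀ (by positivity)]
    linarith
  have hsum : Summable (fourierCoeff F) :=
    Summable.of_norm_bounded ((summable_exp_neg_mul_abs hm).mul_left B) hbound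
  refine ⟨fourierCoeff F, hbound, fun t ht => ?_⟩
  have h1 := has_pointwise_sum_fourier_series_of_summable hsum (t : AddCircle (2 * Real.pi))
  have hFt : F (t : AddCircle (2 * Real.pi)) = f t := by
    have ht' := abs_le.mp ht
    have h_end : -Real.pi + 2 * Real.pi = Real.pi := by ring
    rcases eq_or_lt_of_le ht'.2 with h | h
    -- The lift to the circle uses a half-open interval, so the endpoint `t = π` is identified with
    -- `-π` first.
    · have e : ((t : ℝ) : AddCircle (2 * Real.pi)) = ((-Real.pi : ℝ) : AddCircle (2 * Real.pi)) := by
        rw [h, ← AddCircle.coe_add_period (2 * Real.pi) (-Real.pi)]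
        congr 1
        ring
      rw [e]
      have h2 : F ((-Real.pi : ℝ) : AddCircle (2 * Real.pi)) = F₀ (-Real.pi) :=
        AddCircle.liftIco_coe_apply (f := F₀) ⟨le_rfl, by rw [h_end]; linarith⟩
      rw [h2, hend, h]
      simp only [hF₀]
      rw [show -Real.pi + 2 * Real.pi = Real.pi by ring]
    · exact AddCircle.liftIco_coe_apply (f := F₀) ⟨ht'.1, by rw [h_end]; exact h⟩
  rw [hFt] at h1
  convert h1 using 2 with y
  rw [fourier_coe_apply, smul_eq_mul]
  congr 2
  push_cast
  field_simp

theorem abs_valMinAbs_le_of_intCast_eq {N : ℕ} [NeZero N] {x : ZMod N} {y : ℤ}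
    (h : (y : ZMod N) = x) : |x.valMinAbs| ≤ |y| := by
  have h1 : (x.valMinAbs.natAbs : ℤ) ≤ y.natAbs := by
    have := ZMod.natAbs_min_of_le_div_two N x.valMinAbs y (by simp [h]) x.natAbs_valMinAbs_le
    exact_mod_cast this
  simpa using h1

/-- Poisson summation: sampling at the `N` momenta periodises the coefficients, leaving the sum of
`c y` over `y ≡ -x` modulo `N`. Every such `y` has `|y|` at least the torus length of `x`. One half
of the decay rate is kept in `x` and the other half pays for the sum. -/
theorem norm_sum_zmod_le (hm : 0 < m)
    (hd : ∀ z : ℂ, |z.re| ≤ Real.pi → |z.im| ≤ m → DifferentiableAt ℂ f z)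
    (hB : ∀ z : ℂ, |z.re| ≤ Real.pi → |z.im| ≤ m → ‖f z‖ ≤ B)
    (hper : ∀ s : ℝ, |s| ≤ m →
      f (-Real.pi + s * Complex.I) = f (Real.pi + s * Complex.I)) (N : ℕ) [NeZero N] (x : ZMod N) :
    ‖(N : ℂ)⁻¹ * ∑ k : ZMod N, f ((2 * Real.pi * (k.valMinAbs : ℝ) / N : ℝ) : ℂ) *
      ZMod.stdAddChar (k * x)‖ ≤
      B * expSum (m / 2) * Real.exp (-(m / 2 * |(x.valMinAbs : ℝ)|)) := by
  obtain ⟨c, hc, hsum⟩ := exists_fourier_series hm hd hB hper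
  have hN : (0 : ℝ) < N := Nat.cast_pos.mpr (Nat.pos_of_ne_zero (NeZero.ne N))
  have hN' : (N : ℂ) ≠ 0 := Nat.cast_ne_zero.mpr (NeZero.ne N)
  have hB0 : 0 ≤ B := (norm_nonneg _).trans (hB 0 (by simp [Real.pi_pos.le]) (by simpa using hm.le))
  have h1 : ∀ k : ZMod N, HasSum (fun y : ℤ => c y * ZMod.stdAddChar (k * ((y : ZMod N) + x)))
      (f ((2 * Real.pi * (k.valMinAbs : ℝ) / N : ℝ) : ℂ) * ZMod.stdAddChar (k * x)) := by
    intro k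
    have ht : |2 * Real.pi * (k.valMinAbs : ℝ) / N| ≤ Real.pi := by
      have h2 : |(k.valMinAbs : ℝ)| * 2 ≤ N := by
        have := k.natAbs_valMinAbs_le
        have h3 : k.valMinAbs.natAbs * 2 ≤ N := by lia
        have h4 : ((k.valMinAbs.natAbs : ℕ) : ℝ) * 2 ≤ N := by exact_mod_cast h3
        rwa [Nat.cast_natAbs, Int.cast_abs] at h4
      rw [abs_div, abs_mul, abs_of_pos (by positivity : 0 < 2 * Real.pi), abs_of_pos hN,
        div_le_iff₀ hN]
      nlinarith [Real.pi_pos]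
    have h2 := (hsum _ ht).mul_right (ZMod.stdAddChar (k * x) : ℂ)
    have e : ∀ y : ℤ, c y * ZMod.stdAddChar (k * ((y : ZMod N) + x)) =
        c y * Complex.exp (Complex.I * y * ((2 * Real.pi * (k.valMinAbs : ℝ) / N : ℝ) : ℂ)) *
          ZMod.stdAddChar (k * x) := fun y => by
      rw [mul_add, AddChar.map_add_eq_mul, ← mul_assoc]
      congr 2
      conv_lhs => rw [← k.coe_valMinAbs, ← Int.cast_mul, ZMod.stdAddChar_coe]
      congr 1
      push_cast
      field_simp
    simp only [e]
    exact h2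
  have h2 := (hasSum_sum fun k (_ : k ∈ Finset.univ) => h1 k).mul_left (N : ℂ)⁻¹
  have h3 : ∀ y : ℤ, (N : ℂ)⁻¹ * ∑ k : ZMod N, c y * ZMod.stdAddChar (k * ((y : ZMod N) + x)) =
      if (y : ZMod N) + x = 0 then c y else 0 := by
    intro y
    rw [← Finset.mul_sum, AddChar.sum_mulShift _ (ZMod.isPrimitive_stdAddChar N), ZMod.card]
    split_ifs
    · field_simp
    · simp
  simp only [h3] at h2
  rw [← h2.tsum_eq]
  refine (tsum_of_norm_bounded (g := fun y : ℤ => B * Real.exp (-(m / 2 * |(x.valMinAbs : ℝ)|)) *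
    Real.exp (-(m / 2 * |(y : ℝ)|))) ((summable_exp_neg_mul_abs (half_pos hm)).hasSum.mul_left _)
    fun y => ?_).trans (le_of_eq ?_)
  · split_ifs with hy
    · refine (hc y).trans ?_
      rw [mul_assoc, ← Real.exp_add]
      refine mul_le_mul_of_nonneg_left (Real.exp_le_exp.mpr ?_) hB0
      have h4 : |x.valMinAbs| ≤ |-y| :=
        abs_valMinAbs_le_of_intCast_eq (by push_cast; exact neg_eq_of_add_eq_zero_right hy)
      have h5 : |(x.valMinAbs : ℝ)| ≤ |(y : ℝ)| := by
        rw [abs_neg] at h4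
        exact_mod_cast h4
      nlinarith
    · rw [norm_zero]; positivity
  · rw [expSum]; ring

end Strip

/-! ### From decay in one variable to the weighted kernel norm -/

section Kernel

variable {L Nt Ns : ℕ} [NeZero L] [NeZero Nt] [NeZero Ns]

/-- In each coordinate, `g` extends to a holomorphic periodic function on a strip of width `m` that
is bounded by `B`. -/
def HasStripExtension (m B : ℝ) (g : Site L Nt Ns 0 → ℂ) : Prop :=
  ∀ (ν : Fin 4) (k : Site L Nt Ns 0), ∃ f : ℂ → ℂ,
    (∀ z : ℂ, |z.re| ≤ Real.pi → |z.im| ≤ m → DifferentiableAt ℂ f z) ∧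
    (∀ z : ℂ, |z.re| ≤ Real.pi → |z.im| ≤ m → ‖f z‖ ≤ B) ∧
    (∀ s : ℝ, |s| ≤ m → f (-Real.pi + s * Complex.I) = f (Real.pi + s * Complex.I)) ∧
    ∀ s, g (Function.update k ν s) =
      f ((2 * Real.pi * (s.valMinAbs : ℝ) / side Nt Ns ν : ℝ) : ℂ)

/-- Replacing one coordinate of a point by all its values counts every point once for each value of
that coordinate. This isolates a one-dimensional Fourier sum with the other momenta frozen. -/
theorem card_mul_sum_eq_sum_update {ι : Type*} [Fintype ι] [DecidableEq ι] {A : ι → Type*}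
    [∀ i, AddCommGroup (A i)] [∀ i, Fintype (A i)] (F : (∀ i, A i) → ℂ) (i : ι) :
    (Fintype.card (A i) : ℂ) * ∑ k, F k = ∑ k, ∑ s : A i, F (Function.update k i s) := by
  have hshift : ∀ s : A i, ∑ k, F k = ∑ k : ∀ i, A i, F (k + Pi.single i s) := fun s =>
    (Equiv.sum_comp (Equiv.addRight (Pi.single i s)) F).symm
  have h2 : (Fintype.card (A i) : ℂ) * ∑ k, F k =
      ∑ s : A i, ∑ k : ∀ i, A i, F (k + Pi.single i s) := by
    rw [← Finset.sum_congr rfl fun s _ => hshift s]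
    simp
  rw [h2, Finset.sum_comm]
  refine Finset.sum_congr rfl fun k _ => ?_
  rw [← Equiv.sum_comp (Equiv.addLeft (k i)) fun s => F (Function.update k i s)]
  refine Finset.sum_congr rfl fun s _ => ?_
  congr 1
  funext i'
  by_cases h : i' = i
  · subst h; simp
  · simp [h]

/-- Decay is obtained in one chosen direction at a time, so holomorphy is needed in a single
variable only; the other characters have modulus one. -/
theorem norm_diagOp_le {m B : ℝ} (hm : 0 < m) {g : Site L Nt Ns 0 → ℂ}
    (hg : HasStripExtension m B g) (u v : Site L Nt Ns 0) (ν : Fin 4) :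
    ‖diagOp g u v‖ ≤
      B * expSum (m / 2) * Real.exp (-(m / 2 * |((u ν - v ν).valMinAbs : ℝ)|)) := by
  classical
  have hNs : ((blockLen L ν ^ 0 * side Nt Ns ν : ℕ) : ℝ) = side Nt Ns ν := by simp
  have hN' : ((blockLen L ν ^ 0 * side Nt Ns ν : ℕ) : ℂ) ≠ 0 := Nat.cast_ne_zero.mpr (NeZero.ne _)
  set w := u - v with hw
  have h1 : ∑ k, g k * wave k w = ∑ k : Site L Nt Ns 0, ((blockLen L ν ^ 0 * side Nt Ns ν : ℕ) : ℂ)⁻¹ *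
      ∑ s : ZMod (blockLen L ν ^ 0 * side Nt Ns ν), g (Function.update k ν s) * wave (Function.update k ν s) w := by
    have h2 := card_mul_sum_eq_sum_update (fun k : Site L Nt Ns 0 => g k * wave k w) ν
    rw [ZMod.card] at h2
    rw [← Finset.mul_sum, eq_inv_mul_iff_mul_eq₀ hN', h2]
  have h2 : ∀ k : Site L Nt Ns 0, ‖((blockLen L ν ^ 0 * side Nt Ns ν : ℕ) : ℂ)⁻¹ *
      ∑ s : ZMod (blockLen L ν ^ 0 * side Nt Ns ν), g (Function.update k ν s) * wave (Function.update k ν s) w‖ ≤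
      B * expSum (m / 2) * Real.exp (-(m / 2 * |((w ν).valMinAbs : ℝ)|)) := by
    intro k
    obtain ⟨f, hd, hB, hper, hfg⟩ := hg ν k
    have h3 := norm_sum_zmod_le hm hd hB hper _ (w ν)
    have h4 : ∀ s : ZMod (blockLen L ν ^ 0 * side Nt Ns ν), g (Function.update k ν s) * wave (Function.update k ν s) w =
        (∏ ν' ∈ Finset.univ.erase ν, ZMod.stdAddChar (k ν' * w ν')) *
          (f ((2 * Real.pi * (s.valMinAbs : ℝ) / ((blockLen L ν ^ 0 * side Nt Ns ν : ℕ) : ℝ) : ℝ) : ℂ) * ZMod.stdAddChar (s * w ν)) := by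
      intro s
      rw [hfg, wave, ← Finset.mul_prod_erase _ _ (Finset.mem_univ ν), Function.update_self, hNs,
        Finset.prod_congr rfl fun ν' hν' => by
          rw [Function.update_of_ne (Finset.ne_of_mem_erase hν')]]
      ring
    simp only [h4]
    rw [← Finset.mul_sum, mul_left_comm, norm_mul, norm_prod, Finset.prod_eq_one fun ν' _ => by
      rw [ZMod.stdAddChar_apply, Circle.norm_coe], one_mul]
    exact h3
  rw [diagOp, h1, norm_mul, norm_inv, Complex.norm_natCast,
    inv_mul_le_iff₀ (Nat.cast_pos.mpr Fintype.card_pos)]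
  refine (norm_sum_le _ _).trans ((Finset.sum_le_card_nsmul _ _ _ fun k _ => h2 k).trans ?_)
  rw [nsmul_eq_mul, Finset.card_univ]
  rfl

theorem torusDist_zero_le (u v : Site L Nt Ns 0) :
    torusDist L Nt Ns 0 u v ≤ ∑ ν, |((u ν - v ν).valMinAbs : ℝ)| := by
  rw [torusDist]
  refine Real.sqrt_le_iff.mpr ⟨Finset.sum_nonneg fun _ _ => abs_nonneg _, ?_⟩
  simp only [pow_zero, div_one]
  simp only [← sq_abs ((u _ - v _).valMinAbs : ℝ)]
  exact Finset.sum_sq_le_sq_sum_of_nonneg fun _ _ => abs_nonneg _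

theorem opNorm_diagOp_le {m B : ℝ} (hm : 0 < m) {g : Site L Nt Ns 0 → ℂ}
    (hg : HasStripExtension m B g) :
    opNorm L Nt Ns (m / 16) (diagOp g) ≤ B * expSum (m / 2) * expSum (m / 16) ^ 4 := by
  have hB0 : 0 ≤ B := by
    obtain ⟨f, -, hB, -⟩ := hg 0 0
    exact (norm_nonneg _).trans (hB 0 (by simp [Real.pi_pos.le]) (by simpa using hm.le))
  have hK := mul_nonneg hB0 (expSum_nonneg (m / 2))
  have hterm : ∀ u v : Site L Nt Ns 0,
      Real.exp (m / 16 * torusDist L Nt Ns 0 u v) * ‖kernel L Nt Ns (diagOp g) u v‖ ≤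
        B * expSum (m / 2) * ∏ ν, Real.exp (-(m / 16 * |((u ν - v ν).valMinAbs : ℝ)|)) := by
    intro u v
    have hk : ‖kernel L Nt Ns (diagOp g) u v‖ = ‖diagOp g u v‖ := by simp [kernel, cellVol]
    -- Decay is used in the direction of largest displacement. The maximum is at least a quarter of
    -- the sum, so the rate `m / 2` becomes `m / 8` in the sum. One `m / 16` absorbs the weight of
    -- the norm and the other is summed over the torus.
    obtain ⟨ν, -, hν⟩ := Finset.exists_max_image (Finset.univ : Finset (Fin 4))
      (fun ν => |((u ν - v ν).valMinAbs : ℝ)|) Finset.univ_nonempty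
    have hsum : ∑ ν, |((u ν - v ν).valMinAbs : ℝ)| ≤ 4 * |((u ν - v ν).valMinAbs : ℝ)| := by
      refine (Finset.sum_le_card_nsmul _ _ _ fun ν' _ => hν ν' (Finset.mem_univ _)).trans ?_
      simp
    rw [hk, ← Real.exp_sum]
    refine (mul_le_mul_of_nonneg_left (norm_diagOp_le hm hg u v ν) (Real.exp_pos _).le).trans ?_
    rw [mul_left_comm, ← Real.exp_add]
    refine mul_le_mul_of_nonneg_left (Real.exp_le_exp.mpr ?_) hK
    rw [Finset.sum_neg_distrib, ← Finset.mul_sum]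
    have hdist := torusDist_zero_le u v
    have h1 := mul_le_mul_of_nonneg_left hdist (by positivity : 0 ≤ m / 16)
    have h2 := mul_le_mul_of_nonneg_left hsum (by positivity : 0 ≤ m / 8)
    linarith
  have hprod : ∑ w : Site L Nt Ns 0, ∏ ν, Real.exp (-(m / 16 * |((w ν).valMinAbs : ℝ)|)) ≤
      expSum (m / 16) ^ 4 := by
    have h1 := Finset.prod_univ_sum
      (fun ν => (Finset.univ : Finset (ZMod (blockLen L ν ^ 0 * side Nt Ns ν))))
      fun ν (x : ZMod (blockLen L ν ^ 0 * side Nt Ns ν)) =>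
        Real.exp (-(m / 16 * |(x.valMinAbs : ℝ)|))
    rw [Fintype.piFinset_univ] at h1
    rw [← h1]
    refine (Finset.prod_le_prod (fun _ _ => Finset.sum_nonneg fun _ _ => (Real.exp_pos _).le)
      fun ν _ => sum_exp_valMinAbs_le (by positivity : 0 < m / 16) _).trans ?_
    simp
  have hcv : cellVol L 0 = 1 := by simp [cellVol]
  rw [opNorm, hcv]
  simp only [one_mul]
  refine max_le (ciSup_le fun u => ?_) (ciSup_le fun v => ?_)
  · refine (Finset.sum_le_sum fun v _ => hterm u v).trans ?_
    rw [← Finset.mul_sum]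
    refine mul_le_mul_of_nonneg_left (hprod.trans' (le_of_eq ?_)) hK
    exact (Equiv.subLeft u).sum_comp fun w : Site L Nt Ns 0 =>
      ∏ ν, Real.exp (-(m / 16 * |((w ν).valMinAbs : ℝ)|))
  · refine (Finset.sum_le_sum fun u _ => hterm u v).trans ?_
    rw [← Finset.mul_sum]
    refine mul_le_mul_of_nonneg_left (hprod.trans' (le_of_eq ?_)) hK
    exact (Equiv.subRight v).sum_comp fun w : Site L Nt Ns 0 =>
      ∏ ν, Real.exp (-(m / 16 * |((w ν).valMinAbs : ℝ)|))

end Kernel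

end BlockSpin

namespace BlockSpin

/-! ### Estimates on the kinetic energy -/

/-- Evenness kills `deriv f 0`. Cauchy's estimate on unit balls bounds the derivative by `2B` for
`‖w‖ < 11`, the Schwarz lemma makes this bound linear in `‖w‖`, and the mean value inequality
concludes. -/
theorem norm_sub_le_of_even {f : ℂ → ℂ} {B : ℝ} (hf : Differentiable ℂ f) (heven : ∀ s, f (-s) = f s)
    (hB : ∀ s, ‖s‖ ≤ 12 → ‖f s‖ ≤ B) {R : ℝ} (hR : R ≤ 6) {s s' : ℂ} (hs : ‖s‖ ≤ R)
    (hs' : ‖s'‖ ≤ R) : ‖f s - f s'‖ ≤ B * R * ‖s - s'‖ := by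
  have hB0 : 0 ≤ B := (norm_nonneg _).trans (hB 0 (by simp))
  have hdf : Differentiable ℂ (deriv f) :=
    (hf.contDiff (n := 2)).differentiable_deriv_two
  have hd0 : deriv f 0 = 0 := by
    have h1 : deriv (fun s => f (-s)) 0 = -deriv f (-0) := deriv_comp_neg f 0
    rw [funext heven, neg_zero] at h1
    have h2 : (2 : ℂ) * deriv f 0 = 0 := by linear_combination h1
    simpa using h2
  have h1 : ∀ w : ℂ, ‖w‖ < 11 → ‖deriv f w‖ ≤ 2 * B := fun w hw => by
    have := Complex.norm_deriv_le_div_of_mapsTo_ball (f := f) (c := w) (R₁ := 1) (R₂ := 2 * B)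
      hf.differentiableOn (fun v hv => ?_) one_pos
    · simpa using this
    · rw [mem_ball_iff_norm] at hv
      rw [mem_closedBall_iff_norm]
      have hv' : ‖v‖ ≤ 12 := by
        have := norm_le_norm_add_norm_sub' v w
        linarith
      linarith [norm_sub_le (f v) (f w), hB v hv', hB w (by linarith)]
  have h2 : ∀ w : ℂ, ‖w‖ < 11 → ‖deriv f w‖ ≤ B * ‖w‖ := fun w hw => by
    have := Complex.dist_le_div_mul_dist_of_mapsTo_ball (f := deriv f) (c := 0) (R₁ := 11)
      (R₂ := 2 * B) hdf.differentiableOn (fun v hv => ?_) (mem_ball_zero_iff.mpr hw)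
    · rw [hd0, dist_zero_right, dist_zero_right] at this
      refine this.trans (mul_le_mul_of_nonneg_right ?_ (norm_nonneg _))
      linarith
    · rw [hd0, mem_closedBall_zero_iff]
      exact h1 v (mem_ball_zero_iff.mp hv)
  refine (convex_closedBall (0 : ℂ) R).norm_image_sub_le_of_norm_deriv_le
    (fun x _ => hf x) (fun x hx => ?_) (mem_closedBall_zero_iff.mpr hs')
    (mem_closedBall_zero_iff.mpr hs)
  rw [mem_closedBall_zero_iff] at hx
  exact (h2 x (by linarith)).trans (mul_le_mul_of_nonneg_left hx hB0)

section

variable {h : (Fin 3 → ℤ) → ℂ} {hhat : (Fin 3 → ℂ) → ℂ}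

/-- The two points are joined by changing one coordinate at a time. The factor `R` records second
order vanishing at `0`; at momenta of order `L^(-n)` it is what compensates the prefactor `L^(2n)`.
-/
theorem IsKineticOperator.exists_norm_sub_le (hh : IsKineticOperator h hhat) :
    ∃ C : ℝ, 0 ≤ C ∧ ∀ R : ℝ, R ≤ 6 → ∀ z z' : Fin 3 → ℂ, ‖z‖ ≤ R → ‖z'‖ ≤ R →
      ‖hhat z - hhat z'‖ ≤ C * R * ‖z - z'‖ := by
  obtain ⟨B, hB⟩ := (isCompact_closedBall (0 : Fin 3 → ℂ) 12).exists_bound_of_continuousOn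
    hh.entire.continuous.continuousOn
  have hB0 : 0 ≤ B := (norm_nonneg _).trans (hB 0 (by simp))
  refine ⟨3 * B, by positivity, fun R hR z z' hz hz' => ?_⟩
  have hR0 : 0 ≤ R := (norm_nonneg z).trans hz
  have key : ∀ (w : Fin 3 → ℂ) (i : Fin 3) (s : ℂ), ‖w‖ ≤ R → ‖s‖ ≤ R →
      ‖hhat w - hhat (Function.update w i s)‖ ≤ B * R * ‖w i - s‖ := by
    intro w i s hw hs
    have h1 := norm_sub_le_of_even (f := fun s => hhat (Function.update w i s)) (B := B)
      (hh.entire.comp (by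
        rw [differentiable_pi]
        intro ν
        by_cases hν : ν = i
        · subst hν; simp
        · simp [hν])) (fun s => by
        have := hh.even (Function.update w i s) i
        simpa using this) (fun s hs => hB _ (by
        rw [mem_closedBall_zero_iff, pi_norm_le_iff_of_nonneg (by norm_num)]
        intro ν
        by_cases hν : ν = i
        · subst hν; simpa using hs
        · simpa [hν] using (norm_le_pi_norm w ν).trans (by linarith))) hR
      ((norm_le_pi_norm w i).trans hw) hs
    simpa using h1
  have hupd : ∀ (w : Fin 3 → ℂ) (i : Fin 3) (s : ℂ), ‖w‖ ≤ R → ‖s‖ ≤ R →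
      ‖Function.update w i s‖ ≤ R := by
    intro w i s hw hs
    rw [pi_norm_le_iff_of_nonneg hR0]
    intro ν
    by_cases hν : ν = i
    · subst hν; simpa using hs
    · simpa [hν] using (norm_le_pi_norm w ν).trans hw
  have hz's : ∀ i, ‖z' i‖ ≤ R := fun i => (norm_le_pi_norm z' i).trans hz'
  set w₁ := Function.update z 0 (z' 0) with hw₁
  set w₂ := Function.update w₁ 1 (z' 1) with hw₂
  have e3 : Function.update w₂ 2 (z' 2) = z' := by
    funext i
    fin_cases i <;> simp [hw₁, hw₂, Function.update]
  have n1 := hupd z 0 _ hz (hz's 0)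
  have n2 := hupd w₁ 1 _ n1 (hz's 1)
  have k1 := key z 0 _ hz (hz's 0)
  have k2 := key w₁ 1 _ n1 (hz's 1)
  have k3 := key w₂ 2 _ n2 (hz's 2)
  rw [e3] at k3
  have d : ∀ i, ‖z i - z' i‖ ≤ ‖z - z'‖ := fun i => norm_le_pi_norm (z - z') i
  have d1 : w₁ 1 = z 1 := by simp [hw₁]
  have d2 : w₂ 2 = z 2 := by simp [hw₁, hw₂]
  rw [d1] at k2
  rw [d2] at k3
  have hBR : 0 ≤ B * R := mul_nonneg hB0 hR0
  calc ‖hhat z - hhat z'‖ = ‖(hhat z - hhat w₁) + (hhat w₁ - hhat w₂) + (hhat w₂ - hhat z')‖ := by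
        congr 1; ring
    _ ≤ ‖hhat z - hhat w₁‖ + ‖hhat w₁ - hhat w₂‖ + ‖hhat w₂ - hhat z'‖ := norm_add₃_le
    _ ≤ B * R * ‖z - z'‖ + B * R * ‖z - z'‖ + B * R * ‖z - z'‖ := by
        refine add_le_add (add_le_add (k1.trans ?_) (k2.trans ?_)) (k3.trans ?_) <;>
        exact mul_le_mul_of_nonneg_left (d _) hBR
    _ = 3 * B * R * ‖z - z'‖ := by ring

/-- The inclusion of real momenta. -/
def toC (q : Fin 3 → ℝ) : Fin 3 → ℂ := fun ν => (q ν : ℂ)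

theorem continuous_toC : Continuous toC := by unfold toC; fun_prop

theorem norm_toC (q : Fin 3 → ℝ) : ‖toC q‖ = ‖q‖ := by
  simp [toC, Pi.norm_def]

/-- The Hessian, as a real quadratic form. -/
noncomputable def hessForm (hhat : (Fin 3 → ℂ) → ℂ) (q : Fin 3 → ℝ) : ℝ :=
  (fderiv ℂ (fderiv ℂ hhat) 0 (toC q) (toC q)).re

theorem IsKineticOperator.hessForm_pos (hh : IsKineticOperator h hhat) {q : Fin 3 → ℝ}
    (hq : q ≠ 0) : 0 < hessForm hhat q := by
  have h1 := hh.hessian_posDef.dotProduct_mulVec_pos hq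
  have h2 : toC q = ∑ ν, (q ν : ℂ) • (Pi.single ν 1 : Fin 3 → ℂ) := by
    rw [pi_eq_sum_univ (toC q)]
    refine Finset.sum_congr rfl fun ν _ => ?_
    congr 1
    funext μ
    simp [Pi.single_apply, eq_comm]
  have h3 : hessForm hhat q = star q ⬝ᵥ (Matrix.of fun μ ν : Fin 3 =>
      (iteratedFDeriv ℂ 2 hhat 0 ![Pi.single μ 1, Pi.single ν 1]).re).mulVec q := by
    simp only [hessForm, iteratedFDeriv_two_apply, Matrix.cons_val_zero, Matrix.cons_val_one]
    rw [h2]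
    simp only [map_sum, map_smul, sum_apply, smul_apply,
      smul_eq_mul, Complex.re_sum, Complex.re_ofReal_mul, dotProduct, Matrix.mulVec,
      Matrix.of_apply, star_trivial, Finset.mul_sum]
    rw [Finset.sum_comm]
    refine Finset.sum_congr rfl fun μ _ => Finset.sum_congr rfl fun ν _ => ?_
    ring
  rw [h3]
  exact h1

theorem continuous_hessForm : Continuous (hessForm hhat) := by
  unfold hessForm
  have := continuous_toC
  fun_prop

theorem hessForm_smul (t : ℝ) (q : Fin 3 → ℝ) : hessForm hhat (t • q) = t ^ 2 * hessForm hhat q := by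
  have : toC (t • q) = (t : ℂ) • toC q := by funext ν; simp [toC]
  simp only [hessForm, this, map_smul, smul_apply, smul_eq_mul,
    Complex.re_ofReal_mul]
  ring

/-- The minimum over the unit sphere, extended by homogeneity. -/
theorem IsKineticOperator.exists_hessForm_ge (hh : IsKineticOperator h hhat) :
    ∃ lam : ℝ, 0 < lam ∧ ∀ q, lam * ‖q‖ ^ 2 ≤ hessForm hhat q := by
  obtain ⟨q₀, hq₀, hmin⟩ := (isCompact_sphere (0 : Fin 3 → ℝ) 1).exists_isMinOn
    (NormedSpace.sphere_nonempty.mpr zero_le_one)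
    (continuous_hessForm (hhat := hhat)).continuousOn
  have hq₀' : q₀ ≠ 0 := by
    rintro rfl
    simp at hq₀
  refine ⟨hessForm hhat q₀, hh.hessForm_pos hq₀', fun q => ?_⟩
  by_cases hq : q = 0
  · subst hq
    have h0 : toC 0 = 0 := by funext ν; simp [toC]
    simp [hessForm, h0]
  · have hn : ‖q‖ ≠ 0 := norm_ne_zero_iff.mpr hq
    have h1 : hessForm hhat q₀ ≤ hessForm hhat (‖q‖⁻¹ • q) := hmin (by
      rw [mem_sphere_zero_iff_norm, norm_smul, norm_inv, norm_norm, inv_mul_cancel₀ hn])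
    rw [hessForm_smul, inv_pow, ← div_eq_inv_mul, le_div_iff₀ (by positivity)] at h1
    exact h1

/-- Otherwise the second derivative would take its default value `0`, contradicting positive
definiteness. -/
theorem IsKineticOperator.differentiableAt_fderiv (hh : IsKineticOperator h hhat) :
    DifferentiableAt ℂ (fderiv ℂ hhat) 0 := by
  by_contra hn
  have := hh.hessForm_pos (q := fun _ => 1) (fun h0 => one_ne_zero (congrFun h0 0))
  simp [hessForm, fderiv_zero_of_not_differentiableAt hn] at this

theorem IsKineticOperator.exists_re_ge_near (hh : IsKineticOperator h hhat) :
    ∃ lam δ : ℝ, 0 < lam ∧ 0 < δ ∧ ∀ q : Fin 3 → ℝ, ‖q‖ < δ →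
      lam * ‖q‖ ^ 2 ≤ (hhat (toC q)).re := by
  obtain ⟨lam, hlam, hH⟩ := hh.exists_hessForm_ge
  have hd := hh.differentiableAt_fderiv.hasFDerivAt
  rw [hasFDerivAt_iff_isLittleO_nhds_zero] at hd
  -- Taylor's formula yields `1/2` of the Hessian form, at least `lam / 2 * ‖q‖²`; an error of `lam
  -- / 4 * ‖q‖²` leaves `lam / 4`.
  obtain ⟨δ, hδ, hball⟩ := Metric.eventually_nhds_iff.mp (hd.def (by positivity : 0 < lam / 4))
  refine ⟨lam / 4, δ, by positivity, hδ, fun q hq => ?_⟩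
  set B := fderiv ℂ (fderiv ℂ hhat) 0 with hB
  set ψ : ℝ → ℂ := fun t => hhat ((t : ℂ) • toC q) - (t : ℂ) ^ 2 / 2 * B (toC q) (toC q) with hψ
  have hder : ∀ t ∈ Set.Icc (0 : ℝ) 1, HasDerivWithinAt ψ
      (fderiv ℂ hhat ((t : ℂ) • toC q) (toC q) - (t : ℂ) * B (toC q) (toC q)) (Set.Icc 0 1) t := by
    intro t _
    have h1 : HasDerivAt (fun t : ℝ => (t : ℂ) • toC q) (toC q) t := by
      have := (Complex.ofRealCLM.hasDerivAt (x := t)).smul_const (toC q)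
      simpa using this
    have h2 := ((hh.entire ((t : ℂ) • toC q)).hasFDerivAt.restrictScalars ℝ).comp_hasDerivAt t h1
    have h3 : HasDerivAt (fun t : ℝ => (t : ℂ) ^ 2 / 2 * B (toC q) (toC q))
        ((t : ℂ) * B (toC q) (toC q)) t := by
      have h4 : HasDerivAt (fun t : ℝ => (t : ℂ)) 1 t := Complex.ofRealCLM.hasDerivAt
      refine (((h4.fun_pow 2).div_const 2).mul_const (B (toC q) (toC q))).congr_deriv ?_
      simp
    exact (h2.sub h3).hasDerivWithinAt
  have hbd : ∀ t ∈ Set.Ico (0 : ℝ) 1, ‖fderiv ℂ hhat ((t : ℂ) • toC q) (toC q) -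
      (t : ℂ) * B (toC q) (toC q)‖ ≤ lam / 4 * ‖q‖ ^ 2 := by
    intro t ht
    have hn : ‖(t : ℂ) • toC q‖ ≤ ‖q‖ := by
      rw [norm_smul, norm_toC, Complex.norm_real, Real.norm_of_nonneg ht.1]
      exact mul_le_of_le_one_left (norm_nonneg _) ht.2.le
    have h1 := hball (y := (t : ℂ) • toC q) (by rw [dist_zero_right]; linarith)
    rw [zero_add, hh.deriv_zero, sub_zero] at h1
    have h2 := (fderiv ℂ hhat ((t : ℂ) • toC q) - B ((t : ℂ) • toC q)).le_opNorm (toC q)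
    have h3 : (fderiv ℂ hhat ((t : ℂ) • toC q) - B ((t : ℂ) • toC q)) (toC q) =
        fderiv ℂ hhat ((t : ℂ) • toC q) (toC q) - (t : ℂ) * B (toC q) (toC q) := by
      simp
    rw [h3, norm_toC] at h2
    refine h2.trans ?_
    rw [sq, ← mul_assoc]
    refine mul_le_mul_of_nonneg_right (h1.trans ?_) (norm_nonneg _)
    exact mul_le_mul_of_nonneg_left hn (by positivity)
  have hmv := norm_image_sub_le_of_norm_deriv_le_segment_01' hder hbd
  have e : ψ 1 - ψ 0 = hhat (toC q) - 1 / 2 * B (toC q) (toC q) := by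
    simp [hψ, hh.zero]
  rw [e] at hmv
  have h1 := (Complex.abs_re_le_norm _).trans hmv
  have h2 : (hhat (toC q) - 1 / 2 * B (toC q) (toC q)).re =
      (hhat (toC q)).re - 1 / 2 * hessForm hhat q := by
    have : (1 / 2 : ℂ) = ((1 / 2 : ℝ) : ℂ) := by push_cast; rfl
    rw [this, Complex.sub_re, Complex.re_ofReal_mul]
    rfl
  rw [h2] at h1
  have h3 := (abs_le.mp h1).1
  linarith [hH q]

/-- Since `4 < 2π`, the origin is the only zero in this ball. The Hessian handles its neighbourhood
and compactness the rest, where `‖q‖² ≤ 16`. -/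
theorem IsKineticOperator.exists_re_ge (hh : IsKineticOperator h hhat) :
    ∃ c : ℝ, 0 < c ∧ ∀ q : Fin 3 → ℝ, ‖q‖ ≤ 4 → c * ‖q‖ ^ 2 ≤ (hhat (toC q)).re := by
  obtain ⟨lam, δ, hlam, hδ, hnear⟩ := hh.exists_re_ge_near
  have hcpt : IsCompact (Metric.closedBall (0 : Fin 3 → ℝ) 4 ∩ {q | δ ≤ ‖q‖}) :=
    (isCompact_closedBall _ _).inter_right (isClosed_le continuous_const continuous_norm)
  have hpos : ∀ q ∈ Metric.closedBall (0 : Fin 3 → ℝ) 4 ∩ {q | δ ≤ ‖q‖},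
      0 < (hhat (toC q)).re := by
    rintro q ⟨hq, hqδ⟩
    refine hh.pos q ?_
    rintro ⟨z, hz⟩
    rw [mem_closedBall_zero_iff] at hq
    have hq0 : q = 0 := by
      funext ν
      have h1 : |q ν| ≤ 4 := (norm_le_pi_norm q ν).trans hq
      rw [hz, abs_mul, abs_of_pos (by positivity : 0 < 2 * Real.pi)] at h1
      have h2 : |(z ν : ℝ)| < 1 := by nlinarith [Real.pi_gt_three, abs_nonneg (z ν : ℝ)]
      have h3 : z ν = 0 := Int.abs_lt_one_iff.mp (by exact_mod_cast h2)
      rw [hz, h3]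
      simp
    rw [hq0] at hqδ
    simp at hqδ
    linarith
  have hcont : Continuous fun q => (hhat (toC q)).re :=
    Complex.continuous_re.comp (hh.entire.continuous.comp continuous_toC)
  obtain ⟨m, hm, hmin⟩ : ∃ m : ℝ, 0 < m ∧ ∀ q ∈ Metric.closedBall (0 : Fin 3 → ℝ) 4 ∩
      {q | δ ≤ ‖q‖}, m ≤ (hhat (toC q)).re := by
    exact hcpt.exists_forall_le' hcont.continuousOn hpos
  refine ⟨min lam (m / 16), by positivity, fun q hq => ?_⟩
  by_cases hqδ : ‖q‖ < δ
  · refine le_trans ?_ (hnear q hqδ)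
    exact mul_le_mul_of_nonneg_right (min_le_left _ _) (by positivity)
  · refine le_trans ?_ (hmin q ⟨mem_closedBall_zero_iff.mpr hq, not_lt.mp hqδ⟩)
    have h1 : ‖q‖ ^ 2 ≤ 16 := by nlinarith [norm_nonneg q]
    have h2 := mul_le_mul_of_nonneg_right (min_le_right lam (m / 16)) (sq_nonneg ‖q‖)
    nlinarith

theorem IsKineticOperator.eq_ofReal (hh : IsKineticOperator h hhat) (q : Fin 3 → ℝ) :
    hhat (toC q) = ((hhat (toC q)).re : ℂ) :=
  Complex.ext rfl (by rw [Complex.ofReal_im]; exact hh.real q)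

end

theorem sin_ge_quarter {y : ℝ} (h0 : 0 ≤ y) (h2 : y ≤ 2) : y / 4 ≤ Real.sin y := by
  rcases le_total y (Real.pi / 2) with h | h
  · have := Real.mul_le_sin h0 h
    have hπ : 1 / 4 ≤ 2 / Real.pi := by
      rw [div_le_div_iff₀ (by norm_num) Real.pi_pos]
      linarith [Real.pi_le_four]
    nlinarith
  -- Beyond `π / 2`, Jordan's inequality is applied to `π - y`, which is at least `1`.
  · have h3 := Real.mul_le_sin (x := Real.pi - y) (by linarith [Real.pi_gt_three]) (by linarith)
    rw [Real.sin_pi_sub] at h3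
    have hπ : 1 / 2 ≤ 2 / Real.pi := by
      rw [div_le_div_iff₀ (by norm_num) Real.pi_pos]
      linarith [Real.pi_le_four]
    nlinarith [Real.pi_gt_three]

theorem abs_sin_ge_quarter {y : ℝ} (h : |y| ≤ 2) : |y| / 4 ≤ |Real.sin y| := by
  rcases le_total 0 y with h0 | h0
  · rw [abs_of_nonneg h0] at h ⊢
    exact (sin_ge_quarter h0 h).trans (le_abs_self _)
  · rw [abs_of_nonpos h0] at h ⊢
    have := sin_ge_quarter (neg_nonneg.mpr h0) h
    rw [Real.sin_neg] at this
    exact this.trans (neg_le_abs _)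

/-- With `r = e^(-η)`, the squared modulus is `(1 - r)² + 4 r sin²(θ/2)`. The first term controls
`η`, the second `|θ|`, and the two bounds are averaged. -/
theorem one_sub_exp_ge {η θ K : ℝ} (hη : 0 ≤ η) (hηK : η ≤ K) (hθ : |θ| ≤ 4) :
    Real.exp (-K) / 8 * (η + |θ|) ≤ ‖1 - Complex.exp (-(η : ℂ) + Complex.I * θ)‖ := by
  set w := 1 - Complex.exp (-(η : ℂ) + Complex.I * θ) with hw
  set r := Real.exp (-η) with hr
  have hre : w.re = 1 - r * Real.cos θ := by simp [hw, Complex.exp_re, hr]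
  have him : w.im = -(r * Real.sin θ) := by simp [hw, Complex.exp_im, hr]
  have hr0 : 0 < r := Real.exp_pos _
  have hr1 : r ≤ 1 := Real.exp_le_one_iff.mpr (by linarith)
  have hrK : Real.exp (-K) ≤ r := Real.exp_le_exp.mpr (by linarith)
  have hK0 : 0 < Real.exp (-K) := Real.exp_pos _
  have h1 : Real.exp (-K) * η ≤ 1 - r := by
    have h2 : η + 1 ≤ Real.exp η := Real.add_one_le_exp η
    have h3 : r * Real.exp η = 1 := by rw [hr, ← Real.exp_add]; simp
    nlinarith
  have hnorm : ‖w‖ ^ 2 = (1 - r) ^ 2 + 4 * r * Real.sin (θ / 2) ^ 2 := by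
    rw [← Complex.normSq_eq_norm_sq, Complex.normSq_apply, hre, him]
    have hc : Real.cos θ = 1 - 2 * Real.sin (θ / 2) ^ 2 := by
      have := Real.cos_two_mul' (θ / 2)
      rw [mul_div_cancel₀ _ (two_ne_zero)] at this
      rw [this, Real.cos_sq']
      ring
    have hs : Real.sin θ ^ 2 = 1 - Real.cos θ ^ 2 := Real.sin_sq θ
    have : (1 - r * Real.cos θ) * (1 - r * Real.cos θ) + -(r * Real.sin θ) * -(r * Real.sin θ) =
        1 - 2 * r * Real.cos θ + r ^ 2 * Real.cos θ ^ 2 + r ^ 2 * Real.sin θ ^ 2 := by ring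
    rw [this, hs, hc]
    ring
  have hb1 : 1 - r ≤ ‖w‖ := by
    refine le_of_sq_le_sq ?_ (norm_nonneg _)
    rw [hnorm]
    nlinarith [sq_nonneg (Real.sin (θ / 2))]
  have hb2 : Real.exp (-K) * (|θ| / 4) ≤ ‖w‖ := by
    refine le_of_sq_le_sq ?_ (norm_nonneg _)
    rw [hnorm]
    have hsin : |θ| / 8 ≤ |Real.sin (θ / 2)| := by
      have := abs_sin_ge_quarter (y := θ / 2) (by rw [abs_div, abs_two]; linarith)
      rw [abs_div, abs_two] at this
      linarith
    have hsin2 : (|θ| / 8) ^ 2 ≤ Real.sin (θ / 2) ^ 2 := by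
      rw [← sq_abs (Real.sin _)]
      exact pow_le_pow_left₀ (by positivity) hsin 2
    have hK1 : Real.exp (-K) ^ 2 ≤ r := by nlinarith
    have h3 : (Real.exp (-K) * (|θ| / 4)) ^ 2 = 4 * Real.exp (-K) ^ 2 * (|θ| / 8) ^ 2 := by ring
    rw [h3]
    have h4 : 4 * Real.exp (-K) ^ 2 * (|θ| / 8) ^ 2 ≤ 4 * r * Real.sin (θ / 2) ^ 2 :=
      mul_le_mul (by linarith) hsin2 (by positivity) (by positivity)
    nlinarith [sq_nonneg (1 - r)]
  nlinarith [abs_nonneg θ]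

end BlockSpin

namespace BlockSpin

/-! ### Estimates on the symbols -/

section

variable {h : (Fin 3 → ℤ) → ℂ} {hhat : (Fin 3 → ℂ) → ℂ}

/-- At real momenta `hhat ≥ 0`, so the exponential lies in the closed unit disc. -/
theorem IsKineticOperator.kinSymb_re_nonneg (hh : IsKineticOperator h hhat) (L n : ℕ)
    (p : Fin 4 → ℝ) : 0 ≤ (kinSymb L n hhat fun ν => (p ν : ℂ)).re := by
  set q : Fin 3 → ℝ := fun ν => p ν.succ / (L : ℝ) ^ n with hq
  have e : (fun ν : Fin 3 => (p ν.succ : ℂ) / (L : ℂ) ^ n) = toC q := by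
    funext ν; simp [toC, hq]
  have e1 : (L : ℂ) ^ (2 * n) = (((L : ℝ) ^ (2 * n) : ℝ) : ℂ) := by push_cast; rfl
  have h0 : 0 ≤ (hhat (toC q)).re := hh.nonneg q
  rw [kinSymb, e, hh.eq_ofReal, e1, Complex.re_ofReal_mul]
  refine mul_nonneg (by positivity) ?_
  rw [Complex.sub_re, Complex.one_re, sub_nonneg]
  refine (Complex.re_le_norm _).trans ?_
  rw [Complex.norm_exp]
  refine Real.exp_le_one_iff.mpr ?_
  have e2 : ((p 0 : ℝ) : ℂ) / (L : ℂ) ^ (2 * n) = ((p 0 / (L : ℝ) ^ (2 * n) : ℝ) : ℂ) := by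
    push_cast; rfl
  rw [← e1, e2, Complex.add_re, Complex.I_mul_re, Complex.ofReal_im, Complex.neg_re, Complex.ofReal_re]
  linarith

theorem differentiable_kinSymb (hh : IsKineticOperator h hhat) (L n : ℕ) :
    Differentiable ℂ (kinSymb L n hhat) := by
  unfold kinSymb
  have h1 : Differentiable ℂ fun z : Fin 4 → ℂ => hhat fun ν => z ν.succ / (L : ℂ) ^ n :=
    hh.entire.comp (by rw [differentiable_pi]; intro ν; fun_prop)
  exact (differentiable_const _).mul ((differentiable_const 1).sub (h1.neg.add (by fun_prop)).cexp)

/-- For momenta of size at most `5` the exponent is at most `(25 C + 5) / M²`, with `M = L^n`,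
because `hhat` vanishes quadratically; this cancels the prefactor `M²`. -/
theorem IsKineticOperator.exists_norm_kinSymb_le (hh : IsKineticOperator h hhat) :
    ∃ C : ℝ, 0 < C ∧ ∀ L n : ℕ, 1 ≤ L → ∀ z : Fin 4 → ℂ, (∀ ν, ‖z ν‖ ≤ 5) →
      ‖kinSymb L n hhat z‖ ≤ C := by
  obtain ⟨C, hC0, hC⟩ := hh.exists_norm_sub_le
  refine ⟨(25 * C + 5) * Real.exp (25 * C + 5), by positivity, fun L n hL z hz => ?_⟩
  set M : ℝ := (L : ℝ) ^ n with hM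
  have hM1 : 1 ≤ M := one_le_pow₀ (by exact_mod_cast hL)
  have hM0 : 0 < M := by linarith
  have hE : (L : ℂ) ^ (2 * n) = ((M ^ 2 : ℝ) : ℂ) := by
    rw [hM, ← pow_mul, mul_comm]; push_cast; rfl
  set w := -hhat (fun ν => z ν.succ / (L : ℂ) ^ n) + Complex.I * (z 0 / (L : ℂ) ^ (2 * n)) with hw
  have hnL : ‖(L : ℂ) ^ n‖ = M := by rw [norm_pow, Complex.norm_natCast]
  have hb : ‖fun ν : Fin 3 => z ν.succ / (L : ℂ) ^ n‖ ≤ 5 / M := by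
    rw [pi_norm_le_iff_of_nonneg (by positivity)]
    intro ν
    rw [norm_div, hnL]
    gcongr
    exact hz _
  have hb5 : 5 / M ≤ 6 := by rw [div_le_iff₀ hM0]; linarith
  have h1 := hC (5 / M) hb5 _ 0 hb (by rw [norm_zero]; positivity)
  rw [hh.zero, sub_zero, sub_zero] at h1
  have h2 : ‖hhat fun ν => z ν.succ / (L : ℂ) ^ n‖ ≤ C * (5 / M) * (5 / M) :=
    h1.trans (mul_le_mul_of_nonneg_left hb (by positivity))
  have h3 : ‖w‖ ≤ (25 * C + 5) / M ^ 2 := by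
    refine (norm_add_le _ _).trans ?_
    rw [norm_neg, norm_mul, Complex.norm_I, one_mul, norm_div, hE, Complex.norm_real,
      Real.norm_of_nonneg (sq_nonneg M)]
    have h4 : ‖z 0‖ / M ^ 2 ≤ 5 / M ^ 2 := by
      gcongr
      exact hz 0
    calc _ ≤ C * (5 / M) * (5 / M) + 5 / M ^ 2 := add_le_add h2 h4
      _ = _ := by field_simp; ring
  have h4 : ‖w‖ ≤ 25 * C + 5 := h3.trans (div_le_self (by positivity) (one_le_pow₀ hM1))
  have h5 := Complex.norm_exp_sub_sum_le_norm_mul_exp w 1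
  simp only [Finset.sum_range_one, pow_zero, Nat.factorial_zero, Nat.cast_one, div_one,
    pow_one] at h5
  rw [kinSymb, ← hw, norm_mul, hE, Complex.norm_real, Real.norm_of_nonneg (sq_nonneg M),
    norm_sub_rev]
  calc M ^ 2 * ‖Complex.exp w - 1‖ ≤ M ^ 2 * ((25 * C + 5) / M ^ 2 * Real.exp (25 * C + 5)) := by
        refine mul_le_mul_of_nonneg_left (h5.trans ?_) (sq_nonneg M)
        exact mul_le_mul h3 (Real.exp_le_exp.mpr h4) (Real.exp_pos _).le (by positivity)
    _ = _ := by field_simp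

/-- The range of momenta rescales to `[-4, 4]` in each direction, where `hhat` dominates a multiple
of `‖q‖²`; undoing the parabolic scaling removes all dependence on `L` and `n`. -/
theorem IsKineticOperator.exists_norm_kinSymb_real_ge (hh : IsKineticOperator h hhat) :
    ∃ c : ℝ, 0 < c ∧ ∀ L n : ℕ, 1 ≤ L → ∀ p : Fin 4 → ℝ,
      (∀ ν, |p ν| ≤ 4 * (blockLen L ν : ℝ) ^ n) →
      c * (‖fun ν : Fin 3 => p ν.succ‖ ^ 2 + |p 0|) ≤ ‖kinSymb L n hhat fun ν => (p ν : ℂ)‖ := by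
  obtain ⟨C, hC0, hC⟩ := hh.exists_norm_sub_le
  obtain ⟨c, hc, hlow⟩ := hh.exists_re_ge
  set K := C * 4 * 4 with hK
  refine ⟨Real.exp (-K) / 8 * min c 1, by positivity, fun L n hL p hp => ?_⟩
  set M : ℝ := (L : ℝ) ^ n with hM
  have hM1 : 1 ≤ M := one_le_pow₀ (by exact_mod_cast hL)
  have hM0 : 0 < M := by linarith
  have hE : (L : ℂ) ^ (2 * n) = ((M ^ 2 : ℝ) : ℂ) := by
    rw [hM, ← pow_mul, mul_comm]; push_cast; rfl
  set q : Fin 3 → ℝ := M⁻¹ • fun ν => p ν.succ with hq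
  have e : (fun ν : Fin 3 => (p ν.succ : ℂ) / (L : ℂ) ^ n) = toC q := by
    funext ν
    simp [toC, hq, hM, div_eq_inv_mul]
  have hnq : ‖q‖ = M⁻¹ * ‖fun ν : Fin 3 => p ν.succ‖ := by
    rw [hq, norm_smul, Real.norm_of_nonneg (by positivity)]
  have hq4 : ‖q‖ ≤ 4 := by
    rw [hnq, inv_mul_le_iff₀ hM0, pi_norm_le_iff_of_nonneg (by positivity)]
    intro ν
    have := hp ν.succ
    simp only [blockLen, Fin.succ_ne_zero, if_false] at this
    rw [Real.norm_eq_abs]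
    linarith
  have hη0 := hlow q hq4
  have hη : 0 ≤ (hhat (toC q)).re := le_trans (by positivity) hη0
  have hηK : (hhat (toC q)).re ≤ K := by
    have h1 := hC 4 (by norm_num) (toC q) 0 (by rwa [norm_toC]) (by simp)
    rw [hh.zero, sub_zero, sub_zero, norm_toC] at h1
    refine (Complex.re_le_norm _).trans (h1.trans ?_)
    exact mul_le_mul_of_nonneg_left hq4 (by positivity)
  have hθ : |p 0 / M ^ 2| ≤ 4 := by
    have := hp 0
    simp only [blockLen, if_true] at this
    rw [abs_div, abs_of_pos (by positivity : 0 < M ^ 2), div_le_iff₀ (by positivity)]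
    push_cast at this
    rwa [← pow_mul, mul_comm 2 n, pow_mul] at this
  have h1 := one_sub_exp_ge hη hηK hθ
  rw [kinSymb, e, hh.eq_ofReal, hE, norm_mul, Complex.norm_real,
    Real.norm_of_nonneg (sq_nonneg M), ← Complex.ofReal_div]
  refine le_trans ?_ (mul_le_mul_of_nonneg_left h1 (sq_nonneg M))
  rw [abs_div, abs_of_pos (by positivity : 0 < M ^ 2)]
  have h2 : min c 1 * (‖fun ν : Fin 3 => p ν.succ‖ ^ 2 + |p 0|) ≤
      M ^ 2 * ((hhat (toC q)).re + |p 0| / M ^ 2) := by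
    have h3 : M ^ 2 * (c * ‖q‖ ^ 2) = c * ‖fun ν : Fin 3 => p ν.succ‖ ^ 2 := by
      rw [hnq]; field_simp
    have h4 := mul_le_mul_of_nonneg_left hη0 (sq_nonneg M)
    rw [h3] at h4
    have h5 : M ^ 2 * (|p 0| / M ^ 2) = |p 0| := by field_simp
    rw [mul_add, mul_add, h5]
    refine add_le_add (le_trans ?_ h4) ?_
    · exact mul_le_mul_of_nonneg_right (min_le_left _ _) (sq_nonneg _)
    · exact mul_le_of_le_one_left (abs_nonneg _) (min_le_right _ _)
  calc _ = Real.exp (-K) / 8 * (min c 1 * (‖fun ν : Fin 3 => p ν.succ‖ ^ 2 + |p 0|)) := by ring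
    _ ≤ Real.exp (-K) / 8 * (M ^ 2 * ((hhat (toC q)).re + |p 0| / M ^ 2)) :=
        mul_le_mul_of_nonneg_left h2 (by positivity)
    _ = _ := by ring

theorem IsKineticOperator.exists_norm_kinSymb_sub_le (hh : IsKineticOperator h hhat) :
    ∃ C : ℝ, 1 ≤ C ∧ ∀ L n : ℕ, 1 ≤ L → ∀ m : ℝ, 0 ≤ m → m ≤ C⁻¹ → ∀ z : Fin 4 → ℂ,
      (∀ ν, |(z ν).re| ≤ 4 * (blockLen L ν : ℝ) ^ n) → (∀ ν, |(z ν).im| ≤ m) →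
      ‖kinSymb L n hhat z - kinSymb L n hhat fun ν => ((z ν).re : ℂ)‖ ≤
        C * m * (1 + ‖fun ν : Fin 3 => (z ν.succ).re‖ ^ 2) := by
  obtain ⟨C, hC0, hC⟩ := hh.exists_norm_sub_le
  -- The constant serves twice: through `m ≤ C⁻¹` it forces `‖δ‖ ≤ 1` below, and it absorbs the
  -- linear term in the final quadratic bound.
  refine ⟨5 * C + 2 * (2 * C + 1), by linarith, fun L n hL m hm0 hm z hz hzi => ?_⟩
  have hm1 : m * (5 * C + 2 * (2 * C + 1)) ≤ 1 := by
    exact (mul_le_mul_of_nonneg_right hm (by positivity)).trans_eq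
      (inv_mul_cancel₀ (by positivity))
  have hm1' : m ≤ 1 := by nlinarith
  set M : ℝ := (L : ℝ) ^ n with hM
  have hM1 : 1 ≤ M := one_le_pow₀ (by exact_mod_cast hL)
  have hM0 : 0 < M := by linarith
  have hE : (L : ℂ) ^ (2 * n) = ((M ^ 2 : ℝ) : ℂ) := by
    rw [hM, ← pow_mul, mul_comm]; push_cast; rfl
  have hnL : ‖(L : ℂ) ^ n‖ = M := by rw [norm_pow, Complex.norm_natCast]
  set r := ‖fun ν : Fin 3 => (z ν.succ).re‖ with hr
  have hr0 : 0 ≤ r := norm_nonneg _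
  have hrν : ∀ ν : Fin 3, |(z ν.succ).re| ≤ r := fun ν =>
    norm_le_pi_norm (fun ν : Fin 3 => (z ν.succ).re) ν
  have hr4 : r ≤ 4 * M := by
    rw [hr, pi_norm_le_iff_of_nonneg (by positivity)]
    intro ν
    have := hz ν.succ
    rw [Real.norm_eq_abs, hM]
    simpa only [blockLen, Fin.succ_ne_zero, if_false] using this
  set y : Fin 3 → ℂ := fun ν => z ν.succ / (L : ℂ) ^ n with hy
  set y' : Fin 3 → ℂ := fun ν => ((z ν.succ).re : ℂ) / (L : ℂ) ^ n with hy'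
  set R := (r + 1) / M with hR
  have hR6 : R ≤ 6 := by rw [hR, div_le_iff₀ hM0]; linarith
  have hyR : ‖y‖ ≤ R := by
    rw [pi_norm_le_iff_of_nonneg (by positivity)]
    intro ν
    rw [hy, hR, norm_div, hnL]
    gcongr
    refine (Complex.norm_le_abs_re_add_abs_im _).trans (add_le_add (hrν ν) ((hzi _).trans hm1'))
  have hy'R : ‖y'‖ ≤ R := by
    rw [pi_norm_le_iff_of_nonneg (by positivity)]
    intro ν
    rw [hy', hR, norm_div, hnL]
    gcongr
    rw [Complex.norm_real, Real.norm_eq_abs]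
    linarith [hrν ν]
  have hsub : ∀ ν, ‖z ν - ((z ν).re : ℂ)‖ ≤ m := fun ν => by
    have : z ν - ((z ν).re : ℂ) = ((z ν).im : ℂ) * Complex.I := by
      linear_combination -(Complex.re_add_im (z ν))
    rw [this, norm_mul, Complex.norm_I, mul_one, Complex.norm_real, Real.norm_eq_abs]
    exact hzi ν
  have hyy : ‖y - y'‖ ≤ m / M := by
    rw [pi_norm_le_iff_of_nonneg (by positivity)]
    intro ν
    rw [Pi.sub_apply, hy, hy', ← sub_div, norm_div, hnL]
    gcongr
    exact hsub _
  have h1 := (hC R hR6 y y' hyR hy'R).trans (mul_le_mul_of_nonneg_left hyy (by positivity))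
  set w := -hhat y + Complex.I * (z 0 / (L : ℂ) ^ (2 * n)) with hw
  set w' := -hhat y' + Complex.I * (((z 0).re : ℂ) / (L : ℂ) ^ (2 * n)) with hw'
  set δ := w - w' with hδ
  have hδ1 : ‖δ‖ ≤ m * (C * (r + 1) + 1) / M ^ 2 := by
    have e : δ = -(hhat y - hhat y') + Complex.I * ((z 0 - ((z 0).re : ℂ)) / (L : ℂ) ^ (2 * n)) := by
      rw [hδ, hw, hw']; ring
    rw [e]
    refine (norm_add_le _ _).trans ?_
    rw [norm_neg, norm_mul, Complex.norm_I, one_mul, norm_div, hE, Complex.norm_real,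
      Real.norm_of_nonneg (sq_nonneg M)]
    have h4 : ‖z 0 - ((z 0).re : ℂ)‖ / M ^ 2 ≤ m / M ^ 2 := by
      gcongr
      exact hsub 0
    calc _ ≤ C * R * (m / M) + m / M ^ 2 := add_le_add h1 h4
      _ = _ := by rw [hR]; field_simp
  have hδ2 : ‖δ‖ ≤ 1 := by
    refine hδ1.trans ?_
    rw [div_le_one (by positivity)]
    have h5 : C * (r + 1) + 1 ≤ (5 * C + 1) * M := by nlinarith
    have h6 : m * (C * (r + 1) + 1) ≤ m * ((5 * C + 1) * M) := mul_le_mul_of_nonneg_left h5 hm0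
    have h7 : m * (5 * C + 1) ≤ 1 := by nlinarith
    nlinarith
  have hw'n : ‖Complex.exp w'‖ ≤ 1 := by
    rw [Complex.norm_exp]
    refine Real.exp_le_one_iff.mpr ?_
    have e : y' = toC fun ν => (z ν.succ).re / M := by
      funext ν; simp [hy', toC, hM]
    have h0 : 0 ≤ (hhat y').re := by rw [e]; exact hh.nonneg _
    rw [hw', hE, ← Complex.ofReal_div, Complex.add_re, Complex.I_mul_re, Complex.ofReal_im,
      Complex.neg_re]
    linarith
  -- Factoring out the exponential at the real momentum, which has modulus at most one, reduces the
  -- difference to `e^δ - 1`.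
  have hmain : kinSymb L n hhat z - kinSymb L n hhat (fun ν => ((z ν).re : ℂ)) =
      -((L : ℂ) ^ (2 * n) * (Complex.exp w' * (Complex.exp δ - 1))) := by
    have : Complex.exp w = Complex.exp w' * Complex.exp δ := by
      rw [← Complex.exp_add, hδ]; congr 1; ring
    rw [kinSymb, kinSymb, ← hy, ← hw, ← hy', ← hw', this]
    ring
  rw [hmain, norm_neg, norm_mul, norm_mul, hE, Complex.norm_real,
    Real.norm_of_nonneg (sq_nonneg M)]
  calc M ^ 2 * (‖Complex.exp w'‖ * ‖Complex.exp δ - 1‖)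
      ≤ M ^ 2 * (1 * (2 * (m * (C * (r + 1) + 1) / M ^ 2))) := by
        refine mul_le_mul_of_nonneg_left (mul_le_mul hw'n ?_ (norm_nonneg _) zero_le_one)
          (sq_nonneg M)
        exact (Complex.norm_exp_sub_one_le hδ2).trans (mul_le_mul_of_nonneg_left hδ1 zero_le_two)
    _ = m * (2 * (C * (r + 1) + 1)) := by field_simp
    _ ≤ m * ((5 * C + 2 * (2 * C + 1)) * (1 + r ^ 2)) := by
        refine mul_le_mul_of_nonneg_left ?_ hm0
        nlinarith [sq_nonneg (r - 1), mul_nonneg hC0 (sq_nonneg (r - 1)), sq_nonneg r,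
          mul_nonneg hC0 (sq_nonneg r)]
    _ = _ := by ring

/-- The real lower bound is `c (r² + |Re z₀|)` with bracket at least `2`, while leaving the real
axis costs at most `c/4 (1 + r²)`. The threshold `2` covers both `ℓ ≠ 0` and the edge `|Re z_ν| = π`
of the momentum zone. -/
theorem IsKineticOperator.exists_norm_kinSymb_ge (hh : IsKineticOperator h hhat) :
    ∃ c m : ℝ, 0 < c ∧ 0 < m ∧ m ≤ 1 ∧ ∀ L n : ℕ, 1 ≤ L → ∀ z : Fin 4 → ℂ,
      (∀ ν, |(z ν).re| ≤ 4 * (blockLen L ν : ℝ) ^ n) → (∀ ν, |(z ν).im| ≤ m) →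
      (∃ ν, 2 ≤ |(z ν).re|) → c ≤ ‖kinSymb L n hhat z‖ := by
  obtain ⟨c, hc, hlow⟩ := hh.exists_norm_kinSymb_real_ge
  obtain ⟨C, hC, hdiff⟩ := hh.exists_norm_kinSymb_sub_le
  have hC0 : 0 < C := by linarith
  refine ⟨c, min C⁻¹ (c / (4 * C)), hc, by positivity,
    (min_le_left _ _).trans (inv_le_one_of_one_le₀ hC), fun L n hL z hz hzi hex => ?_⟩
  have h1 := hlow L n hL (fun ν => (z ν).re) hz
  have h2 := hdiff L n hL _ (by positivity) (min_le_left _ _) z hz hzi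
  set r := ‖fun ν : Fin 3 => (z ν.succ).re‖ with hr
  have hρ : 2 ≤ r ^ 2 + |(z 0).re| := by
    obtain ⟨ν, hν⟩ := hex
    refine Fin.cases (fun h0 => ?_) (fun i hi => ?_) ν hν
    · nlinarith [sq_nonneg r]
    · have : |(z i.succ).re| ≤ r := norm_le_pi_norm (fun ν : Fin 3 => (z ν.succ).re) i
      nlinarith [abs_nonneg (z 0).re]
  have h3 : C * min C⁻¹ (c / (4 * C)) ≤ c / 4 := by
    refine (mul_le_mul_of_nonneg_left (min_le_right _ _) hC0.le).trans (le_of_eq ?_)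
    field_simp
  have h4 : C * min C⁻¹ (c / (4 * C)) * (1 + r ^ 2) ≤ c / 4 * (1 + r ^ 2) :=
    mul_le_mul_of_nonneg_right h3 (by positivity)
  have h5 := norm_sub_norm_le (kinSymb L n hhat fun ν => ((z ν).re : ℂ)) (kinSymb L n hhat z)
  rw [norm_sub_rev] at h5
  nlinarith [abs_nonneg (z 0).re, mul_nonneg hc.le (abs_nonneg (z 0).re),
    mul_le_mul_of_nonneg_left hρ hc.le]

end

/-! ### Size of the averaging symbols -/

theorem norm_sin_ge (w : ℂ) : |Real.sin w.re| ≤ ‖Complex.sin w‖ := by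
  have h1 : ‖Complex.sin w‖ ^ 2 = Real.sin w.re ^ 2 * Real.cosh w.im ^ 2 +
      Real.cos w.re ^ 2 * Real.sinh w.im ^ 2 := by
    rw [← Complex.normSq_eq_norm_sq, Complex.normSq_apply]
    have h2 : Complex.sin w = ((Real.sin w.re * Real.cosh w.im : ℝ) : ℂ) +
        ((Real.cos w.re * Real.sinh w.im : ℝ) : ℂ) * Complex.I := by
      conv_lhs => rw [← Complex.re_add_im w, Complex.sin_add_mul_I]
      push_cast
      rfl
    rw [h2, ← Complex.mk_eq_add_mul_I]
    ring
  refine abs_le_of_sq_le_sq ?_ (norm_nonneg _)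
  rw [h1]
  nlinarith [sq_nonneg (Real.cos w.re * Real.sinh w.im), Real.cosh_sq w.im,
    sq_nonneg (Real.sin w.re * Real.sinh w.im)]

theorem norm_sin_le (w : ℂ) : ‖Complex.sin w‖ ≤ Real.exp |w.im| := by
  rw [Complex.sin, norm_div, norm_mul, Complex.norm_I, mul_one]
  have h1 : ‖Complex.exp (-w * Complex.I)‖ ≤ Real.exp |w.im| := by
    rw [Complex.norm_exp]
    refine Real.exp_le_exp.mpr ?_
    simpa using le_abs_self w.im
  have h2 : ‖Complex.exp (w * Complex.I)‖ ≤ Real.exp |w.im| := by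
    rw [Complex.norm_exp]
    refine Real.exp_le_exp.mpr ?_
    simpa using neg_le_abs w.im
  have h3 := norm_sub_le (Complex.exp (-w * Complex.I)) (Complex.exp (w * Complex.I))
  have h4 : ‖(2 : ℂ)‖ = 2 := by simp
  rw [h4]
  linarith

theorem two_mul_abs_valMinAbs_le {M : ℕ} (hM : Odd M) (l : ZMod M) :
    2 * |(l.valMinAbs : ℝ)| ≤ M - 1 := by
  have : NeZero M := ⟨by rintro rfl; simp at hM⟩
  have h1 := l.natAbs_valMinAbs_le
  obtain ⟨k, hk⟩ := hM
  have h2 : 2 * |l.valMinAbs| ≤ (M : ℤ) - 1 := by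
    rw [Int.abs_eq_natAbs]
    lia
  have h3 : ((2 * |l.valMinAbs| : ℤ) : ℝ) ≤ (((M : ℤ) - 1 : ℤ) : ℝ) := by exact_mod_cast h2
  push_cast at h3
  exact h3

theorem abs_re_add_periodMom_le {M : ℕ} (hM : Odd M) (l : ZMod M) {x : ℝ} (hx : |x| ≤ 4) :
    |x + 2 * Real.pi * l.valMinAbs| ≤ 4 * M := by
  have h1 := two_mul_abs_valMinAbs_le hM l
  have hM1 : (1 : ℝ) ≤ M := by
    obtain ⟨k, hk⟩ := hM
    rw [hk]; push_cast; linarith [Nat.cast_nonneg (α := ℝ) k]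
  refine (abs_add_le _ _).trans ?_
  rw [abs_mul, abs_of_pos (by positivity : 0 < 2 * Real.pi)]
  nlinarith [Real.pi_pos, Real.pi_le_four]

/-- For `|l| ≥ 1` one has `2π|l| - 4 ≥ 6|l| - 4 ≥ 2|l|`. -/
theorem two_mul_le_abs_re_add_periodMom {M : ℕ} {l : ZMod M} (hl : l ≠ 0) {x : ℝ} (hx : |x| ≤ 4) :
    1 ≤ |(l.valMinAbs : ℝ)| ∧ 2 * |(l.valMinAbs : ℝ)| ≤ |x + 2 * Real.pi * l.valMinAbs| := by
  have h0 : l.valMinAbs ≠ 0 := fun h => hl ((ZMod.valMinAbs_eq_zero l).mp h)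
  have h1 : (1 : ℝ) ≤ |(l.valMinAbs : ℝ)| := by exact_mod_cast Int.one_le_abs h0
  refine ⟨h1, ?_⟩
  have h2 := abs_sub_abs_le_abs_sub (2 * Real.pi * (l.valMinAbs : ℝ)) (-x)
  rw [abs_mul, abs_of_pos (by positivity : 0 < 2 * Real.pi), abs_neg, sub_neg_eq_add, add_comm] at h2
  rw [add_comm] at h2 ⊢
  have h3 : 2 * 3 * |(l.valMinAbs : ℝ)| ≤ 2 * Real.pi * |(l.valMinAbs : ℝ)| := by
    have := Real.pi_gt_three
    gcongr
  linarith

/-- In the sine quotient the numerator is at most `2` in the strip and the denominator is at least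
`|Re p| / 8`; for `l ≠ 0`, `|Re p| ≥ 2|l| ≥ 1 + |l|`. For `l = 0` the bound `e` suffices. -/
theorem norm_avgSymb_add_le {b : ℕ} (hb : Odd b) (hb2 : 2 ≤ b) (n : ℕ) {z : ℂ} (hz : |z.re| ≤ 4)
    (hzi : |z.im| ≤ 1) (l : ZMod (b ^ n)) :
    ‖avgSymb b n (z + ((2 * Real.pi * l.valMinAbs : ℝ) : ℂ))‖ ≤ 16 / (1 + |(l.valMinAbs : ℝ)|) := by
  set p := z + ((2 * Real.pi * l.valMinAbs : ℝ) : ℂ) with hp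
  have him : p.im = z.im := by simp [hp]
  have hre : p.re = z.re + 2 * Real.pi * l.valMinAbs := by
    rw [hp, Complex.add_re, Complex.ofReal_re]
  by_cases hl : l = 0
  · have h1 := norm_avgSymb_le b n hb2 p
    rw [him] at h1
    have h2 := Real.exp_le_exp.mpr hzi
    have h3 := Real.exp_one_lt_d9
    rw [hl]
    simp only [ZMod.valMinAbs_zero, Int.cast_zero, abs_zero, add_zero, div_one]
    linarith
  · obtain ⟨h1, h2⟩ := two_mul_le_abs_re_add_periodMom hl hz
    have h3 := abs_re_add_periodMom_le hb.pow l hz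
    rw [← hre] at h2 h3
    have hb0 : (0 : ℝ) < b := by positivity
    have hM0 : (0 : ℝ) < (b : ℝ) ^ n := by positivity
    push_cast at h3
    have hid := mul_avgSymb b n (by lia) p
    have e : p / (2 * (b : ℂ) ^ n) = p / ((2 * (b : ℝ) ^ n : ℝ) : ℂ) := by push_cast; rfl
    have h4 : |p.re| / 8 ≤ ‖(b : ℂ) ^ n * Complex.sin (p / (2 * (b : ℂ) ^ n))‖ := by
      rw [norm_mul, norm_pow, Complex.norm_natCast, e]
      have h5 := norm_sin_ge (p / ((2 * (b : ℝ) ^ n : ℝ) : ℂ))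
      rw [Complex.div_ofReal_re] at h5
      have habs : |p.re / (2 * (b : ℝ) ^ n)| = |p.re| / (2 * (b : ℝ) ^ n) := by
        rw [abs_div, abs_of_pos (by positivity : 0 < 2 * (b : ℝ) ^ n)]
      have h6 := abs_sin_ge_quarter (y := p.re / (2 * (b : ℝ) ^ n)) (by
        rw [habs, div_le_iff₀ (by positivity)]
        linarith)
      rw [habs] at h6
      have h7 := mul_le_mul_of_nonneg_left (h6.trans h5) hM0.le
      refine le_trans (le_of_eq ?_) h7
      field_simp
      ring
    have h5 : ‖Complex.sin (p / 2)‖ ≤ 2 := by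
      refine (norm_sin_le _).trans ?_
      have : (p / 2).im = z.im / 2 := by
        rw [show p / 2 = p / ((2 : ℝ) : ℂ) by push_cast; rfl, Complex.div_ofReal_im, him]
      rw [this, abs_div, abs_two]
      have h6 : Real.exp (|z.im| / 2) ≤ Real.exp (1 / 2) := Real.exp_le_exp.mpr (by linarith)
      have h7 : Real.exp (1 / 2) ≤ 2 := by
        have h8 : Real.exp (1 / 2) ^ 2 = Real.exp 1 := by
          rw [← Real.exp_nat_mul]; norm_num
        nlinarith [Real.exp_one_lt_d9, Real.exp_pos (1 / 2 : ℝ)]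
      linarith
    rw [← hid, norm_mul] at h5
    have h6 := mul_le_mul_of_nonneg_right h4 (norm_nonneg (avgSymb b n p))
    rw [le_div_iff₀ (by positivity)]
    nlinarith [norm_nonneg (avgSymb b n p)]

/-- For nonzero `|x| ≤ 4` the numerator `|sin (x/2)|` is at least `|x| / 8` and the denominator at
most `|x| / 2`. -/
theorem norm_avgSymb_ofReal_ge {b : ℕ} (hb : b ≠ 0) (n : ℕ) {x : ℝ} (hx : |x| ≤ 4) :
    1 / 4 ≤ ‖avgSymb b n x‖ := by
  by_cases h0 : x = 0
  · simp [h0, avgSymb, box_zero hb]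
    norm_num
  · have hid := mul_avgSymb b n hb (x : ℂ)
    have hb0 : (0 : ℝ) < b := by positivity
    have hM0 : (0 : ℝ) < (b : ℝ) ^ n := by positivity
    have e : (x : ℂ) / (2 * (b : ℂ) ^ n) = ((x / (2 * (b : ℝ) ^ n) : ℝ) : ℂ) := by push_cast; rfl
    have e2 : (x : ℂ) / 2 = ((x / 2 : ℝ) : ℂ) := by push_cast; rfl
    rw [e, e2, ← Complex.ofReal_sin, ← Complex.ofReal_sin] at hid
    have h1 := congrArg norm hid
    rw [norm_mul, norm_mul, norm_pow, Complex.norm_natCast, Complex.norm_real, Complex.norm_real,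
      Real.norm_eq_abs, Real.norm_eq_abs] at h1
    have h2 := abs_sin_ge_quarter (y := x / 2) (by rw [abs_div, abs_two]; linarith)
    have h3 : |Real.sin (x / (2 * (b : ℝ) ^ n))| ≤ |x| / (2 * (b : ℝ) ^ n) := by
      refine Real.abs_sin_le_abs.trans (le_of_eq ?_)
      rw [abs_div, abs_of_pos (by positivity : 0 < 2 * (b : ℝ) ^ n)]
    have h4 : (b : ℝ) ^ n * |Real.sin (x / (2 * (b : ℝ) ^ n))| ≤ |x| / 2 := by
      refine (mul_le_mul_of_nonneg_left h3 hM0.le).trans (le_of_eq ?_)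
      field_simp
    have h5 := mul_le_mul_of_nonneg_right h4 (norm_nonneg (avgSymb b n x))
    rw [h1] at h5
    rw [abs_div, abs_two] at h2
    have hx0 : 0 < |x| := abs_pos.mpr h0
    by_contra hlt
    nlinarith

/-- The bound on sums of averaging symbols over a period box. -/
noncomputable def volBound (q : ℕ) : ℝ := ((16 : ℝ) ^ (2 * q) * ∑' y : ℤ, (1 / (1 + |(y : ℝ)|) ^ 2)) ^ 4

theorem summable_one_div_one_add_abs_sq : Summable fun y : ℤ => 1 / (1 + |(y : ℝ)|) ^ 2 := by
  have h : Summable fun k : ℕ => 1 / (1 + (k : ℝ)) ^ 2 := by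
    have h1 := (summable_nat_add_iff 1).mpr (Real.summable_one_div_nat_pow.mpr one_lt_two)
    refine h1.congr fun k => ?_
    push_cast
    rw [add_comm]
  exact Summable.of_nat_of_neg (by simpa using h) (by simpa using h)

theorem volBound_nonneg (q : ℕ) : 0 ≤ volBound q := by
  unfold volBound
  positivity

theorem two_le_blockLen {L : ℕ} (hL : 2 ≤ L) (ν : Fin 4) : 2 ≤ blockLen L ν := by
  unfold blockLen
  split_ifs
  · nlinarith
  · exact hL

/-- The sum factors over directions, and an exponent of at least `2` in each makes the
one-dimensional sums converge uniformly in the period. -/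
theorem sum_norm_volSymb_le {L : ℕ} [NeZero L] (hL : Odd L) (hL2 : 2 ≤ L) (n : ℕ) {q : ℕ}
    {e : Fin 4 → ℕ} (he2 : ∀ ν, 2 ≤ e ν) (heq : ∀ ν, e ν ≤ 2 * q) {z : Fin 4 → ℂ}
    (hz : ∀ ν, |(z ν).re| ≤ 4) (hzi : ∀ ν, |(z ν).im| ≤ 1) :
    ∑ l : Period L n, ‖volSymb L n e fun ν => z ν + (periodMom l ν : ℂ)‖ ≤ volBound q := by
  have h1 : ∀ l : Period L n, ‖volSymb L n e fun ν => z ν + (periodMom l ν : ℂ)‖ ≤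
      ∏ ν, (16 : ℝ) ^ (2 * q) * (1 / (1 + |((l ν).valMinAbs : ℝ)|) ^ 2) := by
    intro l
    rw [volSymb, norm_prod]
    refine Finset.prod_le_prod (fun _ _ => norm_nonneg _) fun ν _ => ?_
    rw [norm_pow]
    have h2 := norm_avgSymb_add_le (odd_blockLen hL ν) (two_le_blockLen hL2 ν) n (hz ν) (hzi ν) (l ν)
    refine (pow_le_pow_left₀ (norm_nonneg _) h2 _).trans ?_
    rw [div_pow, div_eq_mul_one_div]
    refine mul_le_mul (pow_le_pow_right₀ (by norm_num) (heq ν)) ?_ (by positivity) (by positivity)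
    refine one_div_le_one_div_of_le (by positivity) (pow_le_pow_right₀ ?_ (he2 ν))
    linarith [abs_nonneg ((l ν).valMinAbs : ℝ)]
  refine (Finset.sum_le_sum fun l _ => h1 l).trans ?_
  have h2 := Finset.prod_univ_sum (fun ν => (Finset.univ : Finset (ZMod (blockLen L ν ^ n))))
    fun ν (x : ZMod (blockLen L ν ^ n)) => (16 : ℝ) ^ (2 * q) * (1 / (1 + |(x.valMinAbs : ℝ)|) ^ 2)
  rw [Fintype.piFinset_univ] at h2
  rw [← h2, volBound]
  refine (Finset.prod_le_prod (fun _ _ => Finset.sum_nonneg fun _ _ => by positivity)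
    fun ν _ => ?_ : _ ≤ ∏ _ν : Fin 4, (16 : ℝ) ^ (2 * q) * ∑' y : ℤ, (1 / (1 + |(y : ℝ)|) ^ 2)).trans
    (by simp)
  rw [← Finset.mul_sum]
  refine mul_le_mul_of_nonneg_left ?_ (by positivity)
  have h3 := summable_one_div_one_add_abs_sq.sum_le_tsum
    (Finset.univ.map ⟨ZMod.valMinAbs (n := blockLen L ν ^ n), ZMod.injective_valMinAbs⟩)
    fun _ _ => by positivity
  rwa [Finset.sum_map] at h3

end BlockSpin

namespace BlockSpin

/-! ### Dispersion relations -/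

/-- The momentum `z + ℓ`. -/
noncomputable def shiftMom {L n : ℕ} (l : Period L n) (z : Fin 4 → ℂ) : Fin 4 → ℂ :=
  fun ν => z ν + (periodMom l ν : ℂ)

/-- The properties of the symbols of `D_n` and `D_n^*` that are uniform in the scale. -/
structure IsDispersion (C c m : ℝ) (L n : ℕ) (D : (Fin 4 → ℂ) → ℂ) : Prop where
  differentiable : Differentiable ℂ D
  hasPeriods : HasPeriods L n D
  re_nonneg : ∀ p : Fin 4 → ℝ, 0 ≤ (D fun ν => (p ν : ℂ)).re
  norm_le : ∀ z : Fin 4 → ℂ, (∀ ν, ‖z ν‖ ≤ 5) → ‖D z‖ ≤ C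
  le_norm : ∀ z : Fin 4 → ℂ, (∀ ν, |(z ν).re| ≤ 4 * (blockLen L ν : ℝ) ^ n) →
    (∀ ν, |(z ν).im| ≤ m) → (∃ ν, 2 ≤ |(z ν).re|) → c ≤ ‖D z‖

/-- Reflection passes to the symbol of the adjoint, so every estimate covers `D_n` and `D_n^*`
alike. -/
theorem IsDispersion.neg {C c m : ℝ} {L n : ℕ} [NeZero L] {D : (Fin 4 → ℂ) → ℂ}
    (h : IsDispersion C c m L n D) : IsDispersion C c m L n fun z => D (-z) where
  differentiable := h.differentiable.comp (f := fun z : Fin 4 → ℂ => -z) differentiable_id.neg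
  hasPeriods := h.hasPeriods.neg
  re_nonneg p := by
    have := h.re_nonneg (-p)
    simpa [Pi.neg_def] using this
  norm_le z hz := h.norm_le _ fun ν => by simpa using hz ν
  le_norm z hz hzi := by
    rintro ⟨ν, hν⟩
    refine h.le_norm _ (fun ν => ?_) (fun ν => ?_) ⟨ν, ?_⟩
    · simpa using hz ν
    · simpa using hzi ν
    · simpa using hν

theorem IsKineticOperator.exists_isDispersion {h : (Fin 3 → ℤ) → ℂ} {hhat : (Fin 3 → ℂ) → ℂ}
    (hh : IsKineticOperator h hhat) : ∃ C c m : ℝ, 0 < C ∧ 0 < c ∧ c ≤ 1 ∧ 0 < m ∧ m ≤ 1 / 2 ∧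
      ∀ (L n : ℕ) [NeZero L], IsDispersion C c m L n (kinSymb L n hhat) := by
  obtain ⟨C, hC, hle⟩ := hh.exists_norm_kinSymb_le
  obtain ⟨c, m, hc, hm, -, hge⟩ := hh.exists_norm_kinSymb_ge
  refine ⟨C, min c 1, min m (1 / 2), hC, by positivity, min_le_right _ _, by positivity,
    min_le_right _ _, fun L n _ => ?_⟩
  have hL : 1 ≤ L := NeZero.one_le
  exact ⟨differentiable_kinSymb hh L n, hasPeriods_kinSymb hh n, hh.kinSymb_re_nonneg L n,
    hle L n hL, fun z hz hzi hex => (min_le_left _ _).trans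
      (hge L n hL z hz (fun ν => (hzi ν).trans (min_le_left _ _)) hex)⟩

/-- Since `hhat` is even and real on real momenta, reflection is complex conjugation there. This
turns the bilinear products `D E` into squared moduli. -/
theorem kinSymb_neg_ofReal {h : (Fin 3 → ℤ) → ℂ} {hhat : (Fin 3 → ℂ) → ℂ}
    (hh : IsKineticOperator h hhat) (L n : ℕ) (p : Fin 4 → ℝ) :
    kinSymb L n hhat (-fun ν => (p ν : ℂ)) =
      (starRingEnd ℂ) (kinSymb L n hhat fun ν => (p ν : ℂ)) := by
  have e : (fun ν : Fin 3 => (p ν.succ : ℂ) / (L : ℂ) ^ n) =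
      toC fun ν => p ν.succ / (L : ℝ) ^ n := by
    funext ν; simp [toC]
  have e' : (fun ν : Fin 3 => (-fun ν => (p ν : ℂ)) ν.succ / (L : ℂ) ^ n) =
      -toC fun ν => p ν.succ / (L : ℝ) ^ n := by
    funext ν; simp [toC, neg_div]
  simp only [kinSymb]
  rw [e, e', hh.neg, hh.eq_ofReal]
  simp only [map_mul, map_sub, map_one, map_pow, map_natCast, ← Complex.exp_conj, map_add, map_neg,
    Complex.conj_ofReal, Complex.conj_I, map_div₀, Pi.neg_apply]
  congr 4
  ring

section

variable {C c m : ℝ} {L n : ℕ} [NeZero L] {D : (Fin 4 → ℂ) → ℂ} {z : Fin 4 → ℂ}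

/-- The second alternative in `hl` allows `ℓ = 0` near the edge of the momentum zone, where
periodicity has to be checked. -/
theorem IsDispersion.le_norm_shiftMom (h : IsDispersion C c m L n D) (hL : Odd L)
    (hz : ∀ ν, |(z ν).re| ≤ 4) (hzi : ∀ ν, |(z ν).im| ≤ m) {l : Period L n}
    (hl : l ≠ 0 ∨ ∃ ν, 2 ≤ |(z ν).re|) : c ≤ ‖D (shiftMom l z)‖ := by
  have hre : ∀ ν, (shiftMom l z ν).re = (z ν).re + 2 * Real.pi * (l ν).valMinAbs := fun ν => by
    rw [shiftMom, Complex.add_re, Complex.ofReal_re, periodMom]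
  refine h.le_norm _ (fun ν => ?_) (fun ν => ?_) ?_
  · rw [hre]
    have := abs_re_add_periodMom_le (odd_blockLen hL ν).pow (l ν) (hz ν)
    push_cast at this
    exact this
  · simpa [shiftMom] using hzi ν
  · by_cases hl0 : l = 0
    · obtain ⟨ν, hν⟩ := hl.resolve_left (not_not.mpr hl0)
      refine ⟨ν, ?_⟩
      rw [hre, hl0]
      simpa using hν
    · obtain ⟨ν, hν⟩ := Function.ne_iff.mp hl0
      refine ⟨ν, ?_⟩
      rw [hre]
      obtain ⟨h1, h2⟩ := two_mul_le_abs_re_add_periodMom hν (hz ν)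
      linarith

theorem IsDispersion.half_le_norm_sub (h : IsDispersion C c m L n D) (hL : Odd L)
    (hz : ∀ ν, |(z ν).re| ≤ 4) (hzi : ∀ ν, |(z ν).im| ≤ m) {l : Period L n}
    (hl : l ≠ 0 ∨ ∃ ν, 2 ≤ |(z ν).re|) {μ : ℂ} (hμ : ‖μ‖ ≤ c / 2) :
    c / 2 ≤ ‖D (shiftMom l z) - μ‖ := by
  have h1 := h.le_norm_shiftMom hL hz hzi hl
  have h2 := norm_sub_norm_le (D (shiftMom l z)) μ
  linarith

theorem IsDispersion.norm_sub_le (h : IsDispersion C c m L n D)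
    (hz : ∀ ν, |(z ν).re| ≤ 4) (hzi : ∀ ν, |(z ν).im| ≤ m) (hm : m ≤ 1 / 2) (hc : c ≤ 1) {μ : ℂ}
    (hμ : ‖μ‖ ≤ c / 2) : ‖D z - μ‖ ≤ C + 1 := by
  have h1 := h.norm_le z fun ν => by
    have := Complex.norm_le_abs_re_add_abs_im (z ν)
    linarith [hz ν, hzi ν]
  have h2 := _root_.norm_sub_le (D z) μ
  linarith

end

/-! ### The symbols of the inverse Gram operators -/

/-- The symbol of `1 + ∑ L^(-2j) Q_j Q_j^*`. -/
noncomputable def fqSymb (L q n : ℕ) [NeZero L] (z : Fin 4 → ℂ) : ℂ :=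
  1 + ∑ j ∈ Finset.Ico 1 n, ((L : ℂ) ^ (2 * j))⁻¹ *
    ∑ l : Period L j, volSymb L j (fun _ => 2 * q) (shiftMom l z)

/-- The secular function of a Green's function. -/
noncomputable def greenDen (L q n : ℕ) [NeZero L] (a : ℝ) (D : (Fin 4 → ℂ) → ℂ) (μ : ℂ)
    (z : Fin 4 → ℂ) : ℂ :=
  fqSymb L q n z * (D z - μ) + a * (volSymb L n (fun _ => 2 * q) z +
    (D z - μ) * ∑ l ∈ Finset.univ.erase (0 : Period L n),
      volSymb L n (fun _ => 2 * q) (shiftMom l z) / (D (shiftMom l z) - μ))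

/-- The numerator of the symbol of a Gram operator. -/
noncomputable def greenNum (L n : ℕ) [NeZero L] (e : Fin 4 → ℕ) (D E : (Fin 4 → ℂ) → ℂ) (μ : ℂ)
    (z : Fin 4 → ℂ) : ℂ :=
  volSymb L n e z + (D z - μ) * (E z - μ) * ∑ l ∈ Finset.univ.erase (0 : Period L n),
    volSymb L n e (shiftMom l z) / ((D (shiftMom l z) - μ) * (E (shiftMom l z) - μ))

/-- The symbol of the inverse of a Gram operator. -/
noncomputable def gramInv (L q n : ℕ) [NeZero L] (a : ℝ) (e : Fin 4 → ℕ) (D E : (Fin 4 → ℂ) → ℂ)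
    (μ : ℂ) (z : Fin 4 → ℂ) : ℂ :=
  greenDen L q n a D μ z * greenDen L q n a E μ z / ((a : ℂ) ^ 2 * greenNum L n e D E μ z)

theorem differentiable_volSymb (L n : ℕ) (e : Fin 4 → ℕ) : Differentiable ℂ (volSymb L n e) := by
  unfold volSymb
  simp only [Fin.prod_univ_four]
  have h : ∀ ν, Differentiable ℂ fun z : Fin 4 → ℂ => avgSymb (blockLen L ν) n (z ν) ^ e ν :=
    fun ν => ((differentiable_avgSymb (blockLen L ν) n).comp (differentiable_apply ν)).pow _
  exact (((h 0).mul (h 1)).mul (h 2)).mul (h 3)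

section

variable {L n : ℕ} [NeZero L] {D E : (Fin 4 → ℂ) → ℂ} {M : ℂ → ℂ} {Z : ℂ → Fin 4 → ℂ} {τ : ℂ}

theorem differentiableAt_comp_shiftMom {Φ : (Fin 4 → ℂ) → ℂ} (hΦ : Differentiable ℂ Φ)
    (hZ : DifferentiableAt ℂ Z τ) (l : Period L n) :
    DifferentiableAt ℂ (fun t => Φ (shiftMom l (Z t))) τ :=
  (hΦ _).comp τ (hZ.add_const (fun ν => (periodMom l ν : ℂ)))

theorem differentiableAt_fqSymb (q : ℕ) (hZ : DifferentiableAt ℂ Z τ) :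
    DifferentiableAt ℂ (fun t => fqSymb L q n (Z t)) τ := by
  unfold fqSymb
  refine (DifferentiableAt.fun_sum fun j _ => ?_).const_add _
  refine (DifferentiableAt.fun_sum fun l _ => ?_).const_mul _
  exact differentiableAt_comp_shiftMom (differentiable_volSymb L j _) hZ l

theorem differentiableAt_greenDen (q : ℕ) (a : ℝ) (hD : Differentiable ℂ D)
    (hZ : DifferentiableAt ℂ Z τ) (hM : DifferentiableAt ℂ M τ)
    (hne : ∀ l : Period L n, l ≠ 0 → D (shiftMom l (Z τ)) - M τ ≠ 0) :
    DifferentiableAt ℂ (fun t => greenDen L q n a D (M t) (Z t)) τ := by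
  unfold greenDen
  have h1 : DifferentiableAt ℂ (fun t => D (Z t) - M t) τ := ((hD _).comp τ hZ).sub hM
  refine ((differentiableAt_fqSymb q hZ).mul h1).add (DifferentiableAt.const_mul ?_ _)
  refine ((differentiable_volSymb L n _ _).comp τ hZ).add (h1.mul ?_)
  refine DifferentiableAt.fun_sum fun l hl => ?_
  exact (differentiableAt_comp_shiftMom (differentiable_volSymb L n _) hZ l).fun_div
    ((differentiableAt_comp_shiftMom hD hZ l).sub hM) (hne l (Finset.ne_of_mem_erase hl))

theorem differentiableAt_greenNum (e : Fin 4 → ℕ) (hD : Differentiable ℂ D)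
    (hE : Differentiable ℂ E) (hZ : DifferentiableAt ℂ Z τ) (hM : DifferentiableAt ℂ M τ)
    (hne : ∀ l : Period L n, l ≠ 0 → D (shiftMom l (Z τ)) - M τ ≠ 0)
    (hne' : ∀ l : Period L n, l ≠ 0 → E (shiftMom l (Z τ)) - M τ ≠ 0) :
    DifferentiableAt ℂ (fun t => greenNum L n e D E (M t) (Z t)) τ := by
  unfold greenNum
  have h1 : DifferentiableAt ℂ (fun t => D (Z t) - M t) τ := ((hD _).comp τ hZ).sub hM
  have h2 : DifferentiableAt ℂ (fun t => E (Z t) - M t) τ := ((hE _).comp τ hZ).sub hM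
  refine ((differentiable_volSymb L n _ _).comp τ hZ).add ((h1.mul h2).mul ?_)
  refine DifferentiableAt.fun_sum fun l hl => ?_
  have hl0 := Finset.ne_of_mem_erase hl
  exact (differentiableAt_comp_shiftMom (differentiable_volSymb L n _) hZ l).fun_div
    (((differentiableAt_comp_shiftMom hD hZ l).sub hM).mul
      ((differentiableAt_comp_shiftMom hE hZ l).sub hM)) (mul_ne_zero (hne l hl0) (hne' l hl0))

end

theorem norm_sum_div_le {ι : Type*} [Fintype ι] (s : Finset ι) {v d : ι → ℂ} {V δ : ℝ} (hδ : 0 < δ)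
    (hv : ∑ i, ‖v i‖ ≤ V) (hd : ∀ i ∈ s, δ ≤ ‖d i‖) : ‖∑ i ∈ s, v i / d i‖ ≤ V / δ := by
  refine (norm_sum_le_of_le s (n := fun i => ‖v i‖ / δ) fun i hi => ?_).trans ?_
  · rw [norm_div]
    exact div_le_div_of_nonneg_left (norm_nonneg _) hδ (hd i hi)
  · rw [← Finset.sum_div]
    gcongr
    exact (Finset.sum_le_univ_sum_of_nonneg fun i => norm_nonneg _).trans hv

theorem sum_inv_pow_le_one {L : ℕ} (hL : 2 ≤ L) (n : ℕ) :
    ∑ j ∈ Finset.Ico 1 n, ((L : ℝ) ^ (2 * j))⁻¹ ≤ 1 := by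
  have h1 : ∀ j ∈ Finset.Ico 1 n, ((L : ℝ) ^ (2 * j))⁻¹ ≤ (1 / 2) ^ j := fun j _ => by
    rw [one_div, inv_pow]
    refine inv_anti₀ (by positivity) ?_
    have hL' : (2 : ℝ) ≤ L := by exact_mod_cast hL
    calc (2 : ℝ) ^ j ≤ (L : ℝ) ^ j := pow_le_pow_left₀ (by norm_num) hL' j
      _ ≤ (L : ℝ) ^ (2 * j) := pow_le_pow_right₀ (by linarith) (by lia)
  refine (Finset.sum_le_sum h1).trans ?_
  rw [Finset.sum_Ico_eq_sum_range]
  simp only [pow_add, ← Finset.mul_sum]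
  have := sum_geometric_two_le (n - 1)
  linarith

section

variable {C c m : ℝ} {L n q : ℕ} [NeZero L] {e : Fin 4 → ℕ} {D E : (Fin 4 → ℂ) → ℂ}
  {z : Fin 4 → ℂ} {μ : ℂ}

theorem sum_norm_volSymb_shiftMom_le (hL : Odd L) (hL2 : 2 ≤ L) (n : ℕ)
    (he2 : ∀ ν, 2 ≤ e ν) (heq : ∀ ν, e ν ≤ 2 * q)
    (hz : ∀ ν, |(z ν).re| ≤ 4) (hzi : ∀ ν, |(z ν).im| ≤ m) (hm : m ≤ 1 / 2) :
    ∑ l : Period L n, ‖volSymb L n e (shiftMom l z)‖ ≤ volBound q :=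
  sum_norm_volSymb_le hL hL2 n he2 heq hz fun ν => (hzi ν).trans (by linarith)

theorem shiftMom_zero (z : Fin 4 → ℂ) : shiftMom (0 : Period L n) z = z := by
  funext ν; simp [shiftMom, periodMom]

theorem norm_volSymb_le (hL : Odd L) (hL2 : 2 ≤ L) (n : ℕ)
    (he2 : ∀ ν, 2 ≤ e ν) (heq : ∀ ν, e ν ≤ 2 * q)
    (hz : ∀ ν, |(z ν).re| ≤ 4) (hzi : ∀ ν, |(z ν).im| ≤ m) (hm : m ≤ 1 / 2) :
    ‖volSymb L n e z‖ ≤ volBound q := by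
  refine le_trans ?_ (sum_norm_volSymb_shiftMom_le hL hL2 n he2 heq hz hzi hm)
  have := Finset.single_le_sum (f := fun l : Period L n => ‖volSymb L n e (shiftMom l z)‖)
    (fun _ _ => norm_nonneg _) (Finset.mem_univ 0)
  simpa only [shiftMom_zero] using this

theorem norm_fqSymb_le (hL : Odd L) (hL2 : 2 ≤ L) (hq : 1 ≤ q) (n : ℕ)
    (hz : ∀ ν, |(z ν).re| ≤ 4) (hzi : ∀ ν, |(z ν).im| ≤ m) (hm : m ≤ 1 / 2) :
    ‖fqSymb L q n z‖ ≤ 1 + volBound q := by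
  refine (norm_add_le _ _).trans ?_
  rw [norm_one]
  gcongr
  refine (norm_sum_le_of_le _ (n := fun j => ((L : ℝ) ^ (2 * j))⁻¹ * volBound q)
    fun j _ => ?_).trans ?_
  · rw [norm_mul, norm_inv, norm_pow, Complex.norm_natCast]
    gcongr
    exact (norm_sum_le _ _).trans (sum_norm_volSymb_shiftMom_le hL hL2 j (fun _ => by lia)
      (fun _ => le_rfl) hz hzi hm)
  · rw [← Finset.sum_mul]
    exact mul_le_of_le_one_left (volBound_nonneg q) (sum_inv_pow_le_one hL2 n)

/-- The bound on the secular function. -/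
noncomputable def denBound (C c a : ℝ) (q : ℕ) : ℝ :=
  (1 + volBound q) * (C + 1) + a * (volBound q + (C + 1) * (volBound q / (c / 2)))

/-- The bound on the numerator of the Gram symbol. -/
noncomputable def numBound (C c : ℝ) (q : ℕ) : ℝ :=
  volBound q + (C + 1) * (C + 1) * (volBound q / (c / 2 * (c / 2)))

theorem norm_greenDen_le (hD : IsDispersion C c m L n D) {a : ℝ} (ha : 0 < a) (hL : Odd L)
    (hL2 : 2 ≤ L) (hq : 1 ≤ q) (hC : 0 < C) (hc : 0 < c) (hc1 : c ≤ 1)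
    (hz : ∀ ν, |(z ν).re| ≤ 4) (hzi : ∀ ν, |(z ν).im| ≤ m) (hm : m ≤ 1 / 2) (hμ : ‖μ‖ ≤ c / 2) :
    ‖greenDen L q n a D μ z‖ ≤ denBound C c a q := by
  have hV := volBound_nonneg q
  have h0 := hD.norm_sub_le hz hzi hm hc1 hμ
  have h1 := norm_fqSymb_le hL hL2 hq n hz hzi hm
  have h2 := norm_volSymb_le (e := fun _ => 2 * q) hL hL2 n (fun _ => by lia) (fun _ => le_rfl)
    hz hzi hm
  have h3 := norm_sum_div_le (Finset.univ.erase (0 : Period L n)) (half_pos hc)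
    (sum_norm_volSymb_shiftMom_le (e := fun _ => 2 * q) hL hL2 n (fun _ => by lia)
      (fun _ => le_rfl) hz hzi hm)
    fun l hl => hD.half_le_norm_sub hL hz hzi (.inl (Finset.ne_of_mem_erase hl)) hμ
  unfold greenDen denBound
  refine (norm_add_le _ _).trans (add_le_add ?_ ?_)
  · rw [norm_mul]
    exact mul_le_mul h1 h0 (norm_nonneg _) (by positivity)
  · rw [norm_mul, Complex.norm_real, Real.norm_of_nonneg ha.le]
    refine mul_le_mul_of_nonneg_left ((norm_add_le _ _).trans (add_le_add h2 ?_)) ha.le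
    rw [norm_mul]
    exact mul_le_mul h0 h3 (norm_nonneg _) (by positivity)

theorem norm_greenNum_le (hD : IsDispersion C c m L n D) (hE : IsDispersion C c m L n E)
    (hL : Odd L) (hL2 : 2 ≤ L) (he2 : ∀ ν, 2 ≤ e ν) (heq : ∀ ν, e ν ≤ 2 * q) (hC : 0 < C)
    (hc : 0 < c) (hc1 : c ≤ 1) (hz : ∀ ν, |(z ν).re| ≤ 4) (hzi : ∀ ν, |(z ν).im| ≤ m)
    (hm : m ≤ 1 / 2) (hμ : ‖μ‖ ≤ c / 2) :
    ‖greenNum L n e D E μ z‖ ≤ numBound C c q := by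
  have hV := volBound_nonneg q
  have h0 := hD.norm_sub_le hz hzi hm hc1 hμ
  have h0' := hE.norm_sub_le hz hzi hm hc1 hμ
  have h2 := norm_volSymb_le hL hL2 n he2 heq hz hzi hm
  have h3 := norm_sum_div_le (Finset.univ.erase (0 : Period L n))
    (mul_pos (half_pos hc) (half_pos hc))
    (sum_norm_volSymb_shiftMom_le hL hL2 n he2 heq hz hzi hm)
    (d := fun l => (D (shiftMom l z) - μ) * (E (shiftMom l z) - μ)) fun l hl => by
      rw [norm_mul]
      exact mul_le_mul
        (hD.half_le_norm_sub hL hz hzi (.inl (Finset.ne_of_mem_erase hl)) hμ)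
        (hE.half_le_norm_sub hL hz hzi (.inl (Finset.ne_of_mem_erase hl)) hμ)
        (half_pos hc).le (norm_nonneg _)
  unfold greenNum numBound
  refine (norm_add_le _ _).trans (add_le_add h2 ?_)
  rw [norm_mul, norm_mul]
  exact mul_le_mul (mul_le_mul h0 h0' (norm_nonneg _) (by positivity)) h3 (norm_nonneg _)
    (by positivity)

end

/-! ### Lower bounds at real momenta -/

section

variable {C c m : ℝ} {L n q : ℕ} [NeZero L] {e : Fin 4 → ℕ} {D E : (Fin 4 → ℂ) → ℂ}

theorem shiftMom_ofReal (l : Period L n) (p : Fin 4 → ℝ) :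
    shiftMom l (fun ν => (p ν : ℂ)) = fun ν => ((p ν + periodMom l ν : ℝ) : ℂ) := by
  funext ν; simp [shiftMom]

theorem exists_volSymb_ofReal (hL : Odd L) (n : ℕ) (he : ∀ ν, Even (e ν)) (p : Fin 4 → ℝ) :
    ∃ r : ℝ, 0 ≤ r ∧ volSymb L n e (fun ν => (p ν : ℂ)) = r :=
  ⟨∏ ν, sinRatio (blockLen L ν ^ n) (p ν) ^ e ν, Finset.prod_nonneg fun ν _ => (he ν).pow_nonneg _,
    by rw [volSymb_ofReal hL]; push_cast; rfl⟩

theorem norm_volSymb_ofReal_ge (n : ℕ) (heq : ∀ ν, e ν ≤ 2 * q) {p : Fin 4 → ℝ}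
    (hp : ∀ ν, |p ν| ≤ 4) : ((1 / 4) ^ (2 * q)) ^ 4 ≤ ‖volSymb L n e fun ν => (p ν : ℂ)‖ := by
  rw [volSymb, norm_prod]
  have h1 : ∏ _ν : Fin 4, ((1 / 4 : ℝ) ^ (2 * q)) ≤ ∏ ν, ‖avgSymb (blockLen L ν) n (p ν) ^ e ν‖ := by
    refine Finset.prod_le_prod (fun _ _ => by positivity) fun ν _ => ?_
    rw [norm_pow]
    refine le_trans ?_ (pow_le_pow_left₀ (by norm_num)
      (norm_avgSymb_ofReal_ge (NeZero.ne (blockLen L ν)) n (hp ν)) _)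
    exact pow_le_pow_of_le_one (by norm_num) (by norm_num) (heq ν)
  simpa using h1

theorem exists_fqSymb_ofReal (hL : Odd L) (q n : ℕ) (p : Fin 4 → ℝ) :
    ∃ r : ℝ, 1 ≤ r ∧ fqSymb L q n (fun ν => (p ν : ℂ)) = r := by
  have h1 : ∀ j, ∀ l : Period L j, ∃ r : ℝ, 0 ≤ r ∧
      volSymb L j (fun _ => 2 * q) (shiftMom l fun ν => (p ν : ℂ)) = r := fun j l => by
    rw [shiftMom_ofReal]
    exact exists_volSymb_ofReal hL j (fun _ => even_two_mul q) _
  choose r hr0 hr using h1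
  refine ⟨1 + ∑ j ∈ Finset.Ico 1 n, ((L : ℝ) ^ (2 * j))⁻¹ * ∑ l : Period L j, r j l, ?_, ?_⟩
  · refine le_add_of_nonneg_right (Finset.sum_nonneg fun j _ => ?_)
    exact mul_nonneg (by positivity) (Finset.sum_nonneg fun l _ => hr0 j l)
  · simp only [fqSymb, hr]
    push_cast
    rfl

theorem re_div_nonneg {r : ℝ} (hr : 0 ≤ r) {w : ℂ} (hw : 0 ≤ w.re) : 0 ≤ ((r : ℂ) / w).re := by
  rw [div_eq_mul_inv, Complex.re_ofReal_mul, Complex.inv_re]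
  exact mul_nonneg hr (div_nonneg hw (Complex.normSq_nonneg w))

/-- The lower bound on the secular function at real momenta. -/
noncomputable def denLower (c a : ℝ) (q : ℕ) : ℝ :=
  a * ((1 / 4) ^ (2 * q)) ^ 4 / (2 + volBound q + a * (volBound q / c))

/-- Two bounds are combined: `greenDen` dominates `‖D z‖`, and it differs from the averaging term,
which is bounded below, by at most a constant times `‖D z‖`. Eliminating `‖D z‖` gives `denLower`.
-/
theorem le_norm_greenDen_ofReal (hD : IsDispersion C c m L n D) {a : ℝ} (ha : 0 < a) (hL : Odd L)
    (hL2 : 2 ≤ L) (hq : 1 ≤ q) (hc : 0 < c) (hm0 : 0 ≤ m) {p : Fin 4 → ℝ} (hp : ∀ ν, |p ν| ≤ 4) :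
    denLower c a q ≤ ‖greenDen L q n a D 0 fun ν => (p ν : ℂ)‖ := by
  set z : Fin 4 → ℂ := fun ν => (p ν : ℂ) with hzdef
  have hz : ∀ ν, |(z ν).re| ≤ 4 := fun ν => by simpa [hzdef] using hp ν
  have hzi : ∀ ν, |(z ν).im| ≤ 0 := fun ν => by simp [hzdef]
  have hV := volBound_nonneg q
  obtain ⟨f, hf1, hf⟩ := exists_fqSymb_ofReal hL q n p
  have h1 := norm_fqSymb_le hL hL2 hq n hz hzi (by norm_num)
  set v : Period L n → ℂ := fun l => volSymb L n (fun _ => 2 * q) (shiftMom l z) with hv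
  set d : Period L n → ℂ := fun l => D (shiftMom l z) with hd
  have h3 : ‖∑ l ∈ Finset.univ.erase (0 : Period L n), v l / d l‖ ≤ volBound q / c :=
    norm_sum_div_le _ hc
    (sum_norm_volSymb_shiftMom_le (e := fun _ => 2 * q) hL hL2 n (fun _ => by lia)
      (fun _ => le_rfl) hz hzi (by norm_num))
    fun l hl => hD.le_norm_shiftMom hL hz (fun ν => (hzi ν).trans hm0)
      (.inl (Finset.ne_of_mem_erase hl))
  have h4 : ((1 / 4) ^ (2 * q)) ^ 4 ≤ ‖volSymb L n (fun _ => 2 * q) z‖ :=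
    norm_volSymb_ofReal_ge n (fun _ => le_rfl) hp
  set T := ∑ l ∈ Finset.univ.erase (0 : Period L n), v l / d l with hT
  have hA : greenDen L q n a D 0 z = fqSymb L q n z * D z +
      a * (volSymb L n (fun _ => 2 * q) z + D z * T) := by
    simp only [greenDen, sub_zero, hT, hv, hd]
  have hre : ∀ l, 0 ≤ (v l / d l).re := fun l => by
    obtain ⟨r, hr0, hr⟩ := exists_volSymb_ofReal (e := fun _ => 2 * q) hL n
      (fun _ => even_two_mul q) fun ν => p ν + periodMom l ν
    simp only [hv, hd, hzdef, shiftMom_ofReal, hr]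
    exact re_div_nonneg hr0 (hD.re_nonneg _)
  have hlow : ‖D z‖ ≤ ‖greenDen L q n a D 0 z‖ := by
    by_cases h0 : D z = 0
    · rw [h0, norm_zero]; exact norm_nonneg _
    have h5 : greenDen L q n a D 0 z = D z * (f + a * (v 0 / d 0 + T)) := by
      rw [hA, hf]
      simp only [hv, hd, shiftMom_zero]
      field_simp
    -- Here `f ≥ 1`, and every `v / d` has nonnegative real part because `v ≥ 0` and `Re d ≥ 0`.
    have h6 : 1 ≤ ‖(f : ℂ) + a * (v 0 / d 0 + T)‖ := by
      refine le_trans ?_ (Complex.re_le_norm _)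
      rw [Complex.add_re, Complex.ofReal_re, Complex.re_ofReal_mul, Complex.add_re, hT,
        Complex.re_sum]
      have := mul_nonneg ha.le (add_nonneg (hre 0) (Finset.sum_nonneg
        fun (l : Period L n) (_ : l ∈ Finset.univ.erase (0 : Period L n)) => hre l))
      linarith
    rw [h5, norm_mul]
    exact le_mul_of_one_le_right (norm_nonneg _) h6
  have hup : a * ((1 / 4) ^ (2 * q)) ^ 4 ≤ ‖greenDen L q n a D 0 z‖ +
      ‖D z‖ * (1 + volBound q + a * (volBound q / c)) := by
    have h5 : (a : ℂ) * volSymb L n (fun _ => 2 * q) z =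
        greenDen L q n a D 0 z - D z * (fqSymb L q n z + a * T) := by rw [hA]; ring
    have h6 := congrArg norm h5
    rw [norm_mul, Complex.norm_real, Real.norm_of_nonneg ha.le] at h6
    have h7 : ‖fqSymb L q n z + a * T‖ ≤ 1 + volBound q + a * (volBound q / c) := by
      refine (norm_add_le _ _).trans (add_le_add h1 ?_)
      rw [norm_mul, Complex.norm_real, Real.norm_of_nonneg ha.le]
      gcongr
    calc _ ≤ a * ‖volSymb L n (fun _ => 2 * q) z‖ := by gcongr
      _ ≤ _ := by
        rw [h6]
        refine (_root_.norm_sub_le _ _).trans ?_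
        rw [norm_mul]
        gcongr
  rw [denLower, div_le_iff₀ (by positivity)]
  have hK : 0 ≤ 1 + volBound q + a * (volBound q / c) := by positivity
  have := mul_le_mul_of_nonneg_right hlow hK
  linarith

/-- With `E` conjugate to `D`, all denominators are squared moduli and the weights are even powers,
so the term `ℓ = 0` alone is a lower bound. -/
theorem le_norm_greenNum_ofReal (hE : ∀ p : Fin 4 → ℝ, E (fun ν => (p ν : ℂ)) =
      (starRingEnd ℂ) (D fun ν => (p ν : ℂ))) (hL : Odd L) (he : ∀ ν, Even (e ν))
    (heq : ∀ ν, e ν ≤ 2 * q) {p : Fin 4 → ℝ} (hp : ∀ ν, |p ν| ≤ 4) :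
    ((1 / 4) ^ (2 * q)) ^ 4 ≤ ‖greenNum L n e D E 0 fun ν => (p ν : ℂ)‖ := by
  have h4 := norm_volSymb_ofReal_ge (L := L) n heq hp
  obtain ⟨r, hr0, hr⟩ := exists_volSymb_ofReal hL n he p
  have h1 : ∀ l : Period L n, ∃ s : ℝ, 0 ≤ s ∧
      volSymb L n e (shiftMom l fun ν => (p ν : ℂ)) = s := fun l => by
    rw [shiftMom_ofReal]
    exact exists_volSymb_ofReal hL n he _
  choose s hs0 hs using h1
  have hDE : ∀ l : Period L n, D (shiftMom l fun ν => (p ν : ℂ)) *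
      E (shiftMom l fun ν => (p ν : ℂ)) =
        (Complex.normSq (D (shiftMom l fun ν => (p ν : ℂ))) : ℂ) := fun l => by
    rw [shiftMom_ofReal, hE, Complex.mul_conj]
  have h5 : greenNum L n e D E 0 (fun ν => (p ν : ℂ)) =
      ((r + Complex.normSq (D fun ν => (p ν : ℂ)) * ∑ l ∈ Finset.univ.erase (0 : Period L n),
        s l / Complex.normSq (D (shiftMom l fun ν => (p ν : ℂ))) : ℝ) : ℂ) := by
    simp only [greenNum, sub_zero, hr, hs, hDE]
    rw [hE, Complex.mul_conj]
    push_cast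
    rfl
  rw [hr, Complex.norm_real, Real.norm_of_nonneg hr0] at h4
  rw [h5, Complex.norm_real]
  refine h4.trans (le_trans ?_ (le_abs_self _))
  refine le_add_of_nonneg_right (mul_nonneg (Complex.normSq_nonneg _)
    (Finset.sum_nonneg fun l _ => div_nonneg (hs0 l) (Complex.normSq_nonneg _)))

end

end BlockSpin

namespace BlockSpin

/-! ### Perturbation off the real momenta -/

/-- By the Schwarz lemma `f` moves by at most `2 B r` between `0` and `r`. -/
theorem half_le_norm_of_ball {f : ℂ → ℂ} {B κ : ℝ}
    (hf : ∀ τ : ℂ, ‖τ‖ < 1 → DifferentiableAt ℂ f τ) (hB : ∀ τ : ℂ, ‖τ‖ < 1 → ‖f τ‖ ≤ B)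
    (h0 : κ ≤ ‖f 0‖) {r : ℝ} (hr0 : 0 ≤ r) (hr1 : r < 1) (hr : 2 * B * r ≤ κ / 2) :
    κ / 2 ≤ ‖f r‖ := by
  have hr' : ((r : ℝ) : ℂ) ∈ Metric.ball (0 : ℂ) 1 := by
    simpa [abs_of_nonneg hr0] using hr1
  have h1 := Complex.dist_le_div_mul_dist_of_mapsTo_ball (f := f) (c := 0) (R₁ := 1) (R₂ := 2 * B)
    (fun τ hτ => (hf τ (by simpa using hτ)).differentiableWithinAt) (fun τ hτ => by
      have h2 := hB τ (by simpa using hτ)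
      have h3 := hB 0 (by simp)
      rw [Metric.mem_closedBall, dist_eq_norm]
      linarith [norm_sub_le (f τ) (f 0)]) hr'
  rw [dist_eq_norm, dist_eq_norm, sub_zero, Complex.norm_real, Real.norm_of_nonneg hr0,
    div_one] at h1
  have h2 := norm_sub_norm_le (f 0) (f r)
  rw [norm_sub_rev] at h2
  linarith

theorem half_le_norm_of_real {F : ℂ → (Fin 4 → ℂ) → ℂ} {m c B κ r : ℝ}
    (hm : m ≤ 1 / 2)
    (hdiff : ∀ (M : ℂ → ℂ) (Z : ℂ → Fin 4 → ℂ) (τ : ℂ), DifferentiableAt ℂ M τ →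
      DifferentiableAt ℂ Z τ → (∀ ν, |(Z τ ν).re| ≤ 4) → (∀ ν, |(Z τ ν).im| ≤ m) →
      ‖M τ‖ ≤ c / 2 → DifferentiableAt ℂ (fun t => F (M t) (Z t)) τ)
    (hB : ∀ (μ : ℂ) (z : Fin 4 → ℂ), (∀ ν, |(z ν).re| ≤ 4) → (∀ ν, |(z ν).im| ≤ m) →
      ‖μ‖ ≤ c / 2 → ‖F μ z‖ ≤ B)
    (hlow : ∀ p : Fin 4 → ℝ, (∀ ν, |p ν| ≤ 4) → κ ≤ ‖F 0 fun ν => (p ν : ℂ)‖)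
    (hr0 : 0 < r) (hr1 : r < 1) (hr : 2 * B * r ≤ κ / 2) {μ : ℂ} {z : Fin 4 → ℂ}
    (hz : ∀ ν, |(z ν).re| ≤ 7 / 2) (hzi : ∀ ν, |(z ν).im| ≤ r * m) (hμ : ‖μ‖ ≤ r * (c / 2)) :
    κ / 2 ≤ ‖F μ z‖ := by
  -- A complex disc through the given point: `τ = 0` is the real momentum with `μ = 0`, and `τ = r`
  -- is `(μ, z)`. On the unit disc the real parts move by at most `m ≤ 1/2`, which is why `7/2` is
  -- assumed where `4` is used.
  set Z : ℂ → Fin 4 → ℂ := fun τ ν => ((z ν).re : ℂ) + τ * (((z ν).im / r : ℝ) * Complex.I)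
    with hZ
  set M : ℂ → ℂ := fun τ => τ * (μ / r) with hM
  have hr' : (r : ℂ) ≠ 0 := Complex.ofReal_ne_zero.mpr hr0.ne'
  have hZr : Z r = z := by
    funext ν
    simp only [hZ]
    push_cast
    rw [← mul_assoc, mul_div_cancel₀ _ hr', Complex.re_add_im]
  have hMr : M r = μ := by simp only [hM]; rw [mul_div_cancel₀ _ hr']
  have hbd : ∀ ν, |(z ν).im / r| ≤ m := fun ν => by
    rw [abs_div, abs_of_pos hr0, div_le_iff₀ hr0, mul_comm]
    exact hzi ν
  have hprod : ∀ (τ : ℂ), ‖τ‖ < 1 → ∀ ν (x : ℝ), |x| ≤ ‖τ‖ → |x * ((z ν).im / r)| ≤ m :=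
    fun τ hτ ν x hx => by
      rw [abs_mul]
      calc _ ≤ 1 * m := mul_le_mul (hx.trans hτ.le) (hbd ν) (abs_nonneg _) zero_le_one
        _ = m := one_mul m
  have hre : ∀ τ : ℂ, ‖τ‖ < 1 → ∀ ν, |(Z τ ν).re| ≤ 4 := fun τ hτ ν => by
    have e : (Z τ ν).re = (z ν).re + -(τ.im * ((z ν).im / r)) := by
      simp [hZ]
    rw [e]
    refine (abs_add_le _ _).trans ?_
    rw [abs_neg]
    linarith [hz ν, hprod τ hτ ν _ (Complex.abs_im_le_norm τ)]
  have him : ∀ τ : ℂ, ‖τ‖ < 1 → ∀ ν, |(Z τ ν).im| ≤ m := fun τ hτ ν => by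
    have e : (Z τ ν).im = τ.re * ((z ν).im / r) := by simp [hZ]
    rw [e]
    exact hprod τ hτ ν _ (Complex.abs_re_le_norm τ)
  have hMn : ∀ τ : ℂ, ‖τ‖ < 1 → ‖M τ‖ ≤ c / 2 := fun τ hτ => by
    simp only [hM]
    rw [norm_mul, norm_div, Complex.norm_real, Real.norm_of_nonneg hr0.le]
    have h1 : ‖μ‖ / r ≤ c / 2 := by rwa [div_le_iff₀ hr0, mul_comm]
    calc _ ≤ 1 * (c / 2) := mul_le_mul hτ.le h1 (by positivity) zero_le_one
      _ = _ := one_mul _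
  have h := half_le_norm_of_ball (f := fun τ => F (M τ) (Z τ)) (B := B) (κ := κ)
    (fun τ hτ => hdiff M Z τ (by fun_prop) (by rw [differentiableAt_pi]; intro ν; fun_prop)
      (hre τ hτ) (him τ hτ) (hMn τ hτ))
    (fun τ hτ => hB _ _ (hre τ hτ) (him τ hτ) (hMn τ hτ))
    (by
      have h1 : M 0 = 0 := by simp [hM]
      have h2 : Z 0 = fun ν => ((z ν).re : ℂ) := by funext ν; simp [hZ]
      simp only [h1, h2]
      exact hlow _ fun ν => by linarith [hz ν]) hr0.le hr1 hr
  simpa only [hZr, hMr] using h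

/-! ### Periodicity -/

section

variable {L n : ℕ} [NeZero L] {D E : (Fin 4 → ℂ) → ℂ}

/-- A shift by `2π s` permutes the fibre up to full periods of `Φ`. -/
theorem sum_shiftMom_add {Φ : (Fin 4 → ℂ) → ℂ} (hΦ : HasPeriods L n Φ) (z : Fin 4 → ℂ)
    (s : Fin 4 → ℤ) : ∑ l : Period L n, Φ (shiftMom l fun ν => z ν + 2 * Real.pi * s ν) =
      ∑ l : Period L n, Φ (shiftMom l z) := by
  rw [← Equiv.sum_comp (Equiv.addRight (fun ν => (s ν : ZMod (blockLen L ν ^ n)) : Period L n))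
    fun l : Period L n => Φ (shiftMom l z)]
  refine Finset.sum_congr rfl fun l _ => ?_
  have h1 : ∀ ν, ∃ t : ℤ, (l ν).valMinAbs + s ν =
      (l ν + (s ν : ZMod (blockLen L ν ^ n))).valMinAbs + (blockLen L ν ^ n : ℕ) * t := fun ν => by
    have h2 : (((l ν + (s ν : ZMod (blockLen L ν ^ n))).valMinAbs : ℤ) : ZMod (blockLen L ν ^ n)) =
        (((l ν).valMinAbs + s ν : ℤ) : ZMod (blockLen L ν ^ n)) := by
      push_cast
      rfl
    obtain ⟨t, ht⟩ := (ZMod.intCast_eq_intCast_iff_dvd_sub _ _ _).mp h2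
    exact ⟨t, by linarith⟩
  choose t ht using h1
  refine Eq.trans ?_ (hΦ _ t)
  congr 1
  funext ν
  have h3 : ((l ν).valMinAbs : ℂ) + s ν =
      (l ν + (s ν : ZMod (blockLen L ν ^ n))).valMinAbs + (blockLen L ν : ℂ) ^ n * t ν := by
    exact_mod_cast ht ν
  simp only [shiftMom, periodMom, Equiv.coe_addRight, Pi.add_apply]
  push_cast
  linear_combination 2 * (Real.pi : ℂ) * h3

theorem fqSymb_add (hL : Odd L) (q : ℕ) (z : Fin 4 → ℂ) (s : Fin 4 → ℤ) :
    fqSymb L q n (fun ν => z ν + 2 * Real.pi * s ν) = fqSymb L q n z := by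
  simp only [fqSymb, sum_shiftMom_add (hasPeriods_volSymb hL _ _)]

theorem greenDen_eq {q : ℕ} {a : ℝ} {μ : ℂ} {z : Fin 4 → ℂ} (h : D z - μ ≠ 0) :
    greenDen L q n a D μ z = (D z - μ) * (fqSymb L q n z + a * ∑ l : Period L n,
      volSymb L n (fun _ => 2 * q) (shiftMom l z) / (D (shiftMom l z) - μ)) := by
  rw [greenDen, ← Finset.add_sum_erase _ _ (Finset.mem_univ (0 : Period L n)), shiftMom_zero]
  field_simp

theorem greenNum_eq {e : Fin 4 → ℕ} {μ : ℂ} {z : Fin 4 → ℂ} (h : D z - μ ≠ 0) (h' : E z - μ ≠ 0) :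
    greenNum L n e D E μ z = (D z - μ) * (E z - μ) * ∑ l : Period L n,
      volSymb L n e (shiftMom l z) / ((D (shiftMom l z) - μ) * (E (shiftMom l z) - μ)) := by
  rw [greenNum, ← Finset.add_sum_erase _ _ (Finset.mem_univ (0 : Period L n)), shiftMom_zero]
  field_simp

/-- Dividing out the factors at `ℓ = 0` restores sums over the whole fibre, which are visibly
periodic. This requires `D z - μ` and `E z - μ` to be nonzero. -/
theorem gramInv_eq {q : ℕ} {a : ℝ} {e : Fin 4 → ℕ} {μ : ℂ} {z : Fin 4 → ℂ} (h : D z - μ ≠ 0)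
    (h' : E z - μ ≠ 0) : gramInv L q n a e D E μ z =
      (fqSymb L q n z + a * ∑ l : Period L n,
        volSymb L n (fun _ => 2 * q) (shiftMom l z) / (D (shiftMom l z) - μ)) *
      (fqSymb L q n z + a * ∑ l : Period L n,
        volSymb L n (fun _ => 2 * q) (shiftMom l z) / (E (shiftMom l z) - μ)) /
      ((a : ℂ) ^ 2 * ∑ l : Period L n,
        volSymb L n e (shiftMom l z) / ((D (shiftMom l z) - μ) * (E (shiftMom l z) - μ))) := by
  rw [gramInv, greenDen_eq h, greenDen_eq h', greenNum_eq h h', mul_mul_mul_comm,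
    mul_left_comm ((a : ℂ) ^ 2), mul_div_mul_left _ _ (mul_ne_zero h h')]

theorem gramInv_add (hL : Odd L) (hD : HasPeriods L n D) (hE : HasPeriods L n E) {q : ℕ} {a : ℝ}
    {e : Fin 4 → ℕ} {μ : ℂ} {z : Fin 4 → ℂ} (s : Fin 4 → ℤ) (h : D z - μ ≠ 0) (h' : E z - μ ≠ 0)
    (hs : D (fun ν => z ν + 2 * Real.pi * s ν) - μ ≠ 0)
    (hs' : E (fun ν => z ν + 2 * Real.pi * s ν) - μ ≠ 0) :
    gramInv L q n a e D E μ (fun ν => z ν + 2 * Real.pi * s ν) = gramInv L q n a e D E μ z := by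
  have hv := fun e => hasPeriods_volSymb hL n e
  have h1 : ∀ {D : (Fin 4 → ℂ) → ℂ}, HasPeriods L n D →
      HasPeriods L n fun z => volSymb L n (fun _ => 2 * q) z / (D z - μ) := fun hD z t => by
    simp only [hv _ z t, hD z t]
  have h2 : HasPeriods L n fun z => volSymb L n e z / ((D z - μ) * (E z - μ)) := fun z t => by
    simp only [hv _ z t, hD z t, hE z t]
  rw [gramInv_eq h h', gramInv_eq hs hs', fqSymb_add hL, sum_shiftMom_add (h1 hD) z s,
    sum_shiftMom_add (h1 hE) z s, sum_shiftMom_add h2 z s]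

end

/-! ### Uniform bounds -/

/-- The uniform estimates on the symbol of the inverse of a Gram operator. -/
structure GramInvBound (m B : ℝ) (L q n : ℕ) [NeZero L] (a : ℝ) (e : Fin 4 → ℕ)
    (D E : (Fin 4 → ℂ) → ℂ) (μ : ℂ) : Prop where
  den_ne_zero : ∀ p : Fin 4 → ℝ, (∀ ν, |p ν| ≤ Real.pi) →
    greenDen L q n a D μ (fun ν => (p ν : ℂ)) ≠ 0 ∧ greenDen L q n a E μ (fun ν => (p ν : ℂ)) ≠ 0
  num_ne_zero : ∀ p : Fin 4 → ℝ, (∀ ν, |p ν| ≤ Real.pi) →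
    greenNum L n e D E μ (fun ν => (p ν : ℂ)) ≠ 0
  shift_ne_zero : ∀ p : Fin 4 → ℝ, (∀ ν, |p ν| ≤ Real.pi) → ∀ l : Period L n, l ≠ 0 →
    D (shiftMom l fun ν => (p ν : ℂ)) - μ ≠ 0 ∧ E (shiftMom l fun ν => (p ν : ℂ)) - μ ≠ 0
  differentiableAt : ∀ p : Fin 4 → ℝ, (∀ ν, |p ν| ≤ Real.pi) → ∀ ν (t : ℂ), |t.re| ≤ Real.pi →
    |t.im| ≤ m →
    DifferentiableAt ℂ (fun t => gramInv L q n a e D E μ (Function.update (fun ν => (p ν : ℂ)) ν t)) t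
  norm_le : ∀ p : Fin 4 → ℝ, (∀ ν, |p ν| ≤ Real.pi) → ∀ ν (t : ℂ), |t.re| ≤ Real.pi →
    |t.im| ≤ m → ‖gramInv L q n a e D E μ (Function.update (fun ν => (p ν : ℂ)) ν t)‖ ≤ B
  periodic : ∀ p : Fin 4 → ℝ, (∀ ν, |p ν| ≤ Real.pi) → ∀ ν (s : ℝ), |s| ≤ m →
    gramInv L q n a e D E μ (Function.update (fun ν => (p ν : ℂ)) ν (-Real.pi + s * Complex.I)) =
      gramInv L q n a e D E μ (Function.update (fun ν => (p ν : ℂ)) ν (Real.pi + s * Complex.I))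

theorem exists_gramInvBound {q : ℕ} (hq : 1 ≤ q) {a C c m : ℝ} (ha : 0 < a) (hC : 0 < C)
    (hc : 0 < c) (hc1 : c ≤ 1) (hm0 : 0 < m) (hm : m ≤ 1 / 2) :
    ∃ m' B μup : ℝ, 0 < m' ∧ 0 < μup ∧ ∀ (L n : ℕ) [NeZero L], Odd L → 2 ≤ L →
      ∀ e : Fin 4 → ℕ, (∀ ν, Even (e ν)) → (∀ ν, 2 ≤ e ν) → (∀ ν, e ν ≤ 2 * q) →
      ∀ D E : (Fin 4 → ℂ) → ℂ, IsDispersion C c m L n D → IsDispersion C c m L n E →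
      (∀ p : Fin 4 → ℝ, E (fun ν => (p ν : ℂ)) = (starRingEnd ℂ) (D fun ν => (p ν : ℂ))) →
      ∀ μ : ℂ, ‖μ‖ ≤ μup → GramInvBound m' B L q n a e D E μ := by
  have hV := volBound_nonneg q
  set BA := denBound C c a q with hBA
  set BH := numBound C c q with hBH
  set κA := denLower c a q with hκA
  set κH : ℝ := ((1 / 4) ^ (2 * q)) ^ 4 with hκH
  have hBA0 : 0 < BA := by rw [hBA, denBound]; positivity
  have hBH0 : 0 ≤ BH := by rw [hBH, numBound]; positivity
  have hκA0 : 0 < κA := by rw [hκA, denLower]; positivity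
  have hκH0 : 0 < κH := by positivity
  -- The size of `r` ensures that the perturbation consumes at most half of each lower bound `κA`
  -- and `κH`.
  set r := min (1 / 2) (min (κA / (4 * BA)) (κH / (4 * (BH + 1)))) with hr
  have hr0 : 0 < r := by positivity
  have hr1 : r < 1 := (min_le_left _ _).trans_lt (by norm_num)
  have hrA : 2 * BA * r ≤ κA / 2 := by
    have h1 : r ≤ κA / (4 * BA) := (min_le_right _ _).trans (min_le_left _ _)
    rw [le_div_iff₀ (by positivity)] at h1
    linarith
  have hrH : 2 * BH * r ≤ κH / 2 := by
    have h1 : r ≤ κH / (4 * (BH + 1)) := (min_le_right _ _).trans (min_le_right _ _)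
    rw [le_div_iff₀ (by positivity)] at h1
    linarith
  refine ⟨r * m, BA * BA / (a ^ 2 * (κH / 2)), r * (c / 2), by positivity, by positivity,
    fun L n _ hL hL2 e he he2 heq D E hD hE hDE μ hμ => ?_⟩
  have hμ' : ‖μ‖ ≤ c / 2 := hμ.trans (mul_le_of_le_one_left (by positivity) hr1.le)
  have hrm : r * m ≤ m := mul_le_of_le_one_left hm0.le hr1.le
  have hpi : Real.pi ≤ 7 / 2 := by linarith [Real.pi_lt_d2]
  have hshift : ∀ {D : (Fin 4 → ℂ) → ℂ}, IsDispersion C c m L n D → ∀ {μ : ℂ} {z : Fin 4 → ℂ},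
      (∀ ν, |(z ν).re| ≤ 4) → (∀ ν, |(z ν).im| ≤ m) → ‖μ‖ ≤ c / 2 →
      ∀ l : Period L n, (l ≠ 0 ∨ ∃ ν, 2 ≤ |(z ν).re|) → D (shiftMom l z) - μ ≠ 0 := by
    intro D hD μ z hz hzi hμ l hl h0
    have h1 := hD.half_le_norm_sub hL hz hzi hl hμ
    rw [h0, norm_zero] at h1
    linarith
  have hden : ∀ {D : (Fin 4 → ℂ) → ℂ}, IsDispersion C c m L n D → ∀ {z : Fin 4 → ℂ},
      (∀ ν, |(z ν).re| ≤ 7 / 2) → (∀ ν, |(z ν).im| ≤ r * m) →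
      greenDen L q n a D μ z ≠ 0 := by
    intro D hD z hz hzi h0
    have h1 := half_le_norm_of_real (F := greenDen L q n a D) hm
      (fun M Z τ hM hZ h1 h2 h3 => differentiableAt_greenDen q a hD.differentiable hZ hM
        fun l hl => hshift hD h1 h2 h3 l (.inl hl))
      (fun μ z h1 h2 h3 => norm_greenDen_le hD ha hL hL2 hq hC hc hc1 h1 h2 hm h3)
      (fun p hp => le_norm_greenDen_ofReal hD ha hL hL2 hq hc hm0.le hp) hr0 hr1 hrA hz hzi hμ
    rw [h0, norm_zero] at h1
    linarith
  have hnum : ∀ {z : Fin 4 → ℂ}, (∀ ν, |(z ν).re| ≤ 7 / 2) → (∀ ν, |(z ν).im| ≤ r * m) →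
      κH / 2 ≤ ‖greenNum L n e D E μ z‖ := fun {z} hz hzi =>
    half_le_norm_of_real (F := greenNum L n e D E) hm
      (fun M Z τ hM hZ h1 h2 h3 => differentiableAt_greenNum e hD.differentiable hE.differentiable
        hZ hM (fun l hl => hshift hD h1 h2 h3 l (.inl hl))
        (fun l hl => hshift hE h1 h2 h3 l (.inl hl)))
      (fun μ z h1 h2 h3 => norm_greenNum_le hD hE hL hL2 he2 heq hC hc hc1 h1 h2 hm h3)
      (fun p hp => le_norm_greenNum_ofReal hDE hL he heq hp) hr0 hr1 hrH hz hzi hμ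
  have hnum0 : ∀ {z : Fin 4 → ℂ}, (∀ ν, |(z ν).re| ≤ 7 / 2) → (∀ ν, |(z ν).im| ≤ r * m) →
      greenNum L n e D E μ z ≠ 0 := fun hz hzi h0 => by
    have h1 := hnum hz hzi
    rw [h0, norm_zero] at h1
    linarith
  have hreal : ∀ {p : Fin 4 → ℝ}, (∀ ν, |p ν| ≤ Real.pi) →
      (∀ ν, |((p ν : ℂ)).re| ≤ 7 / 2) ∧ ∀ ν, |((p ν : ℂ)).im| ≤ r * m := fun hp =>
    ⟨fun ν => by simpa using (hp ν).trans hpi, fun ν => by simpa using (by positivity)⟩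
  have hupd : ∀ {p : Fin 4 → ℝ}, (∀ ν, |p ν| ≤ Real.pi) → ∀ ν {t : ℂ}, |t.re| ≤ Real.pi →
      |t.im| ≤ r * m → (∀ ν', |(Function.update (fun ν => (p ν : ℂ)) ν t ν').re| ≤ 7 / 2) ∧
        ∀ ν', |(Function.update (fun ν => (p ν : ℂ)) ν t ν').im| ≤ r * m := fun hp ν t ht hti => by
    refine ⟨fun ν' => ?_, fun ν' => ?_⟩
    all_goals
      by_cases h : ν' = ν
      · subst h; rw [Function.update_self]; first | exact ht.trans hpi | exact hti
      · rw [Function.update_of_ne h]; first | exact (hreal hp).1 ν' | exact (hreal hp).2 ν'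
  have h4 : ∀ {z : Fin 4 → ℂ}, (∀ ν, |(z ν).re| ≤ 7 / 2) → ∀ ν, |(z ν).re| ≤ 4 :=
    fun hz ν => (hz ν).trans (by norm_num)
  have hmm : ∀ {z : Fin 4 → ℂ}, (∀ ν, |(z ν).im| ≤ r * m) → ∀ ν, |(z ν).im| ≤ m :=
    fun hz ν => (hz ν).trans hrm
  have ha2 : (a : ℂ) ^ 2 ≠ 0 := pow_ne_zero _ (Complex.ofReal_ne_zero.mpr ha.ne')
  refine ⟨fun p hp => ⟨hden hD (hreal hp).1 (hreal hp).2, hden hE (hreal hp).1 (hreal hp).2⟩,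
    fun p hp => hnum0 (hreal hp).1 (hreal hp).2,
    fun p hp l hl => ⟨hshift hD (h4 (hreal hp).1) (hmm (hreal hp).2) hμ' l (.inl hl),
      hshift hE (h4 (hreal hp).1) (hmm (hreal hp).2) hμ' l (.inl hl)⟩,
    fun p hp ν t ht hti => ?_, fun p hp ν t ht hti => ?_, fun p hp ν s hs => ?_⟩
  · obtain ⟨hz, hzi⟩ := hupd hp ν ht hti
    have hZ : DifferentiableAt ℂ (fun t => Function.update (fun ν => (p ν : ℂ)) ν t) t :=
      (hasDerivAt_update _ ν t).differentiableAt
    have hM : DifferentiableAt ℂ (fun _ : ℂ => μ) t := differentiableAt_const μ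
    have hneD := fun l hl => hshift hD (h4 hz) (hmm hzi) hμ' l (.inl hl)
    have hneE := fun l hl => hshift hE (h4 hz) (hmm hzi) hμ' l (.inl hl)
    unfold gramInv
    exact ((differentiableAt_greenDen q a hD.differentiable hZ hM hneD).mul
      (differentiableAt_greenDen q a hE.differentiable hZ hM hneE)).fun_div
      ((differentiableAt_greenNum e hD.differentiable hE.differentiable hZ hM hneD hneE).const_mul _)
      (mul_ne_zero ha2 (hnum0 hz hzi))
  · obtain ⟨hz, hzi⟩ := hupd hp ν ht hti
    rw [gramInv, norm_div, norm_mul, norm_mul, norm_pow, Complex.norm_real,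
      Real.norm_of_nonneg ha.le]
    have h1 := norm_greenDen_le hD ha hL hL2 hq hC hc hc1 (h4 hz) (hmm hzi) hm hμ'
    have h2 := norm_greenDen_le hE ha hL hL2 hq hC hc hc1 (h4 hz) (hmm hzi) hm hμ'
    have h3 := hnum hz hzi
    gcongr
  · have hp1 : |(-(Real.pi : ℂ) + s * Complex.I).re| ≤ Real.pi := by
      simp [abs_of_pos Real.pi_pos]
    have hp2 : |((Real.pi : ℂ) + s * Complex.I).re| ≤ Real.pi := by
      simp [abs_of_pos Real.pi_pos]
    obtain ⟨hz, hzi⟩ := hupd hp ν (t := -(Real.pi : ℂ) + s * Complex.I) hp1 (by simpa using hs)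
    obtain ⟨hw, hwi⟩ := hupd hp ν (t := (Real.pi : ℂ) + s * Complex.I) hp2 (by simpa using hs)
    -- On the two edges `Re t = ±π` the updated coordinate exceeds `2`, so `D - μ` and `E - μ` do
    -- not vanish at the base momentum and the periodic form of `gramInv` applies.
    have hzex : ∃ ν', 2 ≤ |(Function.update (fun ν => (p ν : ℂ)) ν
        (-(Real.pi : ℂ) + s * Complex.I) ν').re| := ⟨ν, by
      simpa [abs_of_pos Real.pi_pos] using Real.two_le_pi⟩
    have hwex : ∃ ν', 2 ≤ |(Function.update (fun ν => (p ν : ℂ)) ν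
        ((Real.pi : ℂ) + s * Complex.I) ν').re| := ⟨ν, by
      simpa [abs_of_pos Real.pi_pos] using Real.two_le_pi⟩
    have e1 : Function.update (fun ν => (p ν : ℂ)) ν ((Real.pi : ℂ) + s * Complex.I) =
        fun ν' => Function.update (fun ν => (p ν : ℂ)) ν (-(Real.pi : ℂ) + s * Complex.I) ν' +
          2 * Real.pi * ((Pi.single ν 1 : Fin 4 → ℤ) ν' : ℂ) := by
      funext ν'
      by_cases h : ν' = ν
      · subst h; simp; ring
      · simp [h]
    have hD1 := hshift hD (h4 hz) (hmm hzi) hμ' 0 (.inr hzex)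
    have hE1 := hshift hE (h4 hz) (hmm hzi) hμ' 0 (.inr hzex)
    have hD2 := hshift hD (h4 hw) (hmm hwi) hμ' 0 (.inr hwex)
    have hE2 := hshift hE (h4 hw) (hmm hwi) hμ' 0 (.inr hwex)
    rw [shiftMom_zero] at hD1 hE1 hD2 hE2
    rw [e1] at hD2 hE2 ⊢
    exact (gramInv_add hL hD.hasPeriods hE.hasPeriods _ hD1 hE1 hD2 hE2).symm

end BlockSpin

namespace BlockSpin

/-! ### Inverses of the Gram operators -/

section

variable {L Nt Ns : ℕ} [NeZero L] [NeZero Nt] [NeZero Ns] {n : ℕ}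

/-- The minimal integer coordinates of a momentum of the unit torus. -/
def liftInt (k : Site L Nt Ns 0) : Fin 4 → ℤ := fun ν => (k ν).valMinAbs

/-- The momentum with minimal components, as a complex momentum. -/
noncomputable def unitMomC (k : Site L Nt Ns 0) : Fin 4 → ℂ := fun ν => (unitMom L Nt Ns k ν : ℂ)

theorem abs_unitMom_le (k : Site L Nt Ns 0) (ν : Fin 4) : |unitMom L Nt Ns k ν| ≤ Real.pi := by
  have h1 : (k ν).valMinAbs.natAbs ≤ side Nt Ns ν / 2 := by
    have h2 := ZMod.natAbs_valMinAbs_le (k ν)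
    have h3 : blockLen L ν ^ 0 * side Nt Ns ν = side Nt Ns ν := by rw [pow_zero, one_mul]
    exact h2.trans_eq (congrArg (· / 2) h3)
  have h2 : 2 * |(k ν).valMinAbs| ≤ (side Nt Ns ν : ℤ) := by
    rw [Int.abs_eq_natAbs]; lia
  have h3 : 2 * |((k ν).valMinAbs : ℝ)| ≤ side Nt Ns ν := by exact_mod_cast h2
  have hs : (0 : ℝ) < side Nt Ns ν := Nat.cast_pos.mpr (Nat.pos_of_ne_zero (NeZero.ne _))
  rw [unitMom, abs_div, abs_of_pos hs, div_le_iff₀ hs, abs_mul,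
    abs_of_pos (by positivity : 0 < 2 * Real.pi)]
  nlinarith [Real.pi_pos]

theorem ofInt_liftInt (k : Site L Nt Ns 0) : ofInt (liftInt k) = k := ofInt_valMinAbs k

theorem proj_ofInt_liftInt (k : Site L Nt Ns 0) :
    proj 0 (ofInt (liftInt k) : Site L Nt Ns n) = k := by
  rw [proj_ofInt (Nat.zero_le n), ofInt_liftInt]

theorem symb_shiftInt {Φ : (Fin 4 → ℂ) → ℂ} (hΦ : HasPeriods L n Φ) (k : Site L Nt Ns 0)
    (l : Period L n) : symb Φ (ofInt (shiftInt Nt Ns (liftInt k) l) : Site L Nt Ns n) =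
      Φ (shiftMom l (unitMomC k)) := by
  rw [symb_ofInt hΦ]
  congr 1
  funext ν
  rw [mom_shiftInt, Complex.ofReal_add]
  rfl

theorem symb_liftInt {Φ : (Fin 4 → ℂ) → ℂ} (hΦ : HasPeriods L n Φ) (k : Site L Nt Ns 0) :
    symb Φ (ofInt (liftInt k) : Site L Nt Ns n) = Φ (unitMomC k) :=
  symb_ofInt hΦ _

theorem exists_eq_shiftInt {k : Site L Nt Ns 0} {p : Site L Nt Ns n} (hp : proj 0 p = k) :
    ∃ l : Period L n, p = ofInt (shiftInt Nt Ns (liftInt k) l) := by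
  have h := mem_fib.mpr hp
  rw [← ofInt_liftInt k, ← image_shiftInt, Finset.mem_image] at h
  obtain ⟨l, -, hl⟩ := h
  exact ⟨l, hl.symm⟩

theorem sum_fib_liftInt {A : Type*} [AddCommMonoid A] (k : Site L Nt Ns 0)
    (f : Site L Nt Ns n → A) :
    ∑ p ∈ fib n k, f p = ∑ l : Period L n, f (ofInt (shiftInt Nt Ns (liftInt k) l)) := by
  rw [← sum_fib, ofInt_liftInt]

theorem sum_fib_erase_liftInt (k : Site L Nt Ns 0) (f : Site L Nt Ns n → ℂ) :
    ∑ p ∈ (fib n (proj 0 (ofInt (liftInt k) : Site L Nt Ns n))).erase (ofInt (liftInt k)), f p =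
      ∑ l ∈ Finset.univ.erase (0 : Period L n), f (ofInt (shiftInt Nt Ns (liftInt k) l)) := by
  rw [← sum_fib_erase, proj_ofInt_liftInt, ofInt_liftInt]

theorem fqSymb_unitMomC_ne_zero (hL : Odd L) (q n : ℕ) (k : Site L Nt Ns 0) :
    fqSymb L q n (unitMomC k) ≠ 0 := by
  obtain ⟨r, hr1, hr⟩ := exists_fqSymb_ofReal hL q n (unitMom L Nt Ns k)
  have h : fqSymb L q n (unitMomC k) = r := hr
  rw [h, Complex.ofReal_ne_zero]
  linarith

theorem isDiag_fQinv_fqSymb (hL : Odd L) (q n : ℕ) :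
    IsDiag (fun k => fqSymb L q n (unitMomC k)) (fQinv L Nt Ns q n) := by
  refine (isDiag_fQinv hL q n).congr fun k => ?_
  simp only [fqSymb, sum_fib_liftInt, symb_shiftInt (hasPeriods_volSymb hL _ _)]

/-- Evenness of this symbol is what makes `𝔔_n` symmetric. It is proved on the fibre sums, where
reflection is a bijection; minimal representatives need not be odd under it. -/
theorem fqSymb_unitMomC_neg (hL : Odd L) (q n : ℕ) (k : Site L Nt Ns 0) :
    fqSymb L q n (unitMomC (-k)) = fqSymb L q n (unitMomC k) := by
  have h : ∀ k : Site L Nt Ns 0, fqSymb L q n (unitMomC k) = 1 + ∑ j ∈ Finset.Ico 1 n,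
      ((L : ℂ) ^ (2 * j))⁻¹ * ∑ p ∈ fib j k, symb (volSymb L j fun _ => 2 * q) p := fun k => by
    simp only [fqSymb, sum_fib_liftInt, symb_shiftInt (hasPeriods_volSymb hL _ _)]
  simp only [h, sum_fib_neg, symb_neg (hasPeriods_volSymb hL _ _), volSymb_neg]

theorem isDiag_fQ (hL : Odd L) (q : ℕ) (a : ℝ) (n : ℕ) :
    IsDiag (fun k => a * (fqSymb L q n (unitMomC k))⁻¹) (fQ L Nt Ns q a n) :=
  ((isDiag_fQinv_fqSymb hL q n).inv fun k => fqSymb_unitMomC_ne_zero hL q n k).smul _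

theorem adj_fQ (hL : Odd L) (q : ℕ) (a : ℝ) (n : ℕ) :
    adj L Nt Ns (fQ L Nt Ns q a n) = fQ L Nt Ns q a n := by
  have h := (isDiag_fQ (L := L) (Nt := Nt) (Ns := Ns) hL q a n).adj
  simp only [fqSymb_unitMomC_neg hL] at h
  rw [h.eq_diagOp, (isDiag_fQ hL q a n).eq_diagOp]

/-- The operator `T₀ + U 𝔔 W` is invertible, and the Gram operator of `(T₀ + U 𝔔 W)⁻¹ U 𝔔` has
an inverse with exponentially decaying kernel. -/
theorem isUnit_and_hasInverseBound (hL : Odd L) {q : ℕ} {a : ℝ} (ha : 0 < a) {m B : ℝ}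
    (hm : 0 < m) {e : Fin 4 → ℕ} {D Φ Ψ : (Fin 4 → ℂ) → ℂ} {μ : ℂ} (hD : HasPeriods L n D)
    (hΦ : HasPeriods L n Φ) (hΨΦ : ∀ z, Ψ z * Φ z = volSymb L n (fun _ => 2 * q) z)
    (hΦΦ : ∀ z, Φ z * Φ (-z) = volSymb L n e z)
    {T₀ : Op L Nt Ns n n} {U : Op L Nt Ns 0 n} {W : Op L Nt Ns n 0} (hT : IsDiag (symb D) T₀)
    (hU : IsUp (symb Φ) U) (hW : IsDown (symb Ψ) W)
    (hbd : GramInvBound m B L q n a e D (fun z => D (-z)) μ) :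
    IsUnit (T₀ + U * fQ L Nt Ns q a n * W - μ • 1) ∧
      HasInverseBound L Nt Ns (m / 16) (B * expSum (m / 2) * expSum (m / 16) ^ 4)
        (gram L Nt Ns ((T₀ + U * fQ L Nt Ns q a n * W - μ • 1)⁻¹ * U * fQ L Nt Ns q a n)) := by
  have ha' : (a : ℂ) ≠ 0 := Complex.ofReal_ne_zero.mpr ha.ne'
  set d : Site L Nt Ns n → ℂ := fun p => symb D p - μ with hd
  set b : Site L Nt Ns n → ℂ := symb Φ with hb
  set β : Site L Nt Ns n → ℂ := fun p => symb Ψ p * b p with hβ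
  set f : Site L Nt Ns 0 → ℂ := fun k => fqSymb L q n (unitMomC k) with hf
  set c : Site L Nt Ns 0 → ℂ := fun k => a * (f k)⁻¹ with hc
  have hπ : ∀ (k : Site L Nt Ns 0) ν, |unitMom L Nt Ns k ν| ≤ Real.pi := abs_unitMom_le
  have hf0 : ∀ k, f k ≠ 0 := fqSymb_unitMomC_ne_zero hL q n
  have hv := hasPeriods_volSymb hL n fun _ => 2 * q
  have hve := hasPeriods_volSymb hL n e
  have hβv : ∀ p, β p = symb (volSymb L n fun _ => 2 * q) p := fun p => hΨΦ _
  have hdneg : ∀ p, d (-p) = symb (fun z => D (-z)) p - μ := fun p => by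
    simp only [hd, symb_neg hD]
  have hbb : ∀ p, b p * b (-p) = symb (volSymb L n e) p := fun p => by
    rw [hb, symb_neg hΦ]
    exact hΦΦ _
  -- The symbol of `𝔔_n` is `a / f`; multiplying by `f` turns the resolvent denominators into
  -- `greenDen`.
  have hden : ∀ k, denom d β c (ofInt (liftInt k)) = greenDen L q n a D μ (unitMomC k) / f k ∧
      denom (fun p => d (-p)) β c (ofInt (liftInt k)) =
        greenDen L q n a (fun z => D (-z)) μ (unitMomC k) / f k := fun k => by
    rw [denom, denom, sum_fib_erase_liftInt, sum_fib_erase_liftInt]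
    simp only [hβv, hdneg, symb_shiftInt hv, symb_liftInt hv, proj_ofInt_liftInt]
    have := hf0 k
    simp only [hf] at this
    simp only [hd, symb_shiftInt hD, symb_liftInt hD, symb_shiftInt hD.neg, symb_liftInt hD.neg,
      greenDen, hc, hf]
    constructor <;> field_simp
  have hnum : ∀ k : Site L Nt Ns 0, numer d (fun p => d (-p)) (fun p => b p * b (-p)) (ofInt (liftInt k)) =
      greenNum L n e D (fun z => D (-z)) μ (unitMomC k) := fun k => by
    rw [numer, sum_fib_erase_liftInt]
    simp only [hbb, hdneg, symb_shiftInt hve, symb_liftInt hve]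
    simp only [hd, symb_shiftInt hD, symb_liftInt hD, symb_shiftInt hD.neg, symb_liftInt hD.neg,
      greenNum]
  have hne : ∀ k, ∀ p ∈ (fib n (proj 0 (ofInt (liftInt k) : Site L Nt Ns n))).erase
      (ofInt (liftInt k)), d p ≠ 0 ∧ d (-p) ≠ 0 := fun k p hp => by
    rw [proj_ofInt_liftInt, Finset.mem_erase, mem_fib] at hp
    obtain ⟨l, rfl⟩ := exists_eq_shiftInt hp.2
    have hl : l ≠ 0 := fun h => hp.1 (by rw [h, shiftInt_zero])
    have h := hbd.shift_ne_zero _ (hπ k) l hl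
    rw [hdneg, hd]
    simp only [symb_shiftInt hD, symb_shiftInt hD.neg]
    exact h
  have hΔ : ∀ k, secDet d β c k ≠ 0 := fun k => by
    have h := secDet_eq (fun p hp => (hne k p hp).1) β c
    rw [proj_ofInt_liftInt] at h
    rw [h, (hden k).1]
    exact mul_ne_zero (cofac_ne_zero fun p hp => (hne k p hp).1)
      (div_ne_zero (hbd.den_ne_zero _ (hπ k)).1 (hf0 k))
  -- Only the base point of a fibre can be a zero of `d`. There `b` cannot vanish, because `β` is
  -- the averaging symbol, which is bounded below at momenta in `[-π, π]⁴`.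
  have hd0 : ∀ p, d p = 0 → b p ≠ 0 ∧ ∀ p' ∈ fib n (proj 0 p), p' ≠ p → d p' ≠ 0 := by
    intro p hp
    have hbase : p = ofInt (liftInt (proj 0 p)) := by
      by_contra h
      exact (hne (proj 0 p) p (Finset.mem_erase.mpr
        ⟨h, mem_fib.mpr (proj_ofInt_liftInt _).symm⟩)).1 hp
    refine ⟨fun h => ?_, fun p' hp' hne' => ?_⟩
    · have h1 := hβv p
      rw [hβ] at h1
      simp only [h, mul_zero] at h1
      rw [hbase, symb_liftInt hv] at h1
      have h2 := norm_volSymb_ofReal_ge (L := L) (e := fun _ => 2 * q) (q := q) n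
        (fun _ => le_rfl) fun ν => (hπ (proj 0 p) ν).trans Real.pi_le_four
      change _ ≤ ‖volSymb L n (fun _ => 2 * q) (unitMomC (proj 0 p))‖ at h2
      rw [← h1, norm_zero] at h2
      have h3 : (0 : ℝ) < ((1 / 4) ^ (2 * q)) ^ 4 := by positivity
      linarith
    · refine (hne (proj 0 p) p' (Finset.mem_erase.mpr ⟨?_, ?_⟩)).1
      · rwa [← hbase]
      · rwa [proj_ofInt_liftInt]
  have hT' : IsDiag d (T₀ - μ • 1) := by
    have h := hT.add (isDiag_one.smul (-μ))
    rw [neg_smul, ← sub_eq_add_neg] at h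
    exact h.congr fun p => by simp [hd, sub_eq_add_neg]
  have hC : IsDiag c (fQ L Nt Ns q a n) := isDiag_fQ hL q a n
  have hS : T₀ + U * fQ L Nt Ns q a n * W - μ • 1 = (T₀ - μ • 1) + U * fQ L Nt Ns q a n * W := by
    abel
  rw [hS]
  have hunit := rankOne_isUnit hT' hU hC hW hΔ hd0
  refine ⟨hunit, ?_⟩
  have hX := (rankOne_isUp_inv hT' hU hC hW hΔ hunit).mul_isDiag hC
  have hc_even : ∀ k, c (-k) = c k := fun k => by
    simp only [hc, hf, fqSymb_unitMomC_neg hL]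
  have hβ_even : ∀ p, β (-p) = β p := fun p => by
    rw [hβv, hβv, symb_neg hv]
    simp only [volSymb_neg]
  set F : Site L Nt Ns 0 → ℂ := fun k => gramInv L q n a e D (fun z => D (-z)) μ (unitMomC k)
    with hF
  have hF0 : ∀ k, F k ≠ 0 := fun k => by
    have h := hbd.den_ne_zero _ (hπ k)
    exact div_ne_zero (mul_ne_zero h.1 h.2)
      (mul_ne_zero (pow_ne_zero _ ha') (hbd.num_ne_zero _ (hπ k)))
  -- The factors `f` from `c²` and from the two denominators cancel, so the Gram symbol is exactly
  -- the reciprocal of `gramInv`.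
  have hG := hX.gram.congr (d' := fun k => (F k)⁻¹) fun k => by
    have h := gram_symbol_eq (b := b) hβ_even hc_even (fun p hp => (hne k p hp).1)
      (fun p hp => (hne k p hp).2) (x := fun p => c (proj 0 p) *
        (b p * cofac d p / secDet d β c (proj 0 p))) fun p => rfl
    rw [proj_ofInt_liftInt, hnum, (hden k).1, (hden k).2] at h
    rw [h, hF]
    have h1 := hbd.den_ne_zero _ (hπ k)
    have h2 := hbd.num_ne_zero _ (hπ k)
    have h3 : greenDen L q n a D μ (unitMomC k) ≠ 0 := h1.1
    have h4 : greenDen L q n a (fun z => D (-z)) μ (unitMomC k) ≠ 0 := h1.2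
    have h5 : greenNum L n e D (fun z => D (-z)) μ (unitMomC k) ≠ 0 := h2
    have h6 := hf0 k
    simp only [hc, gramInv]
    field_simp
  obtain ⟨hu, hinv⟩ := hG.isUnit_and_inv fun k => inv_ne_zero (hF0 k)
  refine ⟨hu, ?_⟩
  rw [hinv]
  simp only [inv_inv]
  -- The holomorphic extension in one coordinate is `gramInv` itself with the other momenta frozen
  -- at their real values.
  refine opNorm_diagOp_le hm fun ν k => ⟨fun t => gramInv L q n a e D (fun z => D (-z)) μ
    (Function.update (unitMomC k) ν t), hbd.differentiableAt _ (hπ k) ν,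
    hbd.norm_le _ (hπ k) ν, hbd.periodic _ (hπ k) ν, fun s => ?_⟩
  simp only [hF]
  congr 1
  funext ν'
  by_cases h : ν' = ν
  · subst h
    have h1 : Function.update k ν' s ν' = s := Function.update_self _ _ _
    rw [Function.update_self, unitMomC, unitMom, h1]
  · have h1 : Function.update k ν s ν' = k ν' := Function.update_of_ne h _ _
    rw [Function.update_of_ne h, unitMomC, unitMomC, unitMom, unitMom, h1]

/-! ### Adjoints -/

theorem adj_eq_transpose {j : ℕ} (A : Op L Nt Ns j j) : adj L Nt Ns A = A.transpose := by
  have h : cellVol L j ≠ 0 := by exact_mod_cast cellVol_ne_zero (L := L) (j := j)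
  simp [adj, div_self h]

theorem adj_adj_mul_mul {j : ℕ} (A : Op L Nt Ns j 0) (C : Op L Nt Ns 0 0) :
    adj L Nt Ns (adj L Nt Ns A * C * A) = adj L Nt Ns A * adj L Nt Ns C * A := by
  rw [adj_eq_transpose, adj_eq_transpose, adj]
  simp only [Matrix.smul_mul, Matrix.transpose_smul, Matrix.transpose_mul,
    Matrix.transpose_transpose, Matrix.mul_assoc]

theorem adj_inv {j : ℕ} (A : Op L Nt Ns j j) : adj L Nt Ns A⁻¹ = (adj L Nt Ns A)⁻¹ := by
  rw [adj_eq_transpose, adj_eq_transpose, Matrix.transpose_nonsing_inv]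

/-- As `𝔔_n` is symmetric, transposition only replaces `D_n` by its adjoint. The adjoint being
bilinear, `μ` is not conjugated. -/
theorem adj_Sinv (hL : Odd L) (q : ℕ) (a : ℝ) (h : (Fin 3 → ℤ) → ℂ) (n : ℕ) (μ : ℂ) :
    adj L Nt Ns (Sinv L Nt Ns q a h n μ) = adj L Nt Ns (Dop L Nt Ns h n) +
      adj L Nt Ns (Qavg L Nt Ns q n) * fQ L Nt Ns q a n * Qavg L Nt Ns q n - μ • 1 := by
  have h1 := adj_adj_mul_mul (Qavg L Nt Ns q n) (fQ L Nt Ns q a n)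
  rw [adj_fQ hL, adj_eq_transpose] at h1
  rw [Sinv, adj_eq_transpose, adj_eq_transpose, Matrix.transpose_sub, Matrix.transpose_add, h1,
    Matrix.transpose_smul, Matrix.transpose_one]

theorem isDiag_adj_Dop {h : (Fin 3 → ℤ) → ℂ} {hhat : (Fin 3 → ℂ) → ℂ}
    (hh : IsKineticOperator h hhat) (n : ℕ) :
    IsDiag (symb fun z => kinSymb L n hhat (-z)) (adj L Nt Ns (Dop L Nt Ns h n)) :=
  (isDiag_Dop hh n).adj.congr fun p => symb_neg (hasPeriods_kinSymb hh n) p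

end

end BlockSpin

/-! ### Assembly of all the Green's functions from one estimate -/

theorem mainTheorem9 (q : ℕ) (hq : 4 ≤ q) (hq_even : Even q) :
    ∃ Γ₂ : ℝ, ∀ (a : ℝ), 0 < a →
      ∀ (h : (Fin 3 → ℤ) → ℂ) (hhat : (Fin 3 → ℂ) → ℂ), IsKineticOperator h hhat →
        ∃ μup m₇ Γ₁₅ : ℝ, 0 < μup ∧ 0 < m₇ ∧
          ∀ (L : ℕ) [NeZero L], Odd L → Γ₂ < (L : ℝ) →
          ∀ (n : ℕ), 1 ≤ n →
          ∀ (Nt Ns : ℕ) [NeZero Nt] [NeZero Ns] (μ : ℂ), ‖μ‖ ≤ μup →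
            -- the operators in the statement are well defined
            (IsUnit (fQinv L Nt Ns q n) ∧ IsUnit (Sinv L Nt Ns q a h n μ) ∧
              ∀ ν : Fin 4, IsUnit (SplusInv L Nt Ns q a h n ν μ) ∧
                IsUnit (SminusInv L Nt Ns q a h n ν μ)) ∧
            HasInverseBound L Nt Ns m₇ Γ₁₅
              (gram L Nt Ns ((Sinv L Nt Ns q a h n μ)⁻¹ *
                adj L Nt Ns (Qavg L Nt Ns q n) * fQ L Nt Ns q a n)) ∧
            HasInverseBound L Nt Ns m₇ Γ₁₅
              (gram L Nt Ns (adj L Nt Ns ((Sinv L Nt Ns q a h n μ)⁻¹) *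
                adj L Nt Ns (Qavg L Nt Ns q n) * fQ L Nt Ns q a n)) ∧
            ∀ ν : Fin 4,
              HasInverseBound L Nt Ns m₇ Γ₁₅
                (gram L Nt Ns ((SplusInv L Nt Ns q a h n ν μ)⁻¹ *
                  Qplus L Nt Ns q n ν * fQ L Nt Ns q a n)) ∧
              HasInverseBound L Nt Ns m₇ Γ₁₅
                (gram L Nt Ns ((SminusInv L Nt Ns q a h n ν μ)⁻¹ *
                  Qplus L Nt Ns q n ν * fQ L Nt Ns q a n)) := by
  -- Only `L ≥ 2` is needed, for the geometric sums over scales.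
  refine ⟨1, fun a ha h hhat hh => ?_⟩
  obtain ⟨C, c, m, hC, hc, hc1, hm0, hm, hdisp⟩ := hh.exists_isDispersion
  obtain ⟨m', B, μup, hm', hμup, hbd⟩ :=
    exists_gramInvBound (q := q) (by lia) ha hC hc hc1 hm0 hm
  refine ⟨μup, m' / 16, B * expSum (m' / 2) * expSum (m' / 16) ^ 4, hμup, by positivity,
    fun L _ hL hL1 n _ Nt Ns _ _ μ hμ => ?_⟩
  have hL2 : 2 ≤ L := by exact_mod_cast hL1
  have hper := hasPeriods_kinSymb (L := L) hh n
  have hvol := fun e => hasPeriods_volSymb hL n e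
  have hq1 : 1 ≤ q := by lia
  have hconj : ∀ p : Fin 4 → ℝ, kinSymb L n hhat (-fun ν => (p ν : ℂ)) =
      (starRingEnd ℂ) (kinSymb L n hhat fun ν => (p ν : ℂ)) := kinSymb_neg_ofReal hh L n
  -- `hbd1` serves the Green's functions built on `D_n`, and `hbd2` those built on its adjoint, with
  -- `D` and its reflection exchanged.
  have hbd1 : ∀ e : Fin 4 → ℕ, (∀ ν, Even (e ν)) → (∀ ν, 2 ≤ e ν) → (∀ ν, e ν ≤ 2 * q) →
      GramInvBound m' B L q n a e (kinSymb L n hhat) (fun z => kinSymb L n hhat (-z)) μ :=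
    fun e he he2 heq => hbd L n hL hL2 e he he2 heq _ _ (hdisp L n) (hdisp L n).neg hconj μ hμ
  have hbd2 : ∀ e : Fin 4 → ℕ, (∀ ν, Even (e ν)) → (∀ ν, 2 ≤ e ν) → (∀ ν, e ν ≤ 2 * q) →
      GramInvBound m' B L q n a e (fun z => kinSymb L n hhat (-z))
        (fun z => kinSymb L n hhat (- -z)) μ :=
    fun e he he2 heq => hbd L n hL hL2 e he he2 heq _ _ (hdisp L n).neg (hdisp L n).neg.neg
      (fun p => by simp only [neg_neg, hconj, Complex.conj_conj]) μ hμ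
  have hv1 : ∀ z, volSymb L n (fun _ => q) z * volSymb L n (fun _ => q) z =
      volSymb L n (fun _ => 2 * q) z := fun z => by
    rw [volSymb_mul]
    congr 1
    funext ν
    simp [two_mul]
  have hv2 : ∀ z, volSymb L n (fun _ => q) z * volSymb L n (fun _ => q) (-z) =
      volSymb L n (fun _ => 2 * q) z := fun z => by rw [volSymb_neg, hv1]
  have hS := isUnit_and_hasInverseBound hL ha hm' hper (hvol _) hv1 hv2
    (isDiag_Dop (Nt := Nt) (Ns := Ns) hh n) (isUp_adj_Qavg hL q n) (isDown_Qavg hL q n)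
    (hbd1 _ (fun _ => even_two_mul q) (fun _ => by lia) fun _ => le_rfl)
  have hSadj := isUnit_and_hasInverseBound hL ha hm' hper.neg (hvol _) hv1 hv2
    (isDiag_adj_Dop (Nt := Nt) (Ns := Ns) hh n) (isUp_adj_Qavg hL q n) (isDown_Qavg hL q n)
    (hbd2 _ (fun _ => even_two_mul q) (fun _ => by lia) fun _ => le_rfl)
  -- In the Gram weight for `Q^(+)` the exponent in direction `ν` drops to `2(q - 1)`, which is
  -- still even and at least `2`.
  have he : ∀ ν ν', Even ((2 * plusExp q ν) ν') ∧ 2 ≤ (2 * plusExp q ν) ν' ∧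
      (2 * plusExp q ν) ν' ≤ 2 * q := fun ν ν' => by
    have h1 : (2 * plusExp q ν) ν' = 2 * plusExp q ν ν' := rfl
    rw [h1]
    refine ⟨even_two_mul _, ?_, ?_⟩ <;> simp only [plusExp] <;> split_ifs <;> lia
  have hplus := fun ν => isUnit_and_hasInverseBound hL ha hm' hper.neg
    (hasPeriods_plusSymb hL q n ν) (minusSymb_mul_plusSymb hq1 n ν) (plusSymb_mul_neg q n ν)
    (isDiag_adj_Dop (Nt := Nt) (Ns := Ns) hh n) (isUp_Qplus hq1 hL n ν) (isDown_Qminus hq1 hL n ν)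
    (hbd2 _ (fun ν' => (he ν ν').1) (fun ν' => (he ν ν').2.1) fun ν' => (he ν ν').2.2)
  have hminus := fun ν => isUnit_and_hasInverseBound hL ha hm' hper
    (hasPeriods_plusSymb hL q n ν) (minusSymb_mul_plusSymb hq1 n ν) (plusSymb_mul_neg q n ν)
    (isDiag_Dop (Nt := Nt) (Ns := Ns) hh n) (isUp_Qplus hq1 hL n ν) (isDown_Qminus hq1 hL n ν)
    (hbd1 _ (fun ν' => (he ν ν').1) (fun ν' => (he ν ν').2.1) fun ν' => (he ν ν').2.2)
  have hfQ := ((isDiag_fQinv_fqSymb (Nt := Nt) (Ns := Ns) hL q n).isUnit_and_inv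
    fun k => fqSymb_unitMomC_ne_zero hL q n k).1
  refine ⟨⟨hfQ, hS.1, fun ν => ⟨(hplus ν).1, (hminus ν).1⟩⟩, hS.2, ?_,
    fun ν => ⟨(hplus ν).2, (hminus ν).2⟩⟩
  -- The adjoint of `S_n(μ)` is the Green's function with `D_n^*` in place of `D_n`.
  rw [adj_inv, adj_Sinv hL]
  exact hSadj.2
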